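/- Let $Q$ be a quiver with finite sets of nodes $Q_0$ and arrows $Q_1$, with an involution $\sigma$, that is, involutions of $Q_0$ and $Q_1$ such that every arrow $\alpha:i\to j$ is sent to an arrow $\sigma(\alpha):\sigma(j)\to\sigma(i)$ and every arrow $i\to\sigma(i)$ is fixed. Let $(s,\tau)$ be a duality structure: functions $s:Q_0\to\{\pm1\}$, $\tau:Q_1\to\{\pm1\}$ with $s_{\sigma(i)}=s_i$ and $\tau_\alpha\tau_{\sigma(\alpha)}=s_is_j$ for every arrow $\alpha:i\to j$. Let $k=\mathbb F_q$ be a finite field of odd characteristic. All representations are finite dimensional over $k$. A self-dual representation is a representation $M$ with a non-degenerate bilinear form on $\bigoplus_{i\in Q_0}M_i$ such that $M_i\perp M_j$ unless $i=\sigma(j)$; $\langle x,x'\rangle=s_i\langle x',x\rangle$ on $M_i+M_{\sigma(i)}$; and $\langle m_\alpha x,x'\rangle=\tau_\alpha\langle x,m_{\sigma(\alpha)}x'\rangle$ for all $\alpha:i\to j$, $x\in M_i$, $x'\in M_{\sigma(j)}$. Its isometry group is denoted $\mathrm{Aut}_S(M)$. Put $\Lambda_Q=\mathbb ZQ_0$,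 $\Lambda_Q^+=\mathbb Z_{\ge0}Q_0$, let $\Lambda_Q^{\sigma,+}$ be the set of $\sigma$-invariant elements of $\Lambda_Q^+$, and let $H(d)=d+\sigma(d)$. Let $\chi(d,d')=\sum_{i}d_id'_i-\sum_{\alpha:i\to j}d_id'_j$, $\langle d,d'\rangle=\chi(d,d')-\chi(d',d)$ and $$\mathcal E(d)=\sum_{i\in Q_0^\sigma}\tfrac{d_i(d_i-s_i)}2+\sum_{i\in Q_0^+}d_{\sigma(i)}d_i-\sum_{\alpha:\sigma(i)\to i\,\in Q_1^\sigma}\tfrac{d_i(d_i+\tau_\alpha s_i)}2-\sum_{\alpha:i\to j\,\in Q_1^+}d_{\sigma(i)}d_j ,$$ where $Q_0^\sigma,Q_1^\sigma$ are the sets of fixed nodes and arrows and $Q_0^+,Q_1^+$ contain exactly one element of each two-element $\sigma$-orbit (the choice does not matter). Let $\hat{\mathbb T}_Q$ be the algebra of formal series $\sum_{d\in\Lambda_Q^+}f_dx_d$ with coefficients in $\mathbb Q(q^{1/2})\subset\mathbb R$ and product $x_dx_{d'}=q^{\frac12\langle d,d'\rangle}x_{d+d'}$. Let $\hat{\mathbb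 S}_Q$ be the space of formal series $\sum_{e\in\Lambda_Q^{\sigma,+}}g_e\xi_e$ with coefficients in $\mathbb Q(q^{1/2})$, on which $\hat{\mathbb T}_Q$ acts by $$x_d\star\xi_e=q^{\frac12(\langle d,e\rangle+\mathcal E(\sigma(d))-\mathcal E(d))}\,\xi_{H(d)+e}.$$ A stability is a homomorphism $\theta:\Lambda_Q\to\mathbb Z$; it is $\sigma$-compatible if $\theta(\sigma(d))=-\theta(d)$ for all $d$. The slope of a nonzero representation $U$ is $\mu(U)=\theta(\mathbf{dim}\,U)/\dim U$. A representation $U$ is semistable if $\mu(V)\le\mu(U)$ for all nonzero proper subrepresentations $V$; a self-dual representation $M$ is semistable if $\mu(V)\le\mu(M)$ for all nonzero isotropic subrepresentations $V$ (zero representations are semistable). For a $\sigma$-compatible stability $\theta$ put $$A_\mu^\theta=\sum_{U}\frac{q^{\frac12\chi(\mathbf{dim}\,U,\mathbf{dim}\,U)}}{\#\mathrm{Aut}(U)}\,x_{\mathbf{dim}\,U}\in\hat{\mathbb T}_Q,\qquad A^{\sigma,\theta}=\sum_{M}\frac{q^{\frac12\mathcal E(\mathbf{dim}\,M)}}{\#\mathrm{Aut}_S(M)}\,\xi_{\mathbf{dim}\,M}\in\hat{\mathbb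 S}_Q,$$ where $U$ runs over the isomorphism classes of semistable representations that are zero or of slope $\mu$, and $M$ over the isometry classes of semistable self-dual representations. **Theorem (orientifold wall-crossing formula).** For any two $\sigma$-compatible stabilities $\theta$ and $\theta'$ the identity $$\overset{\longleftarrow}{\prod_{\mu\in\mathbb Q_{>0}}}A_\mu^{\theta}\star A^{\sigma,\theta}=\overset{\longleftarrow}{\prod_{\mu\in\mathbb Q_{>0}}}A_\mu^{\theta'}\star A^{\sigma,\theta'}$$ holds in $\hat{\mathbb S}_Q$. Here the factors are ordered with $\mu$ decreasing from left to right, and both infinite products converge in $\hat{\mathbb T}_Q$: each coefficient of the products over finite sets of slopes, directed by inclusion, is eventually constant. -/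

import Mathlib

/-! Self-dual representations of a quiver with involution over a finite field, the quantum torus and
its module, and the (orientifold) Donaldson-Thomas series. -/

noncomputable section

namespace OrientifoldDT

universe u v w

/-! ### Quivers with involution and duality structures -/

/-- A quiver with nodes `I` and arrows `A`; `a` is an arrow `src a ⟶ tgt a`. -/
structure FQuiver (I : Type u) (A : Type v) where
  src : A → I
  tgt : A → I

/-- An involution of a quiver: it reverses arrows and fixes every arrow `i ⟶ σ i`. -/
structure FQuiver.Involution {I : Type u} {A : Type v} (Q : FQuiver I A) where
  node : I → I
  arrow : A → A
  node_involutive : Function.Involutive node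
  arrow_involutive : Function.Involutive arrow
  src_arrow : ∀ a, Q.src (arrow a) = node (Q.tgt a)
  tgt_arrow : ∀ a, Q.tgt (arrow a) = node (Q.src a)
  arrow_fixed : ∀ a, Q.tgt a = node (Q.src a) → arrow a = a

/-- A duality structure `(s, τ)` on a quiver with involution. -/
structure DualityStructure {I : Type u} {A : Type v} {Q : FQuiver I A} (σ : Q.Involution) where
  s : I → ℤˣ
  τ : A → ℤˣ
  s_node : ∀ i, s (σ.node i) = s i
  τ_mul : ∀ a, τ a * τ (σ.arrow a) = s (Q.src a) * s (Q.tgt a)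

section Lattice

variable {I : Type u} {A : Type v} {Q : FQuiver I A}

/-- A dimension vector, viewed in the lattice `Λ_Q = ℤ Q₀`. -/
def toLat (d : I → ℕ) : I → ℤ := fun i => (d i : ℤ)

/-- The action of `σ` on vectors indexed by the nodes: `σ (∑ dᵢ i) = ∑ dᵢ σ(i)`. -/
def FQuiver.Involution.act {R : Type*} (σ : Q.Involution) (d : I → R) : I → R :=
  fun i => d (σ.node i)

/-- The hyperbolic map `H(d) = d + σ(d)`. -/
def FQuiver.Involution.hyp (σ : Q.Involution) (d : I → ℕ) : I → ℕ := d + σ.act d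

/-- The `σ`-invariant dimension vectors. -/
def FQuiver.Involution.InvDim (σ : Q.Involution) : Type u :=
  {e : I → ℕ // σ.act e = e}

/-- A stability `θ ∈ Hom(Λ_Q, ℤ)` is `σ`-compatible if `σ* θ = - θ`. -/
def FQuiver.Involution.Compatible (σ : Q.Involution) (θ : Module.Dual ℤ (I → ℤ)) : Prop :=
  ∀ d : I → ℤ, θ (σ.act d) = - θ d

variable [Fintype I] [Fintype A]

/-- The Euler form. -/
def FQuiver.euler (Q : FQuiver I A) (d d' : I → ℤ) : ℤ :=
  ∑ i, d i * d' i - ∑ a, d (Q.src a) * d' (Q.tgt a)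

/-- The skew-symmetrised Euler form. -/
def FQuiver.skew (Q : FQuiver I A) (d d' : I → ℤ) : ℤ := Q.euler d d' - Q.euler d' d

/-- The slope `θ(d) / dim d` of a dimension vector; it is only used for `d ≠ 0`. -/
def slope (θ : Module.Dual ℤ (I → ℤ)) (d : I → ℕ) : ℚ :=
  (θ (toLat d) : ℚ) / ((∑ i, d i : ℕ) : ℚ)

variable [DecidableEq I] [DecidableEq A]

/-- The Euler form `𝓔` of the category with duality. The sums over `Q₀⁺` and `Q₁⁺` are written as
one half of the sums over all nodes, respectively arrows, that are not fixed by `σ`. All divisions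
are exact; see `sdEuler_eq`. -/
def DualityStructure.sdEuler {σ : Q.Involution} (D : DualityStructure σ) (d : I → ℤ) : ℤ :=
  ∑ i with σ.node i = i, d i * (d i - D.s i) / 2
    + (∑ i with σ.node i ≠ i, d (σ.node i) * d i) / 2
    - ∑ a with σ.arrow a = a, d (Q.tgt a) * (d (Q.tgt a) + D.τ a * D.s (Q.tgt a)) / 2
    - (∑ a with σ.arrow a ≠ a, d (σ.node (Q.src a)) * d (Q.tgt a)) / 2

theorem sum_not_fixed {X : Type*} [Fintype X] [DecidableEq X] (f : X → X)
    (hf : Function.Involutive f) (g : X → ℤ) (hg : ∀ x, g (f x) = g x) (P : Finset X)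
    (h₁ : ∀ x ∈ P, f x ∉ P) (h₂ : ∀ x, f x ≠ x → x ∈ P ∨ f x ∈ P) :
    ∑ x with f x ≠ x, g x = 2 * ∑ x ∈ P, g x := by
  have hu : (Finset.univ.filter fun x => f x ≠ x) = P ∪ P.image f := by
    ext x
    simp only [Finset.mem_filter, Finset.mem_univ, true_and, Finset.mem_union, Finset.mem_image]
    constructor
    · intro hx
      rcases h₂ x hx with h | h
      · exact Or.inl h
      · exact Or.inr ⟨f x, h, hf x⟩
    · rintro (h | ⟨y, hy, rfl⟩) e
      · exact h₁ x h (by rw [e]; exact h)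
      · rw [hf y] at e
        exact h₁ y hy (by rw [← e]; exact hy)
  have hd : Disjoint P (P.image f) := by
    rw [Finset.disjoint_left]
    intro x hx hx'
    obtain ⟨y, hy, rfl⟩ := Finset.mem_image.1 hx'
    exact h₁ y hy hx
  rw [hu, Finset.sum_union hd, Finset.sum_image fun x _ y _ h => hf.injective h]
  simp only [hg]
  ring

/-- For every choice of `Q₀⁺` and `Q₁⁺`, the function `𝓔` is given by the usual formula. -/
theorem DualityStructure.sdEuler_eq {σ : Q.Involution} (D : DualityStructure σ) (d : I → ℤ)
    (P₀ : Finset I) (P₁ : Finset A)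
    (h₀ : ∀ i ∈ P₀, σ.node i ∉ P₀) (h₀' : ∀ i, σ.node i ≠ i → i ∈ P₀ ∨ σ.node i ∈ P₀)
    (h₁ : ∀ a ∈ P₁, σ.arrow a ∉ P₁) (h₁' : ∀ a, σ.arrow a ≠ a → a ∈ P₁ ∨ σ.arrow a ∈ P₁) :
    (D.sdEuler d : ℚ) =
      ∑ i with σ.node i = i, (d i * (d i - D.s i) : ℚ) / 2
      + ∑ i ∈ P₀, (d (σ.node i) * d i : ℚ)
      - ∑ a with σ.arrow a = a,
          (d (Q.tgt a) * (d (Q.tgt a) + D.τ a * D.s (Q.tgt a)) : ℚ) / 2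
      - ∑ a ∈ P₁, (d (σ.node (Q.src a)) * d (Q.tgt a) : ℚ) := by
  have key : ∀ (x : ℤ) (ε : ℤˣ), ((x * (x + ε) / 2 : ℤ) : ℚ) = (x * (x + (ε : ℤ)) : ℚ) / 2 := by
    intro x ε
    have h2 : (2 : ℤ) ∣ x * (x + ε) := by
      rcases Int.units_eq_one_or ε with rfl | rfl
      · exact (Int.even_mul_succ_self x).two_dvd
      · have := (Int.even_mul_pred_self x).two_dvd
        simpa [sub_eq_add_neg] using this
    rw [Int.cast_div h2 (by norm_num)]
    push_cast
    ring
  have e₀ := sum_not_fixed σ.node σ.node_involutive (fun i => d (σ.node i) * d i)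
    (fun i => by simp only [σ.node_involutive i]; ring) P₀ h₀ h₀'
  have e₁ := sum_not_fixed σ.arrow σ.arrow_involutive
    (fun a => d (σ.node (Q.src a)) * d (Q.tgt a))
    (fun a => by simp only [σ.src_arrow, σ.tgt_arrow, σ.node_involutive (Q.tgt a)]; ring) P₁ h₁ h₁'
  unfold DualityStructure.sdEuler
  rw [e₀, e₁, Int.mul_ediv_cancel_left _ two_ne_zero, Int.mul_ediv_cancel_left _ two_ne_zero]
  push_cast
  congr 1
  congr 1
  · congr 1
    refine Finset.sum_congr rfl fun i _ => ?_
    have := key (d i) (- D.s i)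
    push_cast at this
    simpa [sub_eq_add_neg] using this
  · refine Finset.sum_congr rfl fun a _ => ?_
    have := key (d (Q.tgt a)) (D.τ a * D.s (Q.tgt a))
    push_cast at this
    exact this

end Lattice

/-! ### Representations -/

/-- A finite dimensional representation of `Q` over `k`. -/
structure Rep {I : Type u} {A : Type v} (Q : FQuiver I A) (k : Type w) [Field k] where
  V : I → Type w
  [grp : ∀ i, AddCommGroup (V i)]
  [mod : ∀ i, Module k (V i)]
  [fin : ∀ i, FiniteDimensional k (V i)]
  map : ∀ a, V (Q.src a) →ₗ[k] V (Q.tgt a)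

attribute [instance] Rep.grp Rep.mod Rep.fin

namespace Rep

variable {I : Type u} {A : Type v} {Q : FQuiver I A} {k : Type w} [Field k]

/-- The dimension vector. -/
def dim (U : Rep Q k) : I → ℕ := fun i => Module.finrank k (U.V i)

/-- Isomorphisms of representations. -/
def Iso (U V : Rep Q k) : Type (max u w) :=
  {φ : ∀ i, U.V i ≃ₗ[k] V.V i // ∀ a x, φ (Q.tgt a) (U.map a x) = V.map a (φ (Q.src a) x)}

/-- Isomorphism of representations, as an equivalence relation. -/
instance isoSetoid (Q : FQuiver I A) (k : Type w) [Field k] : Setoid (Rep Q k) where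
  r U V := Nonempty (U.Iso V)
  iseqv :=
    { refl := fun U => ⟨⟨fun i => LinearEquiv.refl k (U.V i), fun _ _ => rfl⟩⟩
      symm := by
        rintro U V ⟨φ, h⟩
        refine ⟨⟨fun i => (φ i).symm, fun a x => ?_⟩⟩
        rw [LinearEquiv.symm_apply_eq, h, LinearEquiv.apply_symm_apply]
      trans := by
        rintro U V W ⟨φ, h⟩ ⟨ψ, h'⟩
        refine ⟨⟨fun i => (φ i).trans (ψ i), fun a x => ?_⟩⟩
        simp only [LinearEquiv.trans_apply, h, h'] }

/-- The graded subspace `W` is a subrepresentation of `U`. -/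
def IsSubrep (U : Rep Q k) (W : ∀ i, Submodule k (U.V i)) : Prop :=
  ∀ a, ∀ x ∈ W (Q.src a), U.map a x ∈ W (Q.tgt a)

/-- The dimension vector of a graded subspace. -/
def subDim (U : Rep Q k) (W : ∀ i, Submodule k (U.V i)) : I → ℕ :=
  fun i => Module.finrank k (W i)

/-- Semistability: no proper nonzero subrepresentation has bigger slope. -/
def Semistable [Fintype I] (U : Rep Q k) (θ : Module.Dual ℤ (I → ℤ)) : Prop :=
  ∀ W : ∀ i, Submodule k (U.V i), U.IsSubrep W → W ≠ (fun _ => ⊥) → W ≠ (fun _ => ⊤) →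
    slope θ (U.subDim W) ≤ slope θ U.dim

end Rep

/-! ### Self-dual representations -/

/-- A self-dual representation: a representation with a non-degenerate bilinear form on its total
space `⨁ Mᵢ` (a finite product), satisfying the conditions prescribed by `(s, τ)`. -/
structure SDRep {I : Type u} {A : Type v} [DecidableEq I] {Q : FQuiver I A} {σ : Q.Involution}
    (D : DualityStructure σ) (k : Type w) [Field k] extends Rep Q k where
  form : LinearMap.BilinForm k (∀ i, V i)
  nondegenerate : form.Nondegenerate
  orthogonal : ∀ i j, i ≠ σ.node j → ∀ (x : V i) (y : V j),
    form (Pi.single i x) (Pi.single j y) = 0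
  symmetric : ∀ i, ∀ x y : ∀ j, V j, (∀ j, j ≠ i → j ≠ σ.node i → x j = 0 ∧ y j = 0) →
    form x y = ((D.s i : ℤ) : k) * form y x
  compatible : ∀ a (x : V (Q.src a)) (y : V (Q.src (σ.arrow a))),
    form (Pi.single (Q.tgt a) (map a x)) (Pi.single (Q.src (σ.arrow a)) y)
      - ((D.τ a : ℤ) : k) *
        form (Pi.single (Q.src a) x) (Pi.single (Q.tgt (σ.arrow a)) (map (σ.arrow a) y)) = 0

namespace SDRep

variable {I : Type u} {A : Type v} [DecidableEq I] {Q : FQuiver I A} {σ : Q.Involution}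
  {D : DualityStructure σ} {k : Type w} [Field k]

/-- Isometries of self-dual representations. -/
def Isometry (M N : SDRep D k) : Type (max u w) :=
  {φ : M.toRep.Iso N.toRep // ∀ x y : ∀ i, M.V i,
    N.form (fun i => φ.1 i (x i)) (fun i => φ.1 i (y i)) = M.form x y}

/-- Isometry of self-dual representations, as an equivalence relation. -/
instance isometrySetoid (D : DualityStructure σ) (k : Type w) [Field k] :
    Setoid (SDRep D k) where
  r M N := Nonempty (M.Isometry N)
  iseqv :=
    { refl := fun M => ⟨⟨⟨fun i => LinearEquiv.refl k (M.V i), fun _ _ => rfl⟩, fun _ _ => rfl⟩⟩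
      symm := by
        rintro M N ⟨⟨φ, h⟩, hφ⟩
        refine ⟨⟨⟨fun i => (φ i).symm, fun a x => ?_⟩, fun x y => ?_⟩⟩
        · rw [LinearEquiv.symm_apply_eq, h, LinearEquiv.apply_symm_apply]
        · rw [← hφ]
          simp only [LinearEquiv.apply_symm_apply]
      trans := by
        rintro L M N ⟨⟨φ, h⟩, hφ⟩ ⟨⟨ψ, h'⟩, hψ⟩
        refine ⟨⟨⟨fun i => (φ i).trans (ψ i), fun a x => ?_⟩, fun x y => ?_⟩⟩
        · simp only [LinearEquiv.trans_apply, h, h']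
        · simp only [LinearEquiv.trans_apply]
          rw [hψ (fun i => φ i (x i)) (fun i => φ i (y i)), hφ] }

/-- A graded subspace is isotropic if it lies in its own orthogonal. -/
def IsIsotropic (M : SDRep D k) (W : ∀ i, Submodule k (M.V i)) : Prop :=
  ∀ x y : ∀ i, M.V i, (∀ i, x i ∈ W i) → (∀ i, y i ∈ W i) → M.form x y = 0

/-- Semistability of self-dual representations: it is tested on nonzero isotropic
subrepresentations. -/
def Semistable [Fintype I] (M : SDRep D k) (θ : Module.Dual ℤ (I → ℤ)) : Prop :=
  ∀ W : ∀ i, Submodule k (M.V i), M.toRep.IsSubrep W → M.IsIsotropic W → W ≠ (fun _ => ⊥) →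
    slope θ (M.toRep.subDim W) ≤ slope θ M.toRep.dim

end SDRep

/-! ### The coefficient field, the quantum torus and its module -/

/-- The field `ℚ(q^{1/2}) ⊆ ℝ`, where `q` is the number of elements of `k`. -/
abbrev QField (k : Type w) : Type := IntermediateField.adjoin ℚ {Real.sqrt (Nat.card k : ℝ)}

/-- The element `q^{1/2}` of `ℚ(q^{1/2})`. -/
def sqrtq (k : Type w) : QField k := IntermediateField.AdjoinSimple.gen ℚ (Real.sqrt (Nat.card k : ℝ))

/-- The quantum torus: the series `∑ f(d) x_d` over all dimension vectors `d`, as functions `f`. -/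
def QTorus {I : Type u} {A : Type v} (_Q : FQuiver I A) (k : Type w) : Type u :=
  (I → ℕ) → QField k

/-- The module of the quantum torus: the series `∑ g(e) ξ_e` over all `σ`-invariant dimension
vectors `e`, as functions `g`. -/
def QModule {I : Type u} {A : Type v} {Q : FQuiver I A} {σ : Q.Involution}
    (_D : DualityStructure σ) (k : Type w) : Type u :=
  σ.InvDim → QField k

section Torus

variable {I : Type u} {A : Type v} [Fintype I] [DecidableEq I] [Fintype A] {Q : FQuiver I A}
  {k : Type w}

/-- The unit `x_0`. -/
instance : One (QTorus Q k) := ⟨fun d => if d = 0 then 1 else 0⟩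

/-- The product with `x_a x_b = q^{⟨a, b⟩ / 2} x_{a + b}`, extended to series. -/
instance : Mul (QTorus Q k) :=
  ⟨fun f g d => ∑ a ∈ Finset.Iic d,
    sqrtq k ^ Q.skew (toLat a) (toLat (d - a)) * f a * g (d - a)⟩

/-- The invariant dimension vector `e - H(d)`, for `H(d) ≤ e`. -/
def FQuiver.Involution.InvDim.subHyp {σ : Q.Involution} (e : σ.InvDim) (d : I → ℕ) : σ.InvDim :=
  ⟨e.1 - σ.hyp d, by
    funext i
    have h := congrFun e.2 i
    simp only [FQuiver.Involution.act] at h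
    simp only [FQuiver.Involution.act, FQuiver.Involution.hyp, Pi.sub_apply, Pi.add_apply,
      σ.node_involutive i, h]
    omega⟩

/-- The action with `x_d ⋆ ξ_e = q^{(⟨d, e⟩ + 𝓔(σ d) - 𝓔(d)) / 2} ξ_{H(d) + e}`, extended to
series. -/
instance [DecidableEq A] {σ : Q.Involution} {D : DualityStructure σ} :
    SMul (QTorus Q k) (QModule D k) :=
  ⟨fun f g e => ∑ d ∈ Finset.Iic e.1 with ∀ i, σ.hyp d i ≤ e.1 i,
    sqrtq k ^ (Q.skew (toLat d) (toLat (e.subHyp d).1)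
        + D.sdEuler (σ.act (toLat d)) - D.sdEuler (toLat d))
      * f d * g (e.subHyp d)⟩

/-- `P` is the infinite product of the `f μ` over all positive rational numbers `μ`, the factors
being ordered with `μ` decreasing from left to right: every coefficient of the finite partial
products is eventually equal to the coefficient of `P`. -/
def IsSlopeProduct (f : {μ : ℚ // 0 < μ} → QTorus Q k) (P : QTorus Q k) : Prop :=
  ∀ d, ∀ᶠ F : Finset {μ : ℚ // 0 < μ} in Filter.atTop,
    ((F.sort (· ≥ ·)).map f).prod d = P d

theorem IsSlopeProduct.unique {f : {μ : ℚ // 0 < μ} → QTorus Q k} {P P' : QTorus Q k}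
    (h : IsSlopeProduct f P) (h' : IsSlopeProduct f P') : P = P' := by
  funext d
  obtain ⟨F, hF, hF'⟩ := ((h d).and (h' d)).exists
  exact hF.symm.trans hF'

/-! ### Donaldson-Thomas series -/

/-- `A_μ^θ`: the sum over the isomorphism classes of `θ`-semistable representations `U` that are zero
or of slope `μ` of `q^{χ(U, U) / 2} / #Aut(U)` times `x_{dim U}`. -/
def dtSeries (Q : FQuiver I A) (k : Type w) [Field k] (θ : Module.Dual ℤ (I → ℤ)) (μ : ℚ) :
    QTorus Q k := fun d => by
  classical
  exact if d = 0 ∨ slope θ d = μ then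
    ∑ᶠ (c : Quotient (Rep.isoSetoid Q k)) (_ : c.out.dim = d ∧ c.out.Semistable θ),
      sqrtq k ^ Q.euler (toLat d) (toLat d) / (Nat.card (c.out.Iso c.out) : QField k)
  else 0

/-- `A^{σ,θ}`: the sum over the isometry classes of `θ`-semistable self-dual representations `M` of
`q^{𝓔(dim M) / 2} / #Aut_S(M)` times `ξ_{dim M}`. -/
def oriDTSeries [DecidableEq A] {σ : Q.Involution} (D : DualityStructure σ) (k : Type w) [Field k]
    (θ : Module.Dual ℤ (I → ℤ)) : QModule D k := fun e =>
  ∑ᶠ (c : Quotient (SDRep.isometrySetoid D k))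
    (_ : c.out.toRep.dim = e.1 ∧ c.out.Semistable θ),
    sqrtq k ^ D.sdEuler (toLat e.1) / (Nat.card (c.out.Isometry c.out) : QField k)

end Torus

end OrientifoldDT

end

noncomputable section

namespace OrientifoldDT

universe u₁ u₂

set_option linter.unusedSectionVars false

/-! Both sides equal one series that does not involve the stability. Its coefficient at `ξ_e` is
`q^{𝓔(e)/2}` times the number of all self-dual representations on the coordinate space of dimension
vector `e`, divided by the order of `GL_e` (`smul_eq_total`).

The reason is a canonical reduction. Every self-dual representation `M` has exactly one isotropic
subrepresentation `U` such that all nonzero quotients of `U` have positive degree and `U^⊥/U` is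
semistable. For existence, take `U` of maximal degree among the isotropic subrepresentations, and of
minimal dimension among those (`exists_positive_semistableReduction`). For uniqueness, compatibility
of the stability makes the degree invariant under `W ↦ W^⊥`, and two candidates are compared by
modularity of the degree (`positive_semistableReduction_unique`). By ordinary Harder-Narasimhan
theory, all nonzero quotients of `U` have positive degree exactly when all its Harder-Narasimhan
slopes are positive (`HNInterval.positive`, `PositiveInterval.hn`), so the product over `μ > 0`
counts the possible `U`, while `A^{σ,θ}` counts the possible `N = U^⊥/U`. All this is proved in
lattices with two modular functions, degree and rank, and is carried over to subrepresentations and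
quotients by convex embeddings.

The rest is counting. A sum over isomorphism classes weighted by `1/#Aut` is a number of matrix
tuples divided by the order of a graded general linear group (`finsum_quotient_eq`). To count the
tuples that have a distinguished subspace, one moves this subspace to standard position and counts
pairs in two ways (`slice_count`). This gives `hall_count` for extensions of a quotient by a
subrepresentation, and `sd_count` for self-dual representations on `U ⊕ N ⊕ U*`. In the latter, the
free data besides `U` and `N` are the component `U* → N` and a component `U* → U` with a symmetry
condition; the group elements that preserve this shape have the same form. In odd characteristic the
dimensions of the two spaces with symmetry conditions differ by `𝓔(d)` (`sdEuler_eq_of_corner`), so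
that the powers of `q` are `q^{-χ(b,a)}` for an extension of `b` by `a`, and `q^{-𝓔(d)-χ(n,d)}` in
the self-dual case. Identities for the Euler forms (`sdEuler_hyp_add` and the one in
`list_prod_apply`) turn these powers into the twists of the product and of the action. -/

/-! ### Harder-Narasimhan filtrations in lattices -/

section Slopes

variable {L L' : Type*} [Lattice L] [Lattice L'] (deg rk : L → ℤ) (deg' rk' : L' → ℤ)

/-- The degree shifted by `μ` times the rank: it is constant on an interval of slope `μ`. -/
def shift (μ : ℚ) (x : L) : ℚ := deg x - μ * rk x

/-- The interval from `a` to `b` is trivial, or semistable of slope `μ`. -/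
def SemistableInterval (μ : ℚ) (a b : L) : Prop :=
  a ≤ b ∧ shift deg rk μ b = shift deg rk μ a ∧
    ∀ c, a ≤ c → c ≤ b → shift deg rk μ c ≤ shift deg rk μ a

/-- All nontrivial quotients of the interval from `a` to `b` have positive degree. -/
def PositiveInterval (a b : L) : Prop := ∀ c, a ≤ c → c < b → deg c < deg b

/-- The interval from `a` to `b` has a filtration by semistable intervals with slopes in the list. -/
def HNInterval : List ℚ → L → L → Prop
  | [], a, b => a = b
  | μ :: l, a, b => ∃ c, c ≤ b ∧ SemistableInterval deg rk μ a c ∧ HNInterval l c b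

variable {deg rk deg' rk'}

theorem HNInterval.le {l : List ℚ} {a b : L} (h : HNInterval deg rk l a b) : a ≤ b := by
  induction l generalizing a with
  | nil => exact le_of_eq h
  | cons μ l ih =>
    obtain ⟨c, -, h₁, h₂⟩ := h
    exact h₁.1.trans (ih h₂)

/-- Degree and rank are modular, and the rank is strictly monotone. -/
structure IsSlopeData (deg rk : L → ℤ) : Prop where
  deg_add : ∀ x y, deg (x ⊔ y) + deg (x ⊓ y) = deg x + deg y
  rk_add : ∀ x y, rk (x ⊔ y) + rk (x ⊓ y) = rk x + rk y
  rk_strictMono : StrictMono rk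

theorem IsSlopeData.shift_add (h : IsSlopeData deg rk) (μ : ℚ) (x y : L) :
    shift deg rk μ (x ⊔ y) + shift deg rk μ (x ⊓ y) = shift deg rk μ x + shift deg rk μ y := by
  have h₁ : (deg (x ⊔ y) + deg (x ⊓ y) : ℚ) = deg x + deg y := by exact_mod_cast h.deg_add x y
  have h₂ : (rk (x ⊔ y) + rk (x ⊓ y) : ℚ) = rk x + rk y := by exact_mod_cast h.rk_add x y
  unfold shift
  linear_combination h₁ - μ * h₂

theorem IsSlopeData.rk_lt (h : IsSlopeData deg rk) {x y : L} (hxy : x < y) :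
    (rk x : ℚ) < rk y := by exact_mod_cast h.rk_strictMono hxy

theorem shift_eq {L : Type*} {deg rk : L → ℤ} (μ ν : ℚ) (x : L) :
    shift deg rk μ x = shift deg rk ν x - (μ - ν) * rk x := by unfold shift; ring

/-- A subquotient of slope at most `ν` has slope less than `μ`. Working with `shift` instead of
quotients of degree and rank keeps everything additive and avoids division by the rank of a trivial
interval. -/
theorem IsSlopeData.shift_lt (h : IsSlopeData deg rk) {μ ν : ℚ} (hμ : ν < μ) {x y : L} (hxy : x < y)
    (hs : shift deg rk ν y ≤ shift deg rk ν x) : shift deg rk μ y < shift deg rk μ x := by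
  rw [shift_eq μ ν, shift_eq μ ν x]
  nlinarith [mul_pos (sub_pos.2 hμ) (sub_pos.2 (h.rk_lt hxy))]

theorem IsSlopeData.shift_le (h : IsSlopeData deg rk) {μ ν : ℚ} (hμ : ν < μ) {x y : L} (hxy : x ≤ y)
    (hs : shift deg rk ν y ≤ shift deg rk ν x) : shift deg rk μ y ≤ shift deg rk μ x := by
  rcases hxy.eq_or_lt with rfl | hxy
  · exact le_rfl
  · exact (h.shift_lt hμ hxy hs).le

/-- Subobjects of an object with all filtration slopes below `μ` have slope below `μ`. By modularity
`c` splits into `c ⊓ w`, controlled by semistability of the first step, and `c ⊔ w`, controlled by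
induction; when `c ≤ w` the strictness comes from the rank. -/
theorem HNInterval.shift_lt (hL : IsSlopeData deg rk) {l : List ℚ} {μ : ℚ} (hl : ∀ ν ∈ l, ν < μ)
    {a b c : L} (h : HNInterval deg rk l a b) (hac : a < c) (hcb : c ≤ b) :
    shift deg rk μ c < shift deg rk μ a := by
  induction l generalizing a c with
  | nil => exact absurd (hac.trans_le hcb) (by rw [show a = b from h]; exact lt_irrefl b)
  | cons ν l ih =>
    obtain ⟨w, hwb, ⟨haw, hs, hss⟩, hw⟩ := h
    have hν := hl ν (by simp)
    have hl' : ∀ ν ∈ l, ν < μ := fun x hx => hl x (by simp [hx])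
    have e := hL.shift_add μ c w
    have h₁ := hss (c ⊓ w) (le_inf hac.le haw) inf_le_right
    rcases (show w ≤ c ⊔ w from le_sup_right).eq_or_lt with h | h
    · rw [← h] at e
      have hcw : c ≤ w := by rw [h]; exact le_sup_left
      rw [inf_eq_left.2 hcw] at h₁
      exact hL.shift_lt hν hac h₁
    · have h₂ := ih hl' hw h (sup_le hcb hwb)
      have h₃ := hL.shift_le hν (le_inf hac.le haw) h₁
      linarith

/-- If `c < c ⊔ c'`, the shift drops strictly from `c` to `c ⊔ c'`, because the remaining slopes are
below `μ`. But `c` and `c'` have the shift of `a`, and `c ⊓ c'` has at most that, so modularity says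
that it cannot drop. -/
theorem HNInterval.unique (hL : IsSlopeData deg rk) {l : List ℚ} {μ : ℚ} (hl : ∀ ν ∈ l, ν < μ)
    {a b c c' : L} (hc : SemistableInterval deg rk μ a c) (hcb : HNInterval deg rk l c b)
    (hc' : SemistableInterval deg rk μ a c') (hcb' : HNInterval deg rk l c' b) : c = c' := by
  have key : ∀ {c c' : L}, SemistableInterval deg rk μ a c → HNInterval deg rk l c b →
      SemistableInterval deg rk μ a c' → HNInterval deg rk l c' b → c' ≤ c := by
    intro c c' hc hcb hc' hcb'
    rcases (show c ≤ c ⊔ c' from le_sup_left).eq_or_lt with h | h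
    · rw [h]; exact le_sup_right
    · have h₁ := hcb.shift_lt hL hl h (sup_le hcb.le hcb'.le)
      have h₂ := hL.shift_add μ c c'
      have h₃ := hc.2.2 (c ⊓ c') (le_inf hc.1 hc'.1) inf_le_left
      have h₄ := hc.2.1
      have h₅ := hc'.2.1
      linarith
  exact le_antisymm (key hc' hcb' hc hcb) (key hc hcb hc' hcb')

/-- A quotient of `b` by `c` splits into a quotient by `c ⊔ w`, of nonnegative degree by induction,
and the quotient of `w` by `c ⊓ w`, of positive degree because `w` is semistable of positive slope;
if the latter is trivial, then `w ≤ c` and induction applies directly. -/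
theorem HNInterval.positive (hL : IsSlopeData deg rk) {l : List ℚ} (hl : ∀ ν ∈ l, 0 < ν)
    {a b : L} (h : HNInterval deg rk l a b) : PositiveInterval deg a b := by
  induction l generalizing a with
  | nil =>
    intro c hac hcb
    exact absurd (hac.trans_lt hcb) (by rw [show a = b from h]; exact lt_irrefl b)
  | cons ν l ih =>
    obtain ⟨w, hwb, ⟨haw, hs, hss⟩, hw⟩ := h
    have hν := hl ν (by simp)
    have hp := ih (fun x hx => hl x (by simp [hx])) hw
    intro c hac hcb
    have e := hL.deg_add c w
    have h₁ := hss (c ⊓ w) (le_inf hac haw) inf_le_right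
    have h₂ : deg (c ⊔ w) ≤ deg b := by
      rcases (sup_le hcb.le hwb).eq_or_lt with h | h
      · rw [h]
      · exact (hp _ le_sup_right h).le
    rcases (show c ⊓ w ≤ w from inf_le_right).eq_or_lt with h | h
    · rw [h] at e
      have : c ⊔ w = c := sup_eq_left.2 (inf_eq_right.1 h)
      exact hp c (inf_eq_right.1 h) hcb
    · have h₃ := hL.rk_lt h
      have h₄ : (deg (c ⊓ w) : ℚ) < deg w := by
        unfold shift at h₁ hs
        nlinarith [mul_pos hν (sub_pos.2 h₃)]
      have h₅ : deg (c ⊓ w) < deg w := by exact_mod_cast h₄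
      omega

/-- Trivial steps are allowed in a filtration, so `l` may be any decreasing list that contains all
the positive slopes of subquotients. The second alternative in `H` is what makes the induction work:
after the step of slope `μ` is split off, `μ` leaves the list, but all subobjects of the rest have
slope below `μ`. -/
theorem PositiveInterval.hn [Finite L] (hL : IsSlopeData deg rk) {l : List ℚ}
    (hl : l.Pairwise (· > ·)) {a b : L} (hab : a ≤ b)
    (hp : PositiveInterval deg a b)
    (H : ∀ c c', a ≤ c → c < c' → c' ≤ b → ∀ ν : ℚ, 0 < ν →
      shift deg rk ν c' = shift deg rk ν c →
        ν ∈ l ∨ ∀ x, a < x → x ≤ b → shift deg rk ν x < shift deg rk ν a) :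
    HNInterval deg rk l a b := by
  have slope_exists : ∀ {x y : L}, x < y → shift deg rk ((deg y - deg x) / (rk y - rk x)) y
      = shift deg rk ((deg y - deg x) / (rk y - rk x)) x := by
    intro x y hxy
    have := sub_pos.2 (hL.rk_lt hxy)
    unfold shift
    field_simp
    ring
  induction l generalizing a with
  | nil =>
    by_contra hne
    have hlt : a < b := lt_of_le_of_ne hab hne
    have h₀ : (0 : ℚ) < (deg b - deg a) / (rk b - rk a) :=
      div_pos (sub_pos.2 (by exact_mod_cast hp a le_rfl hlt)) (sub_pos.2 (hL.rk_lt hlt))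
    rcases H a b le_rfl hlt le_rfl _ h₀ (slope_exists hlt) with h | h
    · simp at h
    · exact absurd (slope_exists hlt) (h b hlt le_rfl).ne
  | cons μ l ih =>
    rw [List.pairwise_cons] at hl
    -- No subobject has slope above the head `μ`: such a slope would have to occur in the list,
    -- whose head is its largest entry, and the other alternative of `H` fails for the subobject
    -- itself.
    have hmax : ∀ x, a ≤ x → x ≤ b → 0 < μ → shift deg rk μ x ≤ shift deg rk μ a := by
      intro x hax hxb hμ
      by_contra! hlt
      have hax' : a < x := lt_of_le_of_ne hax (by rintro rfl; exact lt_irrefl _ hlt)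
      have hr := sub_pos.2 (hL.rk_lt hax')
      have hν : μ < (deg x - deg a) / (rk x - rk a) := by
        rw [lt_div_iff₀ hr]
        unfold shift at hlt
        linarith
      rcases H a x le_rfl hax' hxb _ (hμ.trans hν) (slope_exists hax') with h | h
      · rcases List.mem_cons.1 h with h | h
        · exact hν.ne' h
        · exact absurd (hl.1 _ h) (not_lt.2 hν.le)
      · exact absurd (slope_exists hax') (h x hax' hxb).ne
    by_cases hμ : 0 < μ
    swap
    -- A slope `μ ≤ 0` is used by a trivial step only.
    · refine ⟨a, hab, ⟨le_rfl, rfl, fun c h₁ h₂ => by rw [le_antisymm h₂ h₁]⟩, ih hl.2 hab hp ?_⟩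
      intro c c' h₁ h₂ h₃ ν hν h
      rcases H c c' h₁ h₂ h₃ ν hν h with h | h
      · rcases List.mem_cons.1 h with h | h
        · exact absurd (h ▸ hν) hμ
        · exact Or.inl h
      · exact Or.inr h
    obtain ⟨w, ⟨haw, hwb, hws⟩, hw⟩ := Set.Finite.exists_maximalFor rk
      {x | a ≤ x ∧ x ≤ b ∧ shift deg rk μ x = shift deg rk μ a} (Set.toFinite _)
      ⟨a, le_rfl, hab, rfl⟩
    -- Since `w` has maximal rank among the subobjects of slope `μ`, nothing nontrivial above it has
    -- slope `μ`. This is the second alternative of `H` for the interval from `w` to `b`.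
    have hmax' : ∀ x, w < x → x ≤ b → shift deg rk μ x < shift deg rk μ w := by
      intro x hwx hxb
      rw [hws]
      refine lt_of_le_of_ne (hmax x (haw.trans hwx.le) hxb hμ) fun h => ?_
      exact absurd (hw ⟨haw.trans hwx.le, hxb, h⟩ (hL.rk_strictMono hwx).le)
        (not_le.2 (hL.rk_strictMono hwx))
    refine ⟨w, hwb, ⟨haw, hws, fun c h₁ h₂ => hmax c h₁ (h₂.trans hwb) hμ⟩,
      ih hl.2 hwb (fun c h₁ h₂ => hp c (haw.trans h₁) h₂) ?_⟩
    intro c c' h₁ h₂ h₃ ν hν h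
    rcases H c c' (haw.trans h₁) h₂ h₃ ν hν h with h | h
    · rcases List.mem_cons.1 h with rfl | h
      · exact Or.inr hmax'
      · exact Or.inl h
    · right
      intro x hwx hxb
      rcases haw.eq_or_lt with rfl | haw'
      · exact h x hwx hxb
      -- The interval from `a` to `w` has slope `μ`, and by the alternative at hand its slope is
      -- less than `ν`.
      · have hνμ : μ < ν := by
          by_contra! hle
          have h₄ := h w haw' hwb
          have h₅ := mul_nonneg (sub_nonneg.2 hle) (sub_pos.2 (hL.rk_lt haw')).le
          rw [shift_eq ν μ, shift_eq ν μ a, hws] at h₄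
          linarith
        exact hL.shift_lt hνμ hwx (hmax' x hwx hxb).le

/-! ### Transport along convex embeddings. -/

/-- A convex order embedding that shifts degree and rank by constants. -/
structure IsConvexEmbedding (deg rk : L → ℤ) (deg' rk' : L' → ℤ) (f : L' → L) : Prop where
  le_iff : ∀ x y, f x ≤ f y ↔ x ≤ y
  convex : ∀ x y z, f x ≤ z → z ≤ f y → ∃ w, f w = z
  deg_eq : ∃ C, ∀ x, deg (f x) = deg' x + C
  rk_eq : ∃ C, ∀ x, rk (f x) = rk' x + C

namespace IsConvexEmbedding

variable {f : L' → L} (hf : IsConvexEmbedding deg rk deg' rk' f)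
include hf

theorem shift_eq (μ : ℚ) : ∃ C, ∀ x, shift deg rk μ (f x) = shift deg' rk' μ x + C := by
  obtain ⟨C, hC⟩ := hf.deg_eq
  obtain ⟨C', hC'⟩ := hf.rk_eq
  refine ⟨C - μ * C', fun x => ?_⟩
  unfold shift
  rw [hC, hC']
  push_cast
  ring

theorem lt_iff (x y : L') : f x < f y ↔ x < y := by
  rw [lt_iff_le_not_ge, lt_iff_le_not_ge, hf.le_iff, hf.le_iff]

theorem injective : Function.Injective f := fun x y h =>
  le_antisymm ((hf.le_iff x y).1 h.le) ((hf.le_iff y x).1 h.ge)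

theorem semistable_iff (μ : ℚ) (a b : L') :
    SemistableInterval deg rk μ (f a) (f b) ↔ SemistableInterval deg' rk' μ a b := by
  obtain ⟨C, hC⟩ := hf.shift_eq μ
  unfold SemistableInterval
  rw [hf.le_iff, hC, hC, add_left_inj]
  refine and_congr_right fun _ => and_congr_right fun _ => ⟨fun h c h₁ h₂ => ?_, fun h c h₁ h₂ => ?_⟩
  · have := h (f c) ((hf.le_iff _ _).2 h₁) ((hf.le_iff _ _).2 h₂)
    rw [hC] at this
    linarith
  · obtain ⟨d, rfl⟩ := hf.convex _ _ _ h₁ h₂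
    have := h d ((hf.le_iff _ _).1 h₁) ((hf.le_iff _ _).1 h₂)
    rw [hC]
    linarith

theorem positive_iff (a b : L') :
    PositiveInterval deg (f a) (f b) ↔ PositiveInterval deg' a b := by
  obtain ⟨C, hC⟩ := hf.deg_eq
  refine ⟨fun h c h₁ h₂ => ?_, fun h c h₁ h₂ => ?_⟩
  · have := h (f c) ((hf.le_iff _ _).2 h₁) ((hf.lt_iff _ _).2 h₂)
    rw [hC, hC] at this
    linarith
  · obtain ⟨d, rfl⟩ := hf.convex _ _ _ h₁ h₂.le
    have := h d ((hf.le_iff _ _).1 h₁) ((hf.lt_iff _ _).1 h₂)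
    rw [hC, hC]
    linarith

theorem hn_iff (l : List ℚ) (a b : L') :
    HNInterval deg rk l (f a) (f b) ↔ HNInterval deg' rk' l a b := by
  induction l generalizing a with
  | nil => exact hf.injective.eq_iff
  | cons μ l ih =>
    constructor
    · rintro ⟨c, h₁, h₂, h₃⟩
      obtain ⟨d, rfl⟩ := hf.convex _ _ _ h₂.1 h₁
      exact ⟨d, (hf.le_iff _ _).1 h₁, (hf.semistable_iff _ _ _).1 h₂, (ih _).1 h₃⟩
    · rintro ⟨c, h₁, h₂, h₃⟩
      exact ⟨f c, (hf.le_iff _ _).2 h₁, (hf.semistable_iff _ _ _).2 h₂, (ih _).2 h₃⟩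

end IsConvexEmbedding

/-! ### Canonical reductions of self-dual objects. -/

/-- The isotropic element `u` has a semistable reduction. -/
def SemistableReduction (deg : L → ℤ) (perp : L → L) (u : L) : Prop :=
  ∀ w, w ≤ perp w → u ≤ w → deg w ≤ deg u

/-- Maximal degree among the isotropic elements gives semistability of the reduction. Anything below
an isotropic element is isotropic, so minimal rank among the maximisers makes every proper subobject
of `u` have strictly smaller degree. -/
theorem exists_positive_semistableReduction [Finite L] (hL : IsSlopeData deg rk) (perp : L → L)
    (hperp : ∀ x y, x ≤ perp y ↔ y ≤ perp x) (b : L) (hb : ∀ x, b ≤ x) :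
    ∃ u, u ≤ perp u ∧ PositiveInterval deg b u ∧ SemistableReduction deg perp u := by
  obtain ⟨u₀, hu₀, hmax⟩ := Set.Finite.exists_maximalFor deg {x | x ≤ perp x} (Set.toFinite _)
    ⟨b, hb _⟩
  obtain ⟨u, ⟨hu, hd⟩, hmin⟩ := Set.Finite.exists_minimalFor rk
    {x | x ≤ perp x ∧ deg x = deg u₀} (Set.toFinite _) ⟨u₀, hu₀, rfl⟩
  have hmax' : ∀ x, x ≤ perp x → deg x ≤ deg u := by
    intro x hx
    rw [hd]
    rcases le_total (deg u₀) (deg x) with h | h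
    · exact hmax hx h
    · exact h
  refine ⟨u, hu, fun c _ hc => ?_, fun w hw _ => hmax' w hw⟩
  have hci : c ≤ perp c := ((hperp _ _).1 (hc.le.trans hu)).trans' hc.le
  refine lt_of_le_of_ne (hmax' c hci) fun h => ?_
  have := hmin (j := c) ⟨hci, h.trans hd⟩ (hL.rk_strictMono hc).le
  exact absurd this (not_le.2 (hL.rk_strictMono hc))

/-- The element `u ⊔ (u' ⊓ u^⊥)` is isotropic, so semistability at `u` gives `deg (u' ⊓ u^⊥) ≤ deg
(u' ⊓ u)`. On the other hand `(u' ⊓ u^⊥)^⊥ = u ⊔ u'^⊥`, and invariance and modularity of the degree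
give `deg (u' ⊓ u^⊥) + deg (u ⊓ u'^⊥) = deg u + deg u'`. By positivity neither summand on the left
exceeds its counterpart, so both are equalities; thus `deg u' ≤ deg (u' ⊓ u)`, and positivity forces
`u' ≤ u`. -/
theorem positive_semistableReduction_unique (hL : IsSlopeData deg rk) (perp : L → L)
    (hperp : ∀ x y, x ≤ perp y ↔ y ≤ perp x) (hinv : ∀ x, perp (perp x) = x)
    (hdeg : ∀ x, deg (perp x) = deg x) {b : L} (hb : ∀ x, b ≤ x) {u u' : L}
    (hu : u ≤ perp u) (hp : PositiveInterval deg b u) (hs : SemistableReduction deg perp u)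
    (hu' : u' ≤ perp u') (hp' : PositiveInterval deg b u')
    (hs' : SemistableReduction deg perp u') : u = u' := by
  have anti : ∀ {x y : L}, x ≤ y → perp y ≤ perp x := fun {x y} h =>
    (hperp _ _).1 (by rw [hinv]; exact h)
  have key : ∀ {u u' : L}, u ≤ perp u → SemistableReduction deg perp u → u' ≤ perp u' →
      deg (u' ⊓ perp u) ≤ deg (u' ⊓ u) := by
    intro u u' hu hs hu'
    have hiso : u ⊔ (u' ⊓ perp u) ≤ perp (u ⊔ (u' ⊓ perp u)) := by
      refine sup_le ((hperp _ _).1 (sup_le hu inf_le_right)) ((hperp _ _).1 (sup_le ?_ ?_))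
      · exact (hperp _ _).1 inf_le_right
      · exact inf_le_left.trans (hu'.trans (anti inf_le_left))
    have h₁ := hs _ hiso le_sup_left
    have h₂ := hL.deg_add u (u' ⊓ perp u)
    have h₃ : u ⊓ (u' ⊓ perp u) = u' ⊓ u :=
      le_antisymm (le_inf (inf_le_right.trans inf_le_left) inf_le_left)
        (le_inf inf_le_right (le_inf inf_le_left (inf_le_right.trans hu)))
    rw [h₃] at h₂
    linarith
  have pos : ∀ {u c : L}, PositiveInterval deg b u → c ≤ u → deg u ≤ deg c → u ≤ c := by
    intro u c hp hc hd
    rcases hc.eq_or_lt with rfl | hlt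
    · exact le_rfl
    · exact absurd (hp c (hb c) hlt) (not_lt.2 hd)
  have pos_le : ∀ {u c : L}, PositiveInterval deg b u → c ≤ u → deg c ≤ deg u := by
    intro u c hp hc
    rcases hc.eq_or_lt with rfl | hlt
    · exact le_rfl
    · exact (hp c (hb c) hlt).le
  have e : perp (u' ⊓ perp u) = u ⊔ perp u' := by
    apply le_antisymm
    · rw [← hinv (u ⊔ perp u')]
      refine anti (le_inf ?_ ?_)
      · exact (anti (le_sup_right : perp u' ≤ u ⊔ perp u')).trans_eq (hinv u')
      · exact anti le_sup_left
    · refine sup_le ((hperp _ _).1 inf_le_right) (anti inf_le_left)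
  have h₁ := hdeg (u' ⊓ perp u)
  rw [e] at h₁
  have h₂ := hL.deg_add u (perp u')
  rw [hdeg u'] at h₂
  have h₃ := pos_le hp' (inf_le_left : u' ⊓ perp u ≤ u')
  have h₄ := pos_le hp (inf_le_left : u ⊓ perp u' ≤ u)
  have h₅ := key hu hs hu'
  have h₆ := key hu' hs' hu
  have h₇ := pos hp' (inf_le_left : u' ⊓ u ≤ u') (by linarith)
  have h₈ := pos hp (inf_le_left : u ⊓ u' ≤ u) (by linarith)
  exact le_antisymm (h₈.trans inf_le_right) (h₇.trans inf_le_right)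

end Slopes

/-! ### Counting lemmas -/

section Counting

/-- Count the pairs `(g, y)` with `y ∈ Y` and `g y ∈ S`. Each `g` contributes `#S`, as `Y` is stable
and contains `S`; each `y` contributes `K`, as `y` can be moved into `S`. This replaces
orbit-stabiliser when `S` meets orbits in many points. -/
theorem slice_count {G Ω : Type*} [Group G] [Finite G] [Finite Ω] (act : G → Ω → Ω)
    (act_one : ∀ y, act 1 y = y) (act_mul : ∀ g h y, act (g * h) y = act g (act h y))
    (Y S : Set Ω) (hSY : S ⊆ Y) (hY : ∀ g, ∀ y ∈ Y, act g y ∈ Y) (hS : ∀ y ∈ Y, ∃ g, act g y ∈ S)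
    (K : ℕ) (hK : ∀ s ∈ S, {g | act g s ∈ S}.ncard = K) :
    Y.ncard * K = Nat.card G * S.ncard := by
  classical
  have := Fintype.ofFinite G
  have := Fintype.ofFinite Ω
  have inv₁ : ∀ g y, act g⁻¹ (act g y) = y := fun g y => by
    rw [← act_mul, inv_mul_cancel, act_one]
  have inv₂ : ∀ g y, act g (act g⁻¹ y) = y := fun g y => by
    rw [← act_mul, mul_inv_cancel, act_one]
  have key := Finset.sum_card_bipartiteAbove_eq_sum_card_bipartiteBelow
    (s := (Finset.univ : Finset G)) (t := Y.toFinset) (fun g y => act g y ∈ S)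
  have h₁ : ∀ g ∈ (Finset.univ : Finset G),
      (Y.toFinset.bipartiteAbove (fun g y => act g y ∈ S) g).card = S.ncard := by
    intro g _
    rw [Set.ncard_eq_toFinset_card']
    refine Finset.card_bij' (fun y _ => act g y) (fun y _ => act g⁻¹ y) ?_ ?_ ?_ ?_
    · intro y hy
      simpa using (Finset.mem_bipartiteAbove _ |>.1 hy).2
    · intro y hy
      have hy' : y ∈ S := by simpa using hy
      rw [Finset.mem_bipartiteAbove]
      exact ⟨by simpa using hY _ _ (hSY hy'), by rw [inv₂]; exact hy'⟩
    · intro y _; exact inv₁ g y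
    · intro y _; exact inv₂ g y
  have h₂ : ∀ y ∈ Y.toFinset,
      ((Finset.univ : Finset G).bipartiteBelow (fun g y => act g y ∈ S) y).card = K := by
    intro y hy
    obtain ⟨g, hg⟩ := hS y (by simpa using hy)
    -- Right translation by `g` identifies the elements that move `g y` into `S` with those that
    -- move `y` into `S`.
    rw [← hK _ hg, Set.ncard_eq_toFinset_card']
    refine Finset.card_bij' (fun h _ => h * g⁻¹) (fun h _ => h * g) ?_ ?_ ?_ ?_
    · intro h hh
      have := (Finset.mem_bipartiteBelow _ |>.1 hh).2
      simpa [act_mul, inv₁] using this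
    · intro h hh
      rw [Finset.mem_bipartiteBelow]
      refine ⟨Finset.mem_univ _, ?_⟩
      rw [act_mul]
      simpa using hh
    · intro h _; simp
    · intro h _; simp
  rw [Finset.sum_congr rfl h₁, Finset.sum_congr rfl h₂, Finset.sum_const, Finset.sum_const,
    smul_eq_mul, smul_eq_mul, Finset.card_univ, ← Nat.card_eq_fintype_card,
    ← Set.ncard_eq_toFinset_card'] at key
  exact key.symm

variable {k : Type*} [Field k]

theorem ncard_support {Z : Type*} [Fintype Z] (T : Z → Prop) [DecidablePred T] :
    {f : Z → k | ∀ z, ¬ T z → f z = 0}.ncard = Nat.card k ^ (Finset.univ.filter T).card := by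
  rw [← Fintype.card_subtype, ← Nat.card_eq_fintype_card (α := {z // T z}), ← Nat.card_fun,
    ← Nat.card_coe_set_eq]
  refine Nat.card_congr
    ⟨fun f z => f.1 z.1, fun g => ⟨fun z => if h : T z then g ⟨z, h⟩ else 0, fun z hz => dif_neg hz⟩,
      ?_, ?_⟩
  · rintro ⟨f, hf⟩
    ext z
    by_cases h : T z
    · simp [h]
    · simp [h, hf z h]
  · intro g
    ext ⟨z, hz⟩
    simp [hz]

/-- Such a function is freely determined by its values at one point of each two-element orbit and at
the fixed points of sign `1`. At fixed points of sign `-1` it vanishes because `2 ≠ 0`. Doubling the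
exponent gives a formula without a choice of representatives. -/
theorem ncard_sign_symmetric (h2 : (2 : k) ≠ 0) {Z : Type*} [Fintype Z] [DecidableEq Z]
    (T : Z → Prop) [DecidablePred T] (ι : Z → Z) (hι : Function.Involutive ι)
    (hT : ∀ z, T z → T (ι z)) (ε : Z → ℤˣ) (hε : ∀ z, T z → ε (ι z) = ε z) :
    ∃ n : ℕ, (2 * n : ℤ) = (Finset.univ.filter T).card + ∑ z with T z ∧ ι z = z, (ε z : ℤ) ∧
    {f : Z → k | (∀ z, ¬ T z → f z = 0) ∧ ∀ z, T z → f (ι z) = ((ε z : ℤ) : k) * f z}.ncard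
      = Nat.card k ^ n := by
  classical
  obtain ⟨o⟩ : Nonempty (Z ≃ Fin (Fintype.card Z)) := ⟨Fintype.equivFin Z⟩
  -- The free coordinates; the auxiliary linear order picks a representative of each two-element
  -- orbit.
  let R : Z → Prop := fun z => T z ∧ (o z < o (ι z) ∨ (ι z = z ∧ ε z = 1))
  have hcard : (2 * (Finset.univ.filter R).card : ℤ)
      = (Finset.univ.filter T).card + ∑ z with T z ∧ ι z = z, (ε z : ℤ) := by
    have e₁ : (Finset.univ.filter R).card = (Finset.univ.filter fun z => T z ∧ o z < o (ι z)).card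
        + (Finset.univ.filter fun z => T z ∧ ι z = z ∧ ε z = 1).card := by
      rw [← Finset.card_union_of_disjoint]
      · congr 1
        ext z
        simp only [R, Finset.mem_filter, Finset.mem_univ, true_and, Finset.mem_union]
        tauto
      · rw [Finset.disjoint_left]
        intro z h h'
        simp only [Finset.mem_filter, Finset.mem_univ, true_and] at h h'
        rw [h'.2.1] at h
        exact lt_irrefl _ h.2
    have e₂ : (Finset.univ.filter T).card = (Finset.univ.filter fun z => T z ∧ o z < o (ι z)).card
        + (Finset.univ.filter fun z => T z ∧ o (ι z) < o z).card
        + ((Finset.univ.filter fun z => T z ∧ ι z = z ∧ ε z = 1).card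
        + (Finset.univ.filter fun z => T z ∧ ι z = z ∧ ε z = -1).card) := by
      rw [← Finset.card_union_of_disjoint, ← Finset.card_union_of_disjoint,
        ← Finset.card_union_of_disjoint]
      · congr 1
        ext z
        simp only [Finset.mem_filter, Finset.mem_univ, true_and, Finset.mem_union]
        rcases lt_trichotomy (o z) (o (ι z)) with h | h | h
        · tauto
        · have h' := (o.injective h).symm
          have := Int.units_eq_one_or (ε z)
          tauto
        · tauto
      · rw [Finset.disjoint_left]
        intro z h h'
        simp only [Finset.mem_filter, Finset.mem_univ, true_and, Finset.mem_union] at h h'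
        have hz : ι z = z := by tauto
        rw [hz] at h
        simp at h
      · rw [Finset.disjoint_left]
        intro z h h'
        simp only [Finset.mem_filter, Finset.mem_univ, true_and] at h h'
        exact absurd (h.2.2.symm.trans h'.2.2) (by decide)
      · rw [Finset.disjoint_left]
        intro z h h'
        simp only [Finset.mem_filter, Finset.mem_univ, true_and] at h h'
        exact lt_asymm h.2 h'.2
    have e₃ : (Finset.univ.filter fun z => T z ∧ o (ι z) < o z).card
        = (Finset.univ.filter fun z => T z ∧ o z < o (ι z)).card := by
      refine Finset.card_bij' (fun z _ => ι z) (fun z _ => ι z) ?_ ?_ ?_ ?_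
      · intro z hz
        simp only [Finset.mem_filter, Finset.mem_univ, true_and] at hz ⊢
        exact ⟨hT z hz.1, by rw [hι z]; exact hz.2⟩
      · intro z hz
        simp only [Finset.mem_filter, Finset.mem_univ, true_and] at hz ⊢
        exact ⟨hT z hz.1, by rw [hι z]; exact hz.2⟩
      · intro z _; exact hι z
      · intro z _; exact hι z
    have e₄ : ∑ z with T z ∧ ι z = z, (ε z : ℤ)
        = (Finset.univ.filter fun z => T z ∧ ι z = z ∧ ε z = 1).card
          - (Finset.univ.filter fun z => T z ∧ ι z = z ∧ ε z = -1).card := by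
      have : ∀ z, (ε z : ℤ) = (if ε z = 1 then 1 else 0) - (if ε z = -1 then 1 else 0) := by
        intro z
        rcases Int.units_eq_one_or (ε z) with h | h <;> rw [h] <;> decide
      rw [Finset.sum_congr rfl fun z _ => this z, Finset.sum_sub_distrib, Finset.sum_boole,
        Finset.sum_boole, Finset.filter_filter, Finset.filter_filter]
      simp only [and_assoc]
    rw [e₄, e₁, e₂, e₃]
    push_cast
    ring
  refine ⟨_, hcard, ?_⟩
  rw [← Fintype.card_subtype, ← Nat.card_eq_fintype_card (α := {z // R z}),
    ← Nat.card_fun, ← Nat.card_coe_set_eq]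
  have sq : ∀ z, ((ε z : ℤ) : k) * ((ε z : ℤ) : k) = 1 := by
    intro z
    rcases Int.units_eq_one_or (ε z) with h | h <;> rw [h] <;> simp
  refine Nat.card_congr (Equiv.ofBijective (fun f (z : {z // R z}) => f.1 z.1) ⟨?_, ?_⟩)
  · rintro ⟨f, hf, hf'⟩ ⟨g, hg, hg'⟩ h
    have h' : ∀ z, R z → f z = g z := fun z hz => congrFun h ⟨z, hz⟩
    refine Subtype.ext (funext fun z => ?_)
    change f z = g z
    by_cases hz : T z
    swap
    · rw [hf z hz, hg z hz]
    rcases lt_trichotomy (o z) (o (ι z)) with h₁ | h₁ | h₁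
    · exact h' z ⟨hz, Or.inl h₁⟩
    · have h₂ := (o.injective h₁).symm
      rcases Int.units_eq_one_or (ε z) with h₃ | h₃
      · exact h' z ⟨hz, Or.inr ⟨h₂, h₃⟩⟩
      · have zero : ∀ x : k, x = ((ε z : ℤ) : k) * x → x = 0 := by
          intro x hx
          rw [h₃] at hx
          have : (2 : k) * x = 0 := by
            simp only [Units.val_neg, Units.val_one, Int.cast_neg, Int.cast_one] at hx
            linear_combination hx
          exact (mul_eq_zero.1 this).resolve_left h2
        have hfz := hf' z hz
        have hgz := hg' z hz
        rw [h₂] at hfz hgz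
        rw [zero _ hfz, zero _ hgz]
    · have h₂ := h' (ι z) ⟨hT z hz, Or.inl (by rw [hι z]; exact h₁)⟩
      have h₃ := hf' (ι z) (hT z hz)
      have h₄ := hg' (ι z) (hT z hz)
      rw [hι z] at h₃ h₄
      rw [h₃, h₄, h₂]
  · intro g
    have hasymm : ∀ z, T z → o z < o (ι z) → ¬ R (ι z) := by
      rintro z hz h ⟨-, h' | h'⟩
      · rw [hι z] at h'
        exact lt_asymm h h'
      · rw [hι z] at h'
        rw [← h'.1] at h
        exact lt_irrefl _ h
    let f : Z → k := fun z => if h : R z then g ⟨z, h⟩ else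
      if h : R (ι z) then ((ε z : ℤ) : k) * g ⟨ι z, h⟩ else 0
    have hfR : ∀ z (h : R z), f z = g ⟨z, h⟩ := fun z h => by simp only [f, dif_pos h]
    have hfR' : ∀ z, ¬ R z → ∀ (h : R (ι z)), f z = ((ε z : ℤ) : k) * g ⟨ι z, h⟩ :=
      fun z h h' => by simp only [f, dif_neg h, dif_pos h']
    have hf0 : ∀ z, ¬ R z → ¬ R (ι z) → f z = 0 := fun z h h' => by
      simp only [f, dif_neg h, dif_neg h']
    refine ⟨⟨f, fun z hz => hf0 z (fun h => hz h.1) fun h => hz (by simpa [hι z] using hT _ h.1),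
      fun z hz => ?_⟩, funext fun z => hfR z.1 z.2⟩
    by_cases h₁ : R z
    · by_cases h₂ : R (ι z)
      · rcases h₁.2 with h | h
        · exact absurd h₂ (hasymm z hz h)
        · rw [h.1, h.2]
          simp
      · have h₃ : R (ι (ι z)) := by rw [hι z]; exact h₁
        have := hfR' (ι z) h₂ h₃
        rw [this, hε z hz, hfR z h₁]
        congr 3
        exact hι z
    · by_cases h₂ : R (ι z)
      · rw [hfR _ h₂, hfR' z h₁ h₂, ← mul_assoc, sq, one_mul]
      · rw [hf0 z h₁ h₂, hf0 (ι z) h₂ (by rw [hι z]; exact h₁), mul_zero]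

end Counting

/-! ### Graded vector spaces with a coloured basis -/

section Graded

variable {I : Type*} [DecidableEq I] {k : Type*} [Field k] {X X' : Type*}

/-- The projection of `k^X` onto the span of the basis vectors of colour `i`. -/
def colorProj (k : Type*) [Field k] (c : X → I) (i : I) : (X → k) →ₗ[k] (X → k) where
  toFun v x := if c x = i then v x else 0
  map_add' v w := by ext x; by_cases h : c x = i <;> simp [h]
  map_smul' r v := by ext x; by_cases h : c x = i <;> simp [h]

theorem colorProj_apply (c : X → I) (i : I) (v : X → k) (x : X) :
    colorProj k c i v x = if c x = i then v x else 0 := rfl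

theorem colorProj_self (c : X → I) (i : I) (v : X → k) :
    colorProj k c i (colorProj k c i v) = colorProj k c i v := by
  ext x; by_cases h : c x = i <;> simp [colorProj_apply, h]

theorem colorProj_ne (c : X → I) {i j : I} (hij : i ≠ j) (v : X → k) :
    colorProj k c i (colorProj k c j v) = 0 := by
  ext x
  by_cases h : c x = i
  · simp [colorProj_apply, h, hij]
  · simp [colorProj_apply, h]

theorem sum_colorProj [Fintype I] (c : X → I) (v : X → k) : ∑ i, colorProj k c i v = v := by
  ext x
  simp [Finset.sum_apply, colorProj_apply]

/-- The subspace is the sum of its homogeneous parts. -/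
def IsGradedSubspace (c : X → I) (W : Submodule k (X → k)) : Prop :=
  ∀ i, ∀ v ∈ W, colorProj k c i v ∈ W

/-- The dimension vector of a graded subspace. -/
def gdim (c : X → I) (W : Submodule k (X → k)) : I → ℤ :=
  fun i => Module.finrank k (W.map (colorProj k c i))

/-- The number of basis vectors of each colour. -/
def colorDim [Fintype X] (c : X → I) : I → ℕ := fun i => (Finset.univ.filter fun x => c x = i).card

section

variable {c : X → I} {c' : X' → I} {W W' : Submodule k (X → k)}

theorem IsGradedSubspace.bot : IsGradedSubspace c (⊥ : Submodule k (X → k)) := by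
  intro i v hv
  rw [Submodule.mem_bot] at hv ⊢
  rw [hv, map_zero]

theorem IsGradedSubspace.top : IsGradedSubspace c (⊤ : Submodule k (X → k)) :=
  fun _ _ _ => Submodule.mem_top

theorem IsGradedSubspace.inf (h : IsGradedSubspace c W) (h' : IsGradedSubspace c W') :
    IsGradedSubspace c (W ⊓ W') := fun i v hv => ⟨h i v hv.1, h' i v hv.2⟩

theorem IsGradedSubspace.sup (h : IsGradedSubspace c W) (h' : IsGradedSubspace c W') :
    IsGradedSubspace c (W ⊔ W') := by
  intro i v hv
  obtain ⟨x, hx, y, hy, rfl⟩ := Submodule.mem_sup.1 hv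
  rw [map_add]
  exact Submodule.add_mem_sup (h i x hx) (h' i y hy)

theorem IsGradedSubspace.map {φ : (X → k) →ₗ[k] (X' → k)}
    (hφ : ∀ i v, φ (colorProj k c i v) = colorProj k c' i (φ v)) (h : IsGradedSubspace c W) :
    IsGradedSubspace c' (W.map φ) := by
  rintro i _ ⟨v, hv, rfl⟩
  exact ⟨_, h i v hv, hφ i v⟩

theorem IsGradedSubspace.comap {φ : (X → k) →ₗ[k] (X' → k)} {W' : Submodule k (X' → k)}
    (hφ : ∀ i v, φ (colorProj k c i v) = colorProj k c' i (φ v)) (h : IsGradedSubspace c' W') :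
    IsGradedSubspace c (W'.comap φ) := by
  intro i v hv
  rw [Submodule.mem_comap, hφ]
  exact h i _ hv

/-- Homogeneous parts commute with intersections only because both subspaces contain the homogeneous
parts of their elements; this is what makes `gdim` modular. -/
theorem IsGradedSubspace.map_inf (h : IsGradedSubspace c W) (h' : IsGradedSubspace c W') (i : I) :
    (W ⊓ W').map (colorProj k c i) = W.map (colorProj k c i) ⊓ W'.map (colorProj k c i) := by
  apply le_antisymm (Submodule.map_inf_le _)
  rintro _ ⟨⟨v, hv, rfl⟩, w, hw, hwv⟩
  refine ⟨colorProj k c i v, ⟨h i v hv, ?_⟩, colorProj_self c i v⟩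
  rw [← hwv]
  exact h' i w hw

theorem le_of_map_colorProj_le [Fintype I] (hW' : IsGradedSubspace c W')
    (h : ∀ i, W.map (colorProj k c i) ≤ W'.map (colorProj k c i)) : W ≤ W' := by
  intro v hv
  rw [← sum_colorProj c v]
  refine Submodule.sum_mem _ fun i _ => ?_
  obtain ⟨w, hw, e⟩ := h i ⟨v, hv, rfl⟩
  rw [← e]
  exact hW' i w hw

theorem gdim_map {φ : (X → k) →ₗ[k] (X' → k)} (hφi : Function.Injective φ)
    (hφ : ∀ i v, φ (colorProj k c i v) = colorProj k c' i (φ v)) (W : Submodule k (X → k)) :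
    gdim c' (W.map φ) = gdim c W := by
  funext i
  unfold gdim
  have : (W.map φ).map (colorProj k c' i) = (W.map (colorProj k c i)).map φ := by
    rw [← Submodule.map_comp, ← Submodule.map_comp]
    congr 1
    ext1 v
    exact (hφ i v).symm
  rw [this, (Submodule.equivMapOfInjective φ hφi _).finrank_eq]

theorem gdim_bot : gdim c (⊥ : Submodule k (X → k)) = 0 := by
  funext i
  simp [gdim]

theorem gdim_nonneg (i : I) : 0 ≤ gdim c W i := Int.natCast_nonneg _

variable [Fintype X]

theorem gdim_top (c : X → I) : gdim c (⊤ : Submodule k (X → k)) = toLat (colorDim c) := by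
  funext i
  unfold gdim toLat colorDim
  congr 1
  rw [← Fintype.card_subtype, ← Module.finrank_fintype_fun_eq_card k]
  let f : ({x // c x = i} → k) →ₗ[k] (X → k) :=
    { toFun := fun v x => if h : c x = i then v ⟨x, h⟩ else 0
      map_add' := fun v w => by ext x; by_cases h : c x = i <;> simp [h]
      map_smul' := fun r v => by ext x; by_cases h : c x = i <;> simp [h] }
  have hf : Function.Injective f := by
    intro v w h
    ext ⟨x, hx⟩
    have := congrFun h x
    simpa [f, hx] using this
  have : (⊤ : Submodule k (X → k)).map (colorProj k c i) = LinearMap.range f := by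
    ext v
    constructor
    · rintro ⟨w, -, rfl⟩
      refine ⟨fun x => w x.1, ?_⟩
      ext x
      by_cases h : c x = i <;> simp [f, colorProj_apply, h]
    · rintro ⟨w, rfl⟩
      refine ⟨f w, trivial, ?_⟩
      ext x
      by_cases h : c x = i <;> simp [f, colorProj_apply, h]
  rw [this, LinearMap.finrank_range_of_inj hf]

theorem gdim_add (h : IsGradedSubspace c W) (h' : IsGradedSubspace c W') :
    gdim c (W ⊔ W') + gdim c (W ⊓ W') = gdim c W + gdim c W' := by
  funext i
  simp only [Pi.add_apply, gdim]
  rw [h.map_inf h', Submodule.map_sup]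
  exact_mod_cast Submodule.finrank_sup_add_finrank_inf_eq _ _

theorem gdim_mono (h : W ≤ W') (i : I) : gdim c W i ≤ gdim c W' i :=
  Int.ofNat_le.2 (Submodule.finrank_mono (Submodule.map_mono h))

theorem eq_of_le_of_gdim_le [Fintype I] (hW : IsGradedSubspace c W) (hle : W ≤ W')
    (h : ∀ i, gdim c W' i ≤ gdim c W i) : W = W' := by
  refine le_antisymm hle (le_of_map_colorProj_le hW fun i => ?_)
  exact (Submodule.eq_of_le_of_finrank_le (Submodule.map_mono hle) (Int.ofNat_le.1 (h i))).ge

end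

/-! ### The lattice of graded invariant subspaces -/

variable {A : Type*} [Fintype X] [Fintype X']

/-- The lattice of subrepresentations: the graded subspaces that are invariant under the matrices
of the arrows. -/
def invLat (c : X → I) (m : A → Matrix X X k) : Sublattice (Submodule k (X → k)) where
  carrier := {W | IsGradedSubspace c W ∧ ∀ a, ∀ v ∈ W, (m a).mulVec v ∈ W}
  supClosed' := by
    rintro W ⟨h, hm⟩ W' ⟨h', hm'⟩
    refine ⟨h.sup h', fun a v hv => ?_⟩
    obtain ⟨x, hx, y, hy, rfl⟩ := Submodule.mem_sup.1 hv
    rw [Matrix.mulVec_add]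
    exact Submodule.add_mem_sup (hm a x hx) (hm' a y hy)
  infClosed' := by
    rintro W ⟨h, hm⟩ W' ⟨h', hm'⟩
    exact ⟨h.inf h', fun a v hv => ⟨hm a v hv.1, hm' a v hv.2⟩⟩

variable {c : X → I} {c' : X' → I} {m : A → Matrix X X k} {m' : A → Matrix X' X' k}

theorem mem_invLat {W : Submodule k (X → k)} : W ∈ invLat c m ↔
    IsGradedSubspace c W ∧ ∀ a, ∀ v ∈ W, (m a).mulVec v ∈ W := Iff.rfl

instance : BoundedOrder (invLat c m) where
  top := ⟨⊤, IsGradedSubspace.top, fun _ _ _ => Submodule.mem_top⟩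
  le_top _ := fun _ _ => Submodule.mem_top
  bot := ⟨⊥, IsGradedSubspace.bot, fun a v hv => by
    rw [Submodule.mem_bot] at hv ⊢; rw [hv, Matrix.mulVec_zero]⟩
  bot_le W := fun v hv => by rw [Submodule.mem_bot] at hv; rw [hv]; exact W.1.zero_mem

instance [Finite k] : Finite (invLat c m) := Subtype.finite

variable [Fintype I]

/-- The degree of a subrepresentation. -/
def latDeg (θ : Module.Dual ℤ (I → ℤ)) (W : invLat c m) : ℤ := θ (gdim c W.1)

/-- The total dimension of a subrepresentation. -/
def latRk (W : invLat c m) : ℤ := ∑ i, gdim c W.1 i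

theorem isSlopeData (θ : Module.Dual ℤ (I → ℤ)) :
    IsSlopeData (latDeg (c := c) (m := m) θ) latRk where
  deg_add W W' := by
    unfold latDeg
    rw [← map_add, ← map_add]
    exact congrArg θ (gdim_add W.2.1 W'.2.1)
  rk_add W W' := by
    unfold latRk
    rw [← Finset.sum_add_distrib, ← Finset.sum_add_distrib]
    exact Finset.sum_congr rfl fun i _ => congrFun (gdim_add W.2.1 W'.2.1) i
  rk_strictMono W W' h := by
    have hle : W.1 ≤ W'.1 := h.le
    refine Finset.sum_lt_sum (fun i _ => gdim_mono hle i) ?_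
    by_contra! hne
    exact h.ne (Subtype.ext (eq_of_le_of_gdim_le W.2.1 hle fun i => hne i (Finset.mem_univ i)))

/-- The image of a subrepresentation under an injective homomorphism. -/
def mapInv (φ : (X → k) →ₗ[k] (X' → k))
    (hφ : ∀ i v, φ (colorProj k c i v) = colorProj k c' i (φ v))
    (hm : ∀ a v, φ ((m a).mulVec v) = (m' a).mulVec (φ v)) (W : invLat c m) : invLat c' m' :=
  ⟨W.1.map φ, W.2.1.map hφ, by
    rintro a _ ⟨v, hv, rfl⟩
    exact ⟨_, W.2.2 a v hv, hm a v⟩⟩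

/-- The preimage of a subrepresentation under a homomorphism. -/
def comapInv (φ : (X → k) →ₗ[k] (X' → k))
    (hφ : ∀ i v, φ (colorProj k c i v) = colorProj k c' i (φ v))
    (hm : ∀ a v, φ ((m a).mulVec v) = (m' a).mulVec (φ v)) (W : invLat c' m') : invLat c m :=
  ⟨W.1.comap φ, W.2.1.comap hφ, by
    intro a v hv
    rw [Submodule.mem_comap, hm]
    exact W.2.2 a _ hv⟩

/-- Subrepresentations of a subrepresentation form a lower interval in the ambient lattice: whatever
lies in the image comes from its own preimage. Degrees and ranks do not change. -/
theorem mapInv_convex (θ : Module.Dual ℤ (I → ℤ)) {φ : (X → k) →ₗ[k] (X' → k)}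
    (hφi : Function.Injective φ)
    (hφ : ∀ i v, φ (colorProj k c i v) = colorProj k c' i (φ v))
    (hm : ∀ a v, φ ((m a).mulVec v) = (m' a).mulVec (φ v)) :
    IsConvexEmbedding (latDeg (c := c') (m := m') θ) latRk (latDeg (c := c) (m := m) θ) latRk
      (mapInv φ hφ hm) where
  le_iff W W' := Submodule.map_le_map_iff_of_injective hφi W.1 W'.1
  convex W W' Z _ h := by
    refine ⟨comapInv φ hφ hm Z, Subtype.ext ?_⟩
    change (Z.1.comap φ).map φ = Z.1
    refine Submodule.map_comap_eq_of_le (le_trans (show Z.1 ≤ W'.1.map φ from h) ?_)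
    exact LinearMap.map_le_range
  deg_eq := ⟨0, fun W => by rw [add_zero]; exact congrArg θ (gdim_map hφi hφ W.1)⟩
  rk_eq := ⟨0, fun W => by
    rw [add_zero]
    exact Finset.sum_congr rfl fun i _ => congrFun (gdim_map hφi hφ W.1) i⟩

theorem gdim_comap {φ : (X → k) →ₗ[k] (X' → k)} {ψ : (X' → k) →ₗ[k] (X → k)}
    (hφ : ∀ i v, φ (colorProj k c i v) = colorProj k c' i (φ v))
    (hψ : ∀ i v, ψ (colorProj k c' i v) = colorProj k c i (ψ v))
    (hφψ : ∀ v, φ (ψ v) = v) {W : Submodule k (X' → k)} (hW : IsGradedSubspace c' W) :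
    gdim c (W.comap φ) = gdim c (LinearMap.ker φ) + gdim c' W := by
  have h₁ : W.comap φ = LinearMap.ker φ ⊔ W.map ψ := by
    apply le_antisymm
    · intro v hv
      rw [← sub_add_cancel v (ψ (φ v))]
      refine Submodule.add_mem_sup ?_ ⟨φ v, hv, rfl⟩
      rw [LinearMap.mem_ker, map_sub, hφψ, sub_self]
    · refine sup_le (fun v hv => ?_) ?_
      · rw [Submodule.mem_comap, LinearMap.mem_ker.1 hv]
        exact W.zero_mem
      · rintro _ ⟨v, hv, rfl⟩
        rw [Submodule.mem_comap, hφψ]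
        exact hv
  have h₂ : LinearMap.ker φ ⊓ W.map ψ = ⊥ := by
    rw [eq_bot_iff]
    rintro _ ⟨h, v, hv, rfl⟩
    have h' : φ (ψ v) = 0 := h
    rw [hφψ] at h'
    rw [h', map_zero]
    exact Submodule.zero_mem _
  have h₃ : IsGradedSubspace c (LinearMap.ker φ) := by
    intro i v hv
    rw [LinearMap.mem_ker, hφ, LinearMap.mem_ker.1 hv, map_zero]
  have h₄ : Function.Injective ψ := fun v w h => by rw [← hφψ v, h, hφψ]
  have := gdim_add h₃ (hW.map hψ)
  rw [h₂, gdim_bot, add_zero, ← h₁, gdim_map h₄ hψ] at this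
  exact this

/-- Subrepresentations of a quotient form the upper interval above the kernel, whose degree and rank
are the shifts. The section `ψ` need only be homogeneous; it is not required to commute with the
arrows, so the extension may be nonsplit. -/
theorem comapInv_convex (θ : Module.Dual ℤ (I → ℤ)) {φ : (X → k) →ₗ[k] (X' → k)}
    {ψ : (X' → k) →ₗ[k] (X → k)}
    (hφ : ∀ i v, φ (colorProj k c i v) = colorProj k c' i (φ v))
    (hψ : ∀ i v, ψ (colorProj k c' i v) = colorProj k c i (ψ v))
    (hφψ : ∀ v, φ (ψ v) = v)
    (hm : ∀ a v, φ ((m a).mulVec v) = (m' a).mulVec (φ v)) :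
    IsConvexEmbedding (latDeg (c := c) (m := m) θ) latRk (latDeg (c := c') (m := m') θ) latRk
      (comapInv φ hφ hm) where
  le_iff W W' := by
    constructor
    · intro h v hv
      have : ψ v ∈ W'.1.comap φ := h (show φ (ψ v) ∈ W.1 by rw [hφψ]; exact hv)
      rw [Submodule.mem_comap, hφψ] at this
      exact this
    · intro h v hv
      exact h hv
  convex W W' Z h _ := by
    have hker : ∀ v, φ v = 0 → v ∈ Z.1 := fun v hv => h (show φ v ∈ W.1 by rw [hv]; exact W.1.zero_mem)
    have hψZ : ∀ v ∈ Z.1, ψ (φ v) ∈ Z.1 := fun v hv => by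
      rw [← sub_sub_cancel v (ψ (φ v))]
      exact Z.1.sub_mem hv (hker _ (by rw [map_sub, hφψ, sub_self]))
    refine ⟨⟨Z.1.map φ, Z.2.1.map hφ, ?_⟩, Subtype.ext ?_⟩
    · rintro a _ ⟨v, hv, rfl⟩
      exact ⟨_, Z.2.2 a v hv, hm a v⟩
    · apply le_antisymm
      · rintro v ⟨w, hw, hwv⟩
        rw [← sub_add_cancel v w]
        exact Z.1.add_mem (hker _ (by rw [map_sub, hwv, sub_self])) hw
      · intro v hv
        exact ⟨v, hv, rfl⟩
  deg_eq := ⟨θ (gdim c (LinearMap.ker φ)), fun W => by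
    unfold latDeg
    rw [← map_add, add_comm]
    exact congrArg θ (gdim_comap hφ hψ hφψ W.2.1)⟩
  rk_eq := ⟨∑ i, gdim c (LinearMap.ker φ) i, fun W => by
    unfold latRk
    rw [← Finset.sum_add_distrib]
    refine Finset.sum_congr rfl fun i _ => ?_
    rw [add_comm]
    exact congrFun (gdim_comap hφ hψ hφψ W.2.1) i⟩

end Graded

/-! ### Graded matrices -/

section GradedMatrices

variable {k : Type*} [Field k] {X X' : Type*}

/-- All nonzero entries of `M` are at places where `P` holds. -/
def SupportedOn (P : X → X' → Prop) (M : Matrix X X' k) : Prop := ∀ x y, ¬ P x y → M x y = 0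

theorem SupportedOn.mul {X'' : Type*} [Fintype X'] {P : X → X' → Prop} {P' : X' → X'' → Prop}
    {P'' : X → X'' → Prop} {M : Matrix X X' k} {M' : Matrix X' X'' k} (h : SupportedOn P M)
    (h' : SupportedOn P' M') (hP : ∀ x y z, P x y → P' y z → P'' x z) :
    SupportedOn P'' (M * M') := by
  intro x z hxz
  rw [Matrix.mul_apply]
  refine Finset.sum_eq_zero fun y _ => ?_
  by_cases h₁ : P x y
  · by_cases h₂ : P' y z
    · exact absurd (hP x y z h₁ h₂) hxz
    · rw [h' y z h₂, mul_zero]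
  · rw [h x y h₁, zero_mul]

theorem SupportedOn.transpose {P : X → X' → Prop} {M : Matrix X X' k} (h : SupportedOn P M) :
    SupportedOn (fun x y => P y x) M.transpose := fun x y hxy => h y x hxy

theorem SupportedOn.neg {P : X → X' → Prop} {M : Matrix X X' k} (h : SupportedOn P M) :
    SupportedOn P (-M) := fun x y hxy => by rw [Matrix.neg_apply, h x y hxy, neg_zero]

theorem SupportedOn.add {P : X → X' → Prop} {M M' : Matrix X X' k} (h : SupportedOn P M)
    (h' : SupportedOn P M') :
    SupportedOn P (M + M') := fun x y hxy => by
  rw [Matrix.add_apply, h x y hxy, h' x y hxy, add_zero]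

theorem SupportedOn.smul {P : X → X' → Prop} {M : Matrix X X' k} (h : SupportedOn P M) (r : k) :
    SupportedOn P (r • M) := fun x y hxy => by rw [Matrix.smul_apply, h x y hxy, smul_zero]

theorem SupportedOn.zero {P : X → X' → Prop} : SupportedOn P (0 : Matrix X X' k) :=
  fun _ _ _ => rfl

theorem SupportedOn.mono {P P' : X → X' → Prop} {M : Matrix X X' k} (h : SupportedOn P M)
    (hP : ∀ x y, P x y → P' x y) : SupportedOn P' M := fun x y hxy => h x y fun h => hxy (hP x y h)

variable {I : Type*} [DecidableEq I] [Fintype X] [DecidableEq X]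

/-- Matrices of homogeneous linear maps. -/
abbrev IsGraded (c : X → I) (M : Matrix X X k) : Prop := SupportedOn (fun x y => c x = c y) M

/-- This form of homogeneity visibly passes to inverses. -/
theorem isGraded_iff_commute (c : X → I) (M : Matrix X X k) : IsGraded c M ↔
    ∀ i, Commute (Matrix.diagonal fun x => if c x = i then (1 : k) else 0) M := by
  constructor
  · intro h i
    ext x y
    rw [Matrix.diagonal_mul, Matrix.mul_diagonal]
    by_cases hxy : c x = c y
    · rw [hxy, mul_comm]
    · rw [h x y hxy, mul_zero, zero_mul]
  · intro h x y hxy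
    have := congrFun (congrFun (h (c x)) x) y
    rw [Matrix.diagonal_mul, Matrix.mul_diagonal, if_pos rfl, one_mul, if_neg (fun e => hxy e.symm),
      mul_zero] at this
    exact this

theorem IsGraded.one {c : X → I} : IsGraded c (1 : Matrix X X k) :=
  fun x y h => Matrix.one_apply_ne fun e => h (by rw [e])

theorem IsGraded.unit_inv {c : X → I} {g : (Matrix X X k)ˣ} (h : IsGraded c (g : Matrix X X k)) :
    IsGraded c ((g⁻¹ : (Matrix X X k)ˣ) : Matrix X X k) := by
  rw [isGraded_iff_commute] at h ⊢
  exact fun i => (h i).units_inv_right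

theorem IsGraded.inv {c : X → I} {g : Matrix X X k} (h : IsGraded c g) : IsGraded c g⁻¹ := by
  by_cases hg : IsUnit g
  · obtain ⟨u, rfl⟩ := hg
    rw [← Matrix.coe_units_inv]
    exact h.unit_inv
  · rw [Matrix.nonsing_inv_apply_not_isUnit _ (by rwa [← Matrix.isUnit_iff_isUnit_det])]
    exact SupportedOn.zero

/-- The homogeneous linear automorphisms of `k^X`. -/
def gradedGL (k : Type*) [Field k] (c : X → I) : Subgroup (Matrix X X k)ˣ where
  carrier := {g | IsGraded c (g : Matrix X X k)}
  mul_mem' hg hh := SupportedOn.mul hg hh fun _ _ _ => Eq.trans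
  one_mem' := IsGraded.one
  inv_mem' hg := IsGraded.unit_inv hg

theorem IsGraded.mulVec_colorProj {c : X → I} {M : Matrix X X k} (h : IsGraded c M) (i : I)
    (v : X → k) : M.mulVec (colorProj k c i v) = colorProj k c i (M.mulVec v) := by
  ext x
  simp only [Matrix.mulVec, dotProduct, colorProj_apply]
  by_cases hx : c x = i
  · rw [if_pos hx]
    refine Finset.sum_congr rfl fun y _ => ?_
    by_cases hy : c y = i
    · rw [if_pos hy]
    · rw [h x y fun e => hy (Eq.trans (Eq.symm e) hx), zero_mul, zero_mul]
  · rw [if_neg hx]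
    refine Finset.sum_eq_zero fun y _ => ?_
    by_cases hy : c y = i
    · rw [h x y fun e => hx (Eq.trans e hy), zero_mul]
    · rw [if_neg hy, mul_zero]

variable {A : Type*} (Q : FQuiver I A)

/-- The representations of `Q` on `k^X`. -/
def repMat (k : Type*) [Field k] (c : X → I) : Set (A → Matrix X X k) :=
  {m | ∀ a, SupportedOn (fun x y => c x = Q.tgt a ∧ c y = Q.src a) (m a)}

/-- The action of automorphisms on representations. -/
def conjRep {c : X → I} (g : gradedGL k c) (m : A → Matrix X X k) : A → Matrix X X k :=
  fun a => (g.1 : Matrix X X k) * m a * ((g.1⁻¹ : (Matrix X X k)ˣ) : Matrix X X k)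

variable {Q}

theorem conjRep_one {c : X → I} (m : A → Matrix X X k) : conjRep (1 : gradedGL k c) m = m := by
  funext a
  simp [conjRep]

theorem conjRep_mul {c : X → I} (g h : gradedGL k c) (m : A → Matrix X X k) :
    conjRep (g * h) m = conjRep g (conjRep h m) := by
  funext a
  simp [conjRep, mul_assoc]

theorem conjRep_mem {c : X → I} (g : gradedGL k c) {m : A → Matrix X X k} (hm : m ∈ repMat Q k c) :
    conjRep g m ∈ repMat Q k c := by
  intro a
  refine SupportedOn.mul (P := fun x y => c x = Q.tgt a ∧ c y = Q.src a)
    (P' := fun x y => c x = c y) (SupportedOn.mul (P := fun x y => c x = c y) g.2 (hm a) ?_)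
    g.2.unit_inv ?_
  · rintro x y z h ⟨h₁, h₂⟩
    exact ⟨h.trans h₁, h₂⟩
  · rintro x y z ⟨h₁, h₂⟩ h
    exact ⟨h₁, h ▸ h₂⟩

/-- An automorphism as a linear equivalence. -/
def glEquiv {c : X → I} (g : gradedGL k c) : (X → k) ≃ₗ[k] (X → k) :=
  LinearEquiv.ofLinearMap (Matrix.mulVecLin (g.1 : Matrix X X k))
    (Matrix.mulVecLin ((g.1⁻¹ : (Matrix X X k)ˣ) : Matrix X X k))
    (by rw [← Matrix.mulVecLin_mul, Units.mul_inv, Matrix.mulVecLin_one])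
    (by rw [← Matrix.mulVecLin_mul, Units.inv_mul, Matrix.mulVecLin_one])

theorem glEquiv_apply {c : X → I} (g : gradedGL k c) (v : X → k) :
    glEquiv g v = (g.1 : Matrix X X k).mulVec v := rfl

theorem glEquiv_colorProj {c : X → I} (g : gradedGL k c) (i : I) (v : X → k) :
    glEquiv g (colorProj k c i v) = colorProj k c i (glEquiv g v) :=
  IsGraded.mulVec_colorProj g.2 i v

theorem glEquiv_conjRep {c : X → I} (g : gradedGL k c) (m : A → Matrix X X k) (a : A) (v : X → k) :
    glEquiv g ((m a).mulVec v) = (conjRep g m a).mulVec (glEquiv g v) := by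
  simp [glEquiv_apply, conjRep, mul_assoc]

end GradedMatrices

/-! ### Graded bases -/

section GradedBases

variable {I : Type*} [DecidableEq I] [Fintype I] {k : Type*} [Field k] {X Y : Type*} [Fintype X]
  [Fintype Y]

/-- Choose a basis of each homogeneous part of `W`, indexed by the coordinates of that colour in
`Y`. -/
theorem exists_graded_parametrization (c : X → I) (d : Y → I) {W : Submodule k (X → k)}
    (hW : IsGradedSubspace c W) (hd : gdim c W = toLat (colorDim d)) :
    ∃ φ : (Y → k) →ₗ[k] (X → k), Function.Injective φ ∧
      (∀ i v, φ (colorProj k d i v) = colorProj k c i (φ v)) ∧ LinearMap.range φ = W := by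
  classical
  have hb : ∀ i, Nonempty (Module.Basis {y // d y = i} k (W.map (colorProj k c i))) := by
    intro i
    have h₁ : Module.finrank k (W.map (colorProj k c i)) = Fintype.card {y // d y = i} := by
      rw [Fintype.card_subtype]
      exact Int.ofNat.inj (congrFun hd i)
    exact ⟨(Module.finBasisOfFinrankEq k _ h₁).reindex (Fintype.equivFin _).symm⟩
  let b := fun i => (hb i).some
  let u : Y → X → k := fun y => (b (d y) ⟨y, rfl⟩ : X → k)
  have hu : ∀ i y (h : d y = i), u y = (b i ⟨y, h⟩ : X → k) := by
    rintro i y rfl; rfl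
  have huW : ∀ y, u y ∈ W := by
    intro y
    obtain ⟨w, hw, e⟩ := (b (d y) ⟨y, rfl⟩).2
    change ((b (d y) ⟨y, rfl⟩ : W.map (colorProj k c (d y))) : X → k) ∈ W
    rw [← e]
    exact hW _ w hw
  have hproj : ∀ i y, colorProj k c i (u y) = if d y = i then u y else 0 := by
    intro i y
    obtain ⟨w, hw, e⟩ := (b (d y) ⟨y, rfl⟩).2
    have e' : u y = colorProj k c (d y) w := e.symm
    split_ifs with h
    · rw [e', ← h, colorProj_self]
    · rw [e', colorProj_ne c (fun e => h e.symm)]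
  let φ : (Y → k) →ₗ[k] (X → k) := Fintype.linearCombination k u
  have hφ : ∀ v, φ v = ∑ y, v y • u y := fun v => Fintype.linearCombination_apply k u v
  have hφg : ∀ i v, φ (colorProj k d i v) = colorProj k c i (φ v) := by
    intro i v
    rw [hφ, hφ, map_sum]
    refine Finset.sum_congr rfl fun y _ => ?_
    rw [map_smul, hproj, colorProj_apply]
    split_ifs <;> simp
  have hsub : ∀ i v, φ (colorProj k d i v) = ((∑ y : {y // d y = i}, v y.1 • b i y :
      W.map (colorProj k c i)) : X → k) := by
    intro i v
    rw [hφ, Submodule.coe_sum]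
    have h₁ : ∑ y, colorProj k d i v y • u y = ∑ y with d y = i, v y • u y := by
      rw [Finset.sum_filter]
      refine Finset.sum_congr rfl fun y _ => ?_
      rw [colorProj_apply]
      split_ifs <;> simp
    rw [h₁, Finset.sum_subtype (p := fun y => d y = i) _ (by simp)]
    refine Finset.sum_congr rfl fun y _ => ?_
    rw [Submodule.coe_smul, hu i y.1 y.2]
  refine ⟨φ, ?_, hφg, ?_⟩
  · rw [injective_iff_map_eq_zero]
    intro v hv
    ext y
    have h₁ := hsub (d y) v
    rw [hφg, hv, map_zero] at h₁
    have h₂ := Fintype.linearIndependent_iff.1 (b (d y)).linearIndependent (fun y => v y.1)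
      (Subtype.ext h₁.symm) ⟨y, rfl⟩
    exact h₂
  · apply le_antisymm
    · rintro _ ⟨v, rfl⟩
      rw [hφ]
      exact Submodule.sum_mem _ fun y _ => W.smul_mem _ (huW y)
    · intro w hw
      rw [← sum_colorProj c w]
      refine Submodule.sum_mem _ fun i _ => ?_
      have h₁ := (b i).sum_repr ⟨_, w, hw, rfl⟩
      refine ⟨colorProj k d i fun y => if h : d y = i then (b i).repr ⟨_, w, hw, rfl⟩ ⟨y, h⟩ else 0, ?_⟩
      rw [hsub]
      refine Eq.trans ?_ (congrArg Subtype.val h₁)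
      congr 1
      refine Finset.sum_congr rfl fun y _ => ?_
      rw [dif_pos y.2]

/-- An arbitrary linear projection onto `W` becomes homogeneous when it is replaced by the sum of
its diagonal components; the kernel is then a graded complement. -/
theorem exists_graded_complement (c : X → I) {W : Submodule k (X → k)}
    (hW : IsGradedSubspace c W) : ∃ W', IsGradedSubspace c W' ∧ W ⊓ W' = ⊥ ∧ W ⊔ W' = ⊤ := by
  obtain ⟨p, hp⟩ := LinearMap.exists_leftInverse_of_injective W.subtype (Submodule.ker_subtype W)
  have hpw : ∀ w (hw : w ∈ W), (p w : X → k) = w := fun w hw =>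
    congrArg Subtype.val (LinearMap.congr_fun hp ⟨w, hw⟩)
  let p' : (X → k) →ₗ[k] (X → k) :=
    ∑ i, colorProj k c i ∘ₗ W.subtype ∘ₗ p ∘ₗ colorProj k c i
  have hp' : ∀ v, p' v = ∑ i, colorProj k c i (p (colorProj k c i v)) := fun v => by
    simp [p', LinearMap.sum_apply]
  have h₁ : ∀ w ∈ W, p' w = w := by
    intro w hw
    rw [hp']
    conv_rhs => rw [← sum_colorProj c w]
    refine Finset.sum_congr rfl fun i _ => ?_
    rw [hpw _ (hW i w hw), colorProj_self]
  have h₂ : ∀ v, p' v ∈ W := by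
    intro v
    rw [hp']
    exact Submodule.sum_mem _ fun i _ => hW i _ (p _).2
  refine ⟨LinearMap.ker p', ?_, ?_, ?_⟩
  · intro j v hv
    rw [LinearMap.mem_ker] at hv ⊢
    have : p' (colorProj k c j v) = colorProj k c j (p' v) := by
      rw [hp', hp', map_sum]
      refine Finset.sum_congr rfl fun i _ => ?_
      by_cases h : i = j
      · subst h
        rw [colorProj_self, colorProj_self]
      · rw [colorProj_ne c h, colorProj_ne c (Ne.symm h), map_zero, Submodule.coe_zero, map_zero]
    rw [this, hv, map_zero]
  · rw [eq_bot_iff]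
    rintro v ⟨hv, hv'⟩
    rw [← h₁ v hv]
    exact hv'
  · rw [eq_top_iff]
    intro v _
    rw [← add_sub_cancel (p' v) v]
    refine Submodule.add_mem_sup (h₂ v) ?_
    rw [LinearMap.mem_ker, map_sub, h₁ _ (h₂ v), sub_self]

variable [DecidableEq X]

theorem exists_gradedGL (c : X → I) (φ : (X → k) →ₗ[k] (X → k)) (hφi : Function.Injective φ)
    (hφ : ∀ i v, φ (colorProj k c i v) = colorProj k c i (φ v)) :
    ∃ g : gradedGL k c, ∀ v, glEquiv g v = φ v := by
  have hu : IsUnit (LinearMap.toMatrix' φ) := by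
    rw [← Matrix.mulVec_injective_iff_isUnit]
    intro v w h
    rw [LinearMap.toMatrix'_mulVec, LinearMap.toMatrix'_mulVec] at h
    exact hφi h
  obtain ⟨g, hg⟩ := hu
  refine ⟨⟨g, ?_⟩, fun v => ?_⟩
  · change IsGraded c (g : Matrix X X k)
    rw [hg]
    intro x y hxy
    rw [LinearMap.toMatrix'_apply]
    have := hφ (c x) (fun j => if j = y then 1 else 0)
    have h0 : colorProj k c (c x) (fun j => if j = y then (1 : k) else 0) = 0 := by
      ext j
      rw [colorProj_apply]
      by_cases h : c j = c x
      · have : j ≠ y := by rintro rfl; exact hxy h.symm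
        simp [this]
      · simp [h]
    rw [h0, map_zero] at this
    have := congrFun this x
    rw [colorProj_apply, if_pos rfl] at this
    have e : (Pi.single y (1 : k) : X → k) = fun j => if j = y then 1 else 0 := by
      ext j; simp [Pi.single_apply]
    rw [e]
    exact this.symm
  · rw [glEquiv_apply, hg, LinearMap.toMatrix'_mulVec]

variable {X₁ X₂ : Type*} 

/-- Extension of coordinate vectors by zero. -/
def inlVec (k : Type*) [Field k] (X₁ X₂ : Type*) : (X₁ → k) →ₗ[k] (X₁ ⊕ X₂ → k) where
  toFun v := Sum.elim v (0 : X₂ → k)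
  map_add' v w := by ext (x | x) <;> simp
  map_smul' r v := by ext (x | x) <;> simp

/-- Extension of coordinate vectors by zero. -/
def inrVec (k : Type*) [Field k] (X₁ X₂ : Type*) : (X₂ → k) →ₗ[k] (X₁ ⊕ X₂ → k) where
  toFun v := Sum.elim (0 : X₁ → k) v
  map_add' v w := by ext (x | x) <;> simp
  map_smul' r v := by ext (x | x) <;> simp

/-- Restriction of coordinate vectors. -/
def resInl (k : Type*) [Field k] (X₁ X₂ : Type*) : (X₁ ⊕ X₂ → k) →ₗ[k] (X₁ → k) where
  toFun v := v ∘ Sum.inl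
  map_add' _ _ := rfl
  map_smul' _ _ := rfl

/-- Restriction of coordinate vectors. -/
def resInr (k : Type*) [Field k] (X₁ X₂ : Type*) : (X₁ ⊕ X₂ → k) →ₗ[k] (X₂ → k) where
  toFun v := v ∘ Sum.inr
  map_add' _ _ := rfl
  map_smul' _ _ := rfl

theorem inlVec_apply (v : X₁ → k) : inlVec k X₁ X₂ v = Sum.elim v (0 : X₂ → k) := rfl

theorem inrVec_apply (v : X₂ → k) : inrVec k X₁ X₂ v = Sum.elim (0 : X₁ → k) v := rfl

theorem resInl_apply (v : X₁ ⊕ X₂ → k) : resInl k X₁ X₂ v = v ∘ Sum.inl := rfl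

theorem resInr_apply (v : X₁ ⊕ X₂ → k) : resInr k X₁ X₂ v = v ∘ Sum.inr := rfl

variable (c₁ : X₁ → I) (c₂ : X₂ → I)

theorem inlVec_colorProj (i : I) (v : X₁ → k) : inlVec k X₁ X₂ (colorProj k c₁ i v)
    = colorProj k (Sum.elim c₁ c₂) i (inlVec k X₁ X₂ v) := by
  ext (x | x)
  · rfl
  · exact (ite_self (0 : k)).symm

theorem inrVec_colorProj (i : I) (v : X₂ → k) : inrVec k X₁ X₂ (colorProj k c₂ i v)
    = colorProj k (Sum.elim c₁ c₂) i (inrVec k X₁ X₂ v) := by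
  ext (x | x)
  · exact (ite_self (0 : k)).symm
  · rfl

theorem resInl_colorProj (i : I) (v : X₁ ⊕ X₂ → k) :
    resInl k X₁ X₂ (colorProj k (Sum.elim c₁ c₂) i v) = colorProj k c₁ i (resInl k X₁ X₂ v) := by
  rfl

theorem resInr_colorProj (i : I) (v : X₁ ⊕ X₂ → k) :
    resInr k X₁ X₂ (colorProj k (Sum.elim c₁ c₂) i v) = colorProj k c₂ i (resInr k X₁ X₂ v) := by
  rfl

theorem inlVec_injective : Function.Injective (inlVec k X₁ X₂) := fun v w h => by
  ext x; exact congrFun h (Sum.inl x)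

theorem inlVec_add_inrVec (v : X₁ ⊕ X₂ → k) :
    inlVec k X₁ X₂ (resInl k X₁ X₂ v) + inrVec k X₁ X₂ (resInr k X₁ X₂ v) = v := by
  ext (x | x) <;> simp [inlVec_apply, inrVec_apply, resInl_apply, resInr_apply]

theorem ker_resInr : LinearMap.ker (resInr k X₁ X₂) = LinearMap.range (inlVec k X₁ X₂) := by
  ext v
  constructor
  · intro h
    refine ⟨resInl k X₁ X₂ v, ?_⟩
    conv_rhs => rw [← inlVec_add_inrVec v, LinearMap.mem_ker.1 h, map_zero, add_zero]
  · rintro ⟨w, rfl⟩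
    rfl

theorem colorDim_sum [Fintype X₁] [Fintype X₂] :
    colorDim (Sum.elim c₁ c₂) = colorDim c₁ + colorDim c₂ := by
  classical
  funext i
  simp only [colorDim, Pi.add_apply, ← Fintype.card_subtype]
  rw [Fintype.card_congr (Equiv.subtypeSum), Fintype.card_sum]
  rfl

theorem gdim_range [Fintype X₁] {c : X → I} {φ : (X₁ → k) →ₗ[k] (X → k)}
    (hφi : Function.Injective φ)
    (hφ : ∀ i v, φ (colorProj k c₁ i v) = colorProj k c i (φ v)) :
    gdim c (LinearMap.range φ) = toLat (colorDim c₁) := by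
  rw [LinearMap.range_eq_map, gdim_map hφi hφ, gdim_top]

/-- Transitivity on graded subspaces of fixed dimension vector: parametrise the subspace and a
graded complement, and take the inverse of the combined map. -/
theorem exists_gradedGL_adapted [Fintype X₁] [Fintype X₂] [DecidableEq X₁] [DecidableEq X₂]
    {W : Submodule k (X₁ ⊕ X₂ → k)}
    (hW : IsGradedSubspace (Sum.elim c₁ c₂) W) (hd : gdim (Sum.elim c₁ c₂) W = toLat (colorDim c₁)) :
    ∃ g : gradedGL k (Sum.elim c₁ c₂), W.map (glEquiv g).toLinearMap
      = LinearMap.range (inlVec k X₁ X₂) := by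
  obtain ⟨W', hW', hinf, hsup⟩ := exists_graded_complement _ hW
  have hd' : gdim (Sum.elim c₁ c₂) W' = toLat (colorDim c₂) := by
    have := gdim_add hW hW'
    rw [hinf, hsup, gdim_bot, gdim_top, colorDim_sum, add_zero, hd] at this
    funext i
    have := congrFun this i
    simp only [toLat, Pi.add_apply] at this ⊢
    push_cast at this
    linarith
  obtain ⟨φ, hφi, hφ, hφW⟩ := exists_graded_parametrization _ c₁ hW hd
  obtain ⟨ψ, hψi, hψ, hψW⟩ := exists_graded_parametrization _ c₂ hW' hd'
  obtain ⟨g, hg⟩ := exists_gradedGL (Sum.elim c₁ c₂)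
    (φ ∘ₗ resInl k X₁ X₂ + ψ ∘ₗ resInr k X₁ X₂) (by
      rw [injective_iff_map_eq_zero]
      intro v hv
      have h₁ : φ (resInl k X₁ X₂ v) = -ψ (resInr k X₁ X₂ v) := eq_neg_of_add_eq_zero_left hv
      have h₂ : φ (resInl k X₁ X₂ v) ∈ W ⊓ W' := by
        refine ⟨hφW ▸ ⟨_, rfl⟩, ?_⟩
        rw [h₁, ← hψW]
        exact Submodule.neg_mem _ ⟨_, rfl⟩
      rw [hinf, Submodule.mem_bot] at h₂
      rw [h₂, eq_comm, neg_eq_zero] at h₁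
      rw [← inlVec_add_inrVec v, hφi (h₂.trans (map_zero φ).symm), hψi (h₁.trans (map_zero ψ).symm)]
      simp) (by
      intro i v
      simp only [LinearMap.add_apply, LinearMap.comp_apply, resInl_colorProj, resInr_colorProj, hφ,
        hψ, map_add])
  refine ⟨g⁻¹, ?_⟩
  have hinv : ∀ v, glEquiv g⁻¹ (glEquiv g v) = v := by
    intro v
    simp [glEquiv_apply]
  have : W = (LinearMap.range (inlVec k X₁ X₂)).map (glEquiv g).toLinearMap := by
    rw [← hφW]
    ext w
    constructor
    · rintro ⟨v, rfl⟩
      refine ⟨_, ⟨v, rfl⟩, ?_⟩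
      change glEquiv g (inlVec k X₁ X₂ v) = φ v
      rw [hg]
      change φ v + ψ 0 = φ v
      rw [map_zero, add_zero]
    · rintro ⟨_, ⟨v, rfl⟩, rfl⟩
      refine ⟨v, ?_⟩
      change φ v = glEquiv g (inlVec k X₁ X₂ v)
      rw [hg]
      change φ v = φ v + ψ 0
      rw [map_zero, add_zero]
  rw [this, ← Submodule.map_comp]
  convert Submodule.map_id _
  exact LinearMap.ext hinv

end GradedBases

/-! ### Counting representations with a subrepresentation -/

/-- A property of intervals in lattices with degree and rank that is invariant under convex
embeddings. -/
structure IntervalPredicate where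
  holds : ∀ {L : Type u₁} [Lattice L], (L → ℤ) → (L → ℤ) → L → L → Prop
  transfer : ∀ {L L' : Type u₁} [Lattice L] [Lattice L'] {deg rk : L → ℤ} {deg' rk' : L' → ℤ}
    {f : L' → L}, IsConvexEmbedding deg rk deg' rk' f → ∀ a b : L',
      (holds deg rk (f a) (f b) ↔ holds deg' rk' a b)

/-- Semistability of slope `μ`. -/
def IntervalPredicate.semistable (μ : ℚ) : IntervalPredicate where
  holds deg rk a b := SemistableInterval deg rk μ a b
  transfer hf a b := hf.semistable_iff μ a b

/-- Positivity of all slopes of quotients. -/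
def IntervalPredicate.positive : IntervalPredicate where
  holds deg _ a b := PositiveInterval deg a b
  transfer hf a b := hf.positive_iff a b

/-- Existence of a Harder-Narasimhan filtration with slopes in a given list. -/
def IntervalPredicate.hn (l : List ℚ) : IntervalPredicate where
  holds deg rk a b := HNInterval deg rk l a b
  transfer hf a b := hf.hn_iff l a b

section

variable {I : Type*} [DecidableEq I] [Fintype I] {A : Type*} [Fintype A] (Q : FQuiver I A)
  {k : Type u₁} [Field k] [Finite k] {X X' X₁ X₂ : Type u₂} [Fintype X] [Fintype X'] [DecidableEq X]
  [DecidableEq X'] [Fintype X₁] [Fintype X₂] [DecidableEq X₁] [DecidableEq X₂]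

/-- The representations on `k^X` with the given property. -/
def repSet (P : IntervalPredicate.{max u₁ u₂}) (θ : Module.Dual ℤ (I → ℤ)) (k : Type u₁) [Field k]
    (c : X → I) : Set (A → Matrix X X k) :=
  {m | m ∈ repMat Q k c ∧ P.holds (latDeg (c := c) (m := m) θ) latRk ⊥ ⊤}

theorem exists_color_equiv {c : X → I} {c' : X' → I} (h : colorDim c = colorDim c') :
    ∃ e : X ≃ X', ∀ x, c' (e x) = c x := by
  have hf : ∀ i, Nonempty ({x // c x = i} ≃ {x // c' x = i}) := by
    intro i
    have := congrFun h i
    simp only [colorDim] at this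
    rw [← Fintype.card_subtype, ← Fintype.card_subtype] at this
    exact ⟨Fintype.equivOfCardEq this⟩
  refine ⟨(Equiv.sigmaFiberEquiv c).symm.trans
    ((Equiv.sigmaCongrRight fun i => (hf i).some).trans (Equiv.sigmaFiberEquiv c')), fun x => ?_⟩
  exact ((hf (c x)).some ⟨x, rfl⟩).2

theorem card_gradedGL (c : X → I) :
    Nat.card (gradedGL k c) = {M : Matrix X X k | IsGraded c M ∧ IsUnit M}.ncard := by
  rw [← Nat.card_coe_set_eq]
  refine Nat.card_congr ⟨fun g => ⟨g.1, g.2, g.1.isUnit⟩, fun M => ⟨M.2.2.unit, M.2.1⟩, ?_, ?_⟩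
  · intro g
    ext1; ext1; rfl
  · intro M
    rfl

theorem ncard_gradedGL_set (c : X → I) (S : Set (Matrix X X k)) :
    {g : gradedGL k c | (g.1 : Matrix X X k) ∈ S}.ncard
      = {M : Matrix X X k | (IsGraded c M ∧ IsUnit M) ∧ M ∈ S}.ncard := by
  refine Set.ncard_congr (fun g _ => (g.1 : Matrix X X k)) ?_ ?_ ?_
  · intro g hg
    exact ⟨⟨g.2, g.1.isUnit⟩, hg⟩
  · intro g h _ _ e
    exact Subtype.ext (Units.ext e)
  · rintro M ⟨⟨h₁, h₂⟩, h₃⟩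
    exact ⟨⟨h₂.unit, h₁⟩, h₃, rfl⟩

theorem card_gradedGL_congr {c : X → I} {c' : X' → I} (h : colorDim c = colorDim c') :
    Nat.card (gradedGL k c) = Nat.card (gradedGL k c') := by
  obtain ⟨e, he⟩ := exists_color_equiv h
  rw [card_gradedGL, card_gradedGL]
  refine Set.ncard_congr (fun M _ => M.submatrix e.symm e.symm) ?_ ?_ ?_
  · rintro M ⟨h₁, h₂⟩
    refine ⟨fun x y hxy => h₁ _ _ fun h => hxy ?_, (Matrix.isUnit_submatrix_equiv _ _).2 h₂⟩
    dsimp only at h ⊢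
    rwa [← he, ← he, e.apply_symm_apply, e.apply_symm_apply] at h
  · intro M N _ _ hMN
    have := congrArg (fun M => M.submatrix e e) hMN
    simpa using this
  · rintro M ⟨h₁, h₂⟩
    refine ⟨M.submatrix e e, ⟨fun x y hxy => h₁ _ _ fun h => hxy ?_, (Matrix.isUnit_submatrix_equiv _ _).2 h₂⟩,
      by simp⟩
    dsimp only at h ⊢
    rwa [he, he] at h

theorem reindex_mulVec (e : X ≃ X') (M : Matrix X X k) (v : X → k) :
    (LinearEquiv.funCongrLeft k k e.symm) (M.mulVec v)
      = (M.submatrix e.symm e.symm).mulVec (LinearEquiv.funCongrLeft k k e.symm v) := by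
  ext x
  simp only [LinearEquiv.funCongrLeft_apply, LinearMap.funLeft_apply, Matrix.mulVec, dotProduct,
    Matrix.submatrix_apply]
  exact (Equiv.sum_comp e.symm fun y => M (e.symm x) y * v y).symm

theorem reindex_colorProj {c : X → I} {c' : X' → I} (e : X ≃ X') (he : ∀ x, c' (e x) = c x) (i : I)
    (v : X → k) : LinearEquiv.funCongrLeft k k e.symm (colorProj k c i v)
      = colorProj k c' i (LinearEquiv.funCongrLeft k k e.symm v) := by
  ext x
  simp only [LinearEquiv.funCongrLeft_apply, LinearMap.funLeft_apply, colorProj_apply]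
  rw [← he, e.apply_symm_apply]

variable {Q}

theorem mapInv_bot {c : X → I} {c' : X' → I} {m : A → Matrix X X k} {m' : A → Matrix X' X' k}
    (φ : (X → k) →ₗ[k] (X' → k))
    (hφ : ∀ i v, φ (colorProj k c i v) = colorProj k c' i (φ v))
    (hm : ∀ a v, φ ((m a).mulVec v) = (m' a).mulVec (φ v)) :
    mapInv φ hφ hm ⊥ = ⊥ := Subtype.ext (Submodule.map_bot φ)

theorem mapInv_top {c : X → I} {c' : X' → I} {m : A → Matrix X X k} {m' : A → Matrix X' X' k}
    (φ : (X → k) ≃ₗ[k] (X' → k))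
    (hφ : ∀ i v, φ (colorProj k c i v) = colorProj k c' i (φ v))
    (hm : ∀ a v, φ ((m a).mulVec v) = (m' a).mulVec (φ v)) :
    mapInv φ.toLinearMap hφ hm ⊤ = ⊤ :=
  Subtype.ext ((Submodule.map_top _).trans (LinearEquiv.range φ))

variable (Q)

theorem reindex_mem_repMat {c : X → I} {c' : X' → I} (e : X ≃ X') (he : ∀ x, c' (e x) = c x)
    {m : A → Matrix X X k} (hm : m ∈ repMat Q k c) :
    (fun a => (m a).submatrix e.symm e.symm) ∈ repMat Q k c' := by
  intro a x y hxy
  refine hm a _ _ fun h => hxy ?_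
  dsimp only at h ⊢
  rwa [← he, ← he, e.apply_symm_apply, e.apply_symm_apply] at h

/-! #### Block triangular matrices -/

theorem fromBlocks_mulVec_inl (p : Matrix X₁ X₁ k) (b : Matrix X₁ X₂ k) (r : Matrix X₂ X₂ k)
    (v : X₁ → k) : inlVec k X₁ X₂ (p.mulVec v)
      = (Matrix.fromBlocks p b 0 r).mulVec (inlVec k X₁ X₂ v) := by
  rw [Matrix.fromBlocks_mulVec]
  ext (x | x) <;> simp [inlVec_apply, Function.comp_def, Matrix.mulVec, dotProduct]

theorem fromBlocks_mulVec_resInr (p : Matrix X₁ X₁ k) (b : Matrix X₁ X₂ k) (r : Matrix X₂ X₂ k)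
    (v : X₁ ⊕ X₂ → k) : resInr k X₁ X₂ ((Matrix.fromBlocks p b 0 r).mulVec v)
      = r.mulVec (resInr k X₁ X₂ v) := by
  rw [Matrix.fromBlocks_mulVec]
  ext x
  simp [resInr_apply, Function.comp_def, Matrix.mulVec, dotProduct]

theorem map_inl_le_iff (M : Matrix (X₁ ⊕ X₂) (X₁ ⊕ X₂) k) :
    (∀ v ∈ LinearMap.range (inlVec k X₁ X₂), M.mulVec v ∈ LinearMap.range (inlVec k X₁ X₂)) ↔
      M.toBlocks₂₁ = 0 := by
  constructor
  · intro h
    ext x y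
    obtain ⟨w, hw⟩ := h (inlVec k X₁ X₂ (Pi.single y 1)) ⟨_, rfl⟩
    have := congrFun hw (Sum.inr x)
    have e : inlVec k X₁ X₂ (Pi.single y 1) = Pi.single (Sum.inl y) 1 := by
      ext (z | z) <;> simp [inlVec_apply, Pi.single_apply]
    rw [e, Matrix.mulVec_single_one] at this
    exact this.symm
  · rintro h _ ⟨v, rfl⟩
    rw [← Matrix.fromBlocks_toBlocks M, h, ← fromBlocks_mulVec_inl]
    exact ⟨_, rfl⟩

theorem ncard_supportedOn (P : X₁ → X₂ → Prop) [∀ x y, Decidable (P x y)] :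
    {M : Matrix X₁ X₂ k | SupportedOn P M}.ncard
      = Nat.card k ^ (Finset.univ.filter fun z : X₁ × X₂ => P z.1 z.2).card := by
  rw [← ncard_support (k := k) fun z : X₁ × X₂ => P z.1 z.2]
  refine Set.ncard_congr (fun M _ z => M z.1 z.2) ?_ ?_ ?_
  · intro M hM z hz
    exact hM _ _ hz
  · intro M N _ _ h
    ext x y
    exact congrFun h (x, y)
  · intro f hf
    exact ⟨fun x y => f (x, y), fun x y hxy => hf (x, y) hxy, rfl⟩

theorem ncard_supportedOn_family (P : A → X₁ → X₂ → Prop) [∀ a x y, Decidable (P a x y)] :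
    {M : A → Matrix X₁ X₂ k | ∀ a, SupportedOn (P a) (M a)}.ncard
      = Nat.card k ^ (Finset.univ.filter fun z : A × X₁ × X₂ => P z.1 z.2.1 z.2.2).card := by
  rw [← ncard_support (k := k) fun z : A × X₁ × X₂ => P z.1 z.2.1 z.2.2]
  refine Set.ncard_congr (fun M _ z => M z.1 z.2.1 z.2.2) ?_ ?_ ?_
  · intro M hM z hz
    exact hM _ _ _ hz
  · intro M N _ _ h
    ext a x y
    exact congrFun h (a, x, y)
  · intro f hf
    exact ⟨fun a x y => f (a, x, y), fun a x y hxy => hf (a, x, y) hxy, rfl⟩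

theorem supportedOn_fromBlocks {P : X₁ ⊕ X₂ → X₁ ⊕ X₂ → Prop} (p : Matrix X₁ X₁ k)
    (b : Matrix X₁ X₂ k) (w : Matrix X₂ X₁ k) (r : Matrix X₂ X₂ k) :
    SupportedOn P (Matrix.fromBlocks p b w r) ↔
      SupportedOn (fun x y => P (Sum.inl x) (Sum.inl y)) p ∧
      SupportedOn (fun x y => P (Sum.inl x) (Sum.inr y)) b ∧
      SupportedOn (fun x y => P (Sum.inr x) (Sum.inl y)) w ∧
      SupportedOn (fun x y => P (Sum.inr x) (Sum.inr y)) r := by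
  constructor
  · intro h
    exact ⟨fun x y => h (Sum.inl x) (Sum.inl y), fun x y => h (Sum.inl x) (Sum.inr y),
      fun x y => h (Sum.inr x) (Sum.inl y), fun x y => h (Sum.inr x) (Sum.inr y)⟩
  · rintro ⟨h₁, h₂, h₃, h₄⟩ (x | x) (y | y)
    exacts [h₁ x y, h₂ x y, h₃ x y, h₄ x y]

/-- The order of a parabolic subgroup, namely that of its Levi subgroup times that of its unipotent
radical. Each stabiliser in the Hall count is of this size. -/
theorem ncard_gradedGL_parabolic (c₁ : X₁ → I) (c₂ : X₂ → I) :
    {g : gradedGL k (Sum.elim c₁ c₂) | (g.1 : Matrix (X₁ ⊕ X₂) (X₁ ⊕ X₂) k).toBlocks₂₁ = 0}.ncard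
      = Nat.card (gradedGL k c₁) * Nat.card (gradedGL k c₂) *
        Nat.card k ^ (Finset.univ.filter fun z : X₁ × X₂ => c₁ z.1 = c₂ z.2).card := by
  rw [← ncard_supportedOn (fun x y => c₁ x = c₂ y), card_gradedGL, card_gradedGL,
    ← Set.ncard_prod, ← Set.ncard_prod]
  refine (ncard_gradedGL_set (Sum.elim c₁ c₂) {M | M.toBlocks₂₁ = 0}).trans ?_
  symm
  refine Set.ncard_congr (fun z _ => Matrix.fromBlocks z.1.1 z.2 0 z.1.2) ?_ ?_ ?_
  · rintro ⟨⟨M, N⟩, b⟩ ⟨⟨⟨h₁, h₂⟩, h₃, h₄⟩, h₅⟩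
    exact ⟨⟨(supportedOn_fromBlocks _ _ _ _).2 ⟨h₁, h₅, SupportedOn.zero, h₃⟩,
      Matrix.isUnit_fromBlocks_zero₂₁.2 ⟨h₂, h₄⟩⟩, Matrix.toBlocks_fromBlocks₂₁ _ _ _ _⟩
  · rintro ⟨⟨M, N⟩, b⟩ ⟨⟨M', N'⟩, b'⟩ _ _ h
    obtain ⟨h₁, h₂, -, h₃⟩ := Matrix.fromBlocks_inj.1 h
    rw [show M = M' from h₁, show b = b' from h₂, show N = N' from h₃]
  · rintro M ⟨⟨h₁, h₂⟩, h₃ : M.toBlocks₂₁ = 0⟩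
    rw [← Matrix.fromBlocks_toBlocks M, h₃] at h₁ h₂
    obtain ⟨h₄, h₅, -, h₆⟩ := (supportedOn_fromBlocks _ _ _ _).1 h₁
    have h₇ := Matrix.isUnit_fromBlocks_zero₂₁.1 h₂
    refine ⟨((M.toBlocks₁₁, M.toBlocks₂₂), M.toBlocks₁₂), ⟨⟨⟨h₄, h₇.1⟩, h₆, h₇.2⟩, h₅⟩, ?_⟩
    conv_rhs => rw [← Matrix.fromBlocks_toBlocks M, h₃]

theorem range_inl_mem_invLat (c₁ : X₁ → I) (c₂ : X₂ → I) (m : A → Matrix (X₁ ⊕ X₂) (X₁ ⊕ X₂) k) :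
    LinearMap.range (inlVec k X₁ X₂) ∈ invLat (Sum.elim c₁ c₂) m ↔ ∀ a, (m a).toBlocks₂₁ = 0 := by
  rw [mem_invLat]
  constructor
  · intro h a
    exact (map_inl_le_iff _).1 (h.2 a)
  · intro h
    refine ⟨?_, fun a => (map_inl_le_iff _).2 (h a)⟩
    rintro i _ ⟨v, rfl⟩
    rw [← inlVec_colorProj]
    exact ⟨_, rfl⟩

variable (P₁ P₂ : IntervalPredicate.{max u₁ u₂}) (θ : Module.Dual ℤ (I → ℤ))

theorem holds_sub_iff (c₁ : X₁ → I) (c₂ : X₂ → I) (p : A → Matrix X₁ X₁ k) (b : A → Matrix X₁ X₂ k)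
    (r : A → Matrix X₂ X₂ k)
    (W : invLat (Sum.elim c₁ c₂) fun a => Matrix.fromBlocks (p a) (b a) 0 (r a))
    (hW : W.1 = LinearMap.range (inlVec k X₁ X₂)) :
    P₁.holds (latDeg θ) latRk ⊥ W ↔ P₁.holds (latDeg (c := c₁) (m := p) θ) latRk ⊥ ⊤ := by
  have := P₁.transfer (mapInv_convex θ (c := c₁) (c' := Sum.elim c₁ c₂) (m := p)
    (m' := fun a => Matrix.fromBlocks (p a) (b a) 0 (r a)) inlVec_injective
    (inlVec_colorProj c₁ c₂) fun a v => fromBlocks_mulVec_inl (p a) (b a) (r a) v) ⊥ ⊤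
  rw [mapInv_bot] at this
  convert this
  exact Subtype.ext (hW.trans (LinearMap.range_eq_map _))

theorem holds_quotient_iff (c₁ : X₁ → I) (c₂ : X₂ → I) (p : A → Matrix X₁ X₁ k)
    (b : A → Matrix X₁ X₂ k) (r : A → Matrix X₂ X₂ k)
    (W : invLat (Sum.elim c₁ c₂) fun a => Matrix.fromBlocks (p a) (b a) 0 (r a))
    (hW : W.1 = LinearMap.range (inlVec k X₁ X₂)) :
    P₂.holds (latDeg θ) latRk W ⊤ ↔ P₂.holds (latDeg (c := c₂) (m := r) θ) latRk ⊥ ⊤ := by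
  have := P₂.transfer (comapInv_convex θ (c := Sum.elim c₁ c₂) (c' := c₂)
    (m := fun a => Matrix.fromBlocks (p a) (b a) 0 (r a)) (m' := r)
    (resInr_colorProj c₁ c₂) (inrVec_colorProj c₁ c₂) (fun v => rfl)
    fun a v => fromBlocks_mulVec_resInr (p a) (b a) (r a) v) ⊥ ⊤
  convert this
  · exact Subtype.ext (hW.trans ker_resInr.symm)
  · exact Subtype.ext (Submodule.comap_top _).symm

/-- The image of a subrepresentation under an automorphism. -/
def glMap {c : X → I} (g : gradedGL k c) {m : A → Matrix X X k} (W : invLat c m) :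
    invLat c (conjRep g m) :=
  mapInv (glEquiv g).toLinearMap (glEquiv_colorProj g) (glEquiv_conjRep g m) W

theorem holds_glMap (P : IntervalPredicate.{max u₁ u₂}) {c : X → I} (g : gradedGL k c)
    {m : A → Matrix X X k} (W W' : invLat c m) :
    P.holds (latDeg θ) latRk (glMap g W) (glMap g W') ↔ P.holds (latDeg θ) latRk W W' :=
  P.transfer (mapInv_convex θ (glEquiv g).injective (glEquiv_colorProj g) (glEquiv_conjRep g m)) W W'

theorem glMap_bot {c : X → I} (g : gradedGL k c) {m : A → Matrix X X k} :
    glMap g (⊥ : invLat c m) = ⊥ := mapInv_bot _ _ _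

theorem glMap_top {c : X → I} (g : gradedGL k c) {m : A → Matrix X X k} :
    glMap g (⊤ : invLat c m) = ⊤ := mapInv_top _ _ _

theorem glEquiv_inv_apply {c : X → I} (g : gradedGL k c) (v : X → k) :
    glEquiv g (glEquiv g⁻¹ v) = v := by simp [glEquiv_apply]

theorem map_glEquiv_eq {c : X → I} (g : gradedGL k c) {W : Submodule k (X → k)}
    (h : ∀ v ∈ W, (g.1 : Matrix X X k).mulVec v ∈ W) : W.map (glEquiv g).toLinearMap = W := by
  refine Submodule.eq_of_le_of_finrank_le ?_ ?_
  · rintro _ ⟨v, hv, rfl⟩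
    exact h v hv
  · rw [LinearEquiv.finrank_map_eq]

/-- This is the Hall algebra product in terms of numbers of points. The slice consists of the
representations for which the standard coordinate subspace has the two properties; these are block
triangular with free corner. By uniqueness of the distinguished subspace, `g` keeps such a
representation in the slice exactly when `g` is parabolic. -/
theorem hall_count (c₁ : X₁ → I) (c₂ : X₂ → I)
    (huniq : ∀ (m : A → Matrix (X₁ ⊕ X₂) (X₁ ⊕ X₂) k) (W W' : invLat (Sum.elim c₁ c₂) m),
      P₁.holds (latDeg θ) latRk ⊥ W → P₂.holds (latDeg θ) latRk W ⊤ →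
      P₁.holds (latDeg θ) latRk ⊥ W' → P₂.holds (latDeg θ) latRk W' ⊤ → W = W') :
    {m | m ∈ repMat Q k (Sum.elim c₁ c₂) ∧ ∃ W : invLat (Sum.elim c₁ c₂) m,
        gdim (Sum.elim c₁ c₂) W.1 = toLat (colorDim c₁) ∧
        P₁.holds (latDeg θ) latRk ⊥ W ∧ P₂.holds (latDeg θ) latRk W ⊤}.ncard
      * (Nat.card (gradedGL k c₁) * Nat.card (gradedGL k c₂) *
        Nat.card k ^ (Finset.univ.filter fun z : X₁ × X₂ => c₁ z.1 = c₂ z.2).card)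
    = Nat.card (gradedGL k (Sum.elim c₁ c₂)) *
      ((repSet Q P₁ θ k c₁).ncard * (repSet Q P₂ θ k c₂).ncard *
        Nat.card k ^ (Finset.univ.filter fun z : A × X₁ × X₂ =>
          c₁ z.2.1 = Q.tgt z.1 ∧ c₂ z.2.2 = Q.src z.1).card) := by
  set c := Sum.elim c₁ c₂ with hc
  let S : Set (A → Matrix (X₁ ⊕ X₂) (X₁ ⊕ X₂) k) := {m | m ∈ repMat Q k c ∧ ∃ W : invLat c m,
    W.1 = LinearMap.range (inlVec k X₁ X₂) ∧
      P₁.holds (latDeg θ) latRk ⊥ W ∧ P₂.holds (latDeg θ) latRk W ⊤}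
  have hS : S.ncard = (repSet Q P₁ θ k c₁).ncard * (repSet Q P₂ θ k c₂).ncard *
        Nat.card k ^ (Finset.univ.filter fun z : A × X₁ × X₂ =>
          c₁ z.2.1 = Q.tgt z.1 ∧ c₂ z.2.2 = Q.src z.1).card := by
    rw [← ncard_supportedOn_family (fun a x y => c₁ x = Q.tgt a ∧ c₂ y = Q.src a),
      ← Set.ncard_prod, ← Set.ncard_prod]
    symm
    refine Set.ncard_congr (fun z _ a => Matrix.fromBlocks (z.1.1 a) (z.2 a) 0 (z.1.2 a)) ?_ ?_ ?_
    · rintro ⟨⟨p, r⟩, b⟩ ⟨⟨⟨h₁, h₂⟩, h₃, h₄⟩, h₅⟩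
      refine ⟨fun a => (supportedOn_fromBlocks _ _ _ _).2 ⟨h₁ a, h₅ a, SupportedOn.zero, h₃ a⟩,
        ⟨LinearMap.range (inlVec k X₁ X₂), (range_inl_mem_invLat c₁ c₂ _).2 fun a =>
          Matrix.toBlocks_fromBlocks₂₁ _ _ _ _⟩, rfl, ?_, ?_⟩
      · exact (holds_sub_iff P₁ θ c₁ c₂ p b r _ rfl).2 h₂
      · exact (holds_quotient_iff P₂ θ c₁ c₂ p b r _ rfl).2 h₄
    · rintro ⟨⟨p, r⟩, b⟩ ⟨⟨p', r'⟩, b'⟩ _ _ h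
      have h' := fun a => Matrix.fromBlocks_inj.1 (congrFun h a)
      rw [show p = p' from funext fun a => (h' a).1, show b = b' from funext fun a => (h' a).2.1,
        show r = r' from funext fun a => (h' a).2.2.2]
    · rintro m ⟨h₁, W, hW, h₂, h₃⟩
      have h₄ := (range_inl_mem_invLat c₁ c₂ m).1 (hW ▸ W.2)
      obtain ⟨p, hp⟩ : ∃ p, p = fun a => (m a).toBlocks₁₁ := ⟨_, rfl⟩
      obtain ⟨b, hb⟩ : ∃ b, b = fun a => (m a).toBlocks₁₂ := ⟨_, rfl⟩
      obtain ⟨r, hr⟩ : ∃ r, r = fun a => (m a).toBlocks₂₂ := ⟨_, rfl⟩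
      have hm : m = fun a => Matrix.fromBlocks (p a) (b a) 0 (r a) := by
        funext a
        rw [hp, hb, hr, ← h₄ a]
        exact (Matrix.fromBlocks_toBlocks _).symm
      subst hm
      have h₅ := fun a => (supportedOn_fromBlocks _ _ _ _).1 (h₁ a)
      exact ⟨((p, r), b), ⟨⟨⟨fun a => (h₅ a).1, (holds_sub_iff P₁ θ c₁ c₂ p b r W hW).1 h₂⟩,
        fun a => (h₅ a).2.2.2, (holds_quotient_iff P₂ θ c₁ c₂ p b r W hW).1 h₃⟩,
        fun a => (h₅ a).2.1⟩, rfl⟩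
  rw [← hS]
  refine slice_count (G := gradedGL k c) conjRep conjRep_one conjRep_mul _ S ?_ ?_ ?_ _ ?_
  · rintro m ⟨h₁, W, hW, h₂, h₃⟩
    exact ⟨h₁, W, by rw [hW]; exact gdim_range c₁ inlVec_injective (inlVec_colorProj c₁ c₂), h₂, h₃⟩
  · rintro g m ⟨h₁, W, hW, h₂, h₃⟩
    refine ⟨conjRep_mem g h₁, glMap g W, ?_, ?_, ?_⟩
    · rw [← hW]
      exact gdim_map (glEquiv g).injective (glEquiv_colorProj g) W.1
    · rw [← glMap_bot g]
      exact (holds_glMap θ P₁ g _ _).2 h₂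
    · rw [← glMap_top g]
      exact (holds_glMap θ P₂ g _ _).2 h₃
  · rintro m ⟨h₁, W, hW, h₂, h₃⟩
    obtain ⟨g, hg⟩ := exists_gradedGL_adapted c₁ c₂ W.2.1 hW
    refine ⟨g, conjRep_mem g h₁, glMap g W, hg, ?_, ?_⟩
    · rw [← glMap_bot g]
      exact (holds_glMap θ P₁ g _ _).2 h₂
    · rw [← glMap_top g]
      exact (holds_glMap θ P₂ g _ _).2 h₃
  · rintro m ⟨h₁, W, hW, h₂, h₃⟩
    rw [← ncard_gradedGL_parabolic c₁ c₂]
    congr 1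
    ext g
    have key : ∀ h : W.1.map (glEquiv g).toLinearMap = W.1, conjRep g m ∈ S := by
      intro h
      refine ⟨conjRep_mem g h₁, glMap g W, h.trans hW, ?_, ?_⟩
      · rw [← glMap_bot g]
        exact (holds_glMap θ P₁ g _ _).2 h₂
      · rw [← glMap_top g]
        exact (holds_glMap θ P₂ g _ _).2 h₃
    constructor
    · rintro ⟨-, W', hW', h₂', h₃'⟩
      -- After moving by `g`, both the image of the standard subspace and the standard subspace
      -- itself are distinguished.
      have h₄ : glMap g W = W' := by
        refine huniq _ _ _ ?_ ?_ h₂' h₃'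
        · rw [← glMap_bot g]
          exact (holds_glMap θ P₁ g _ _).2 h₂
        · rw [← glMap_top g]
          exact (holds_glMap θ P₂ g _ _).2 h₃
      have h₅ : W.1.map (glEquiv g).toLinearMap = W.1 := by
        rw [show W.1.map (glEquiv g).toLinearMap = (glMap g W).1 from rfl, h₄, hW', hW]
      change (g.1 : Matrix (X₁ ⊕ X₂) (X₁ ⊕ X₂) k).toBlocks₂₁ = 0
      rw [← map_inl_le_iff, ← hW]
      intro v hv
      rw [← h₅]
      exact ⟨v, hv, rfl⟩
    · intro h
      refine key (map_glEquiv_eq g ?_)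
      rw [hW]
      exact (map_inl_le_iff _).2 h

end

/-! ### Self-dual structures on coloured coordinate spaces -/

/-- A sign as an element of a field. -/
def signCast (k : Type*) [Field k] (u : ℤˣ) : k := ((u : ℤ) : k)

theorem signCast_mul {k : Type*} [Field k] (u v : ℤˣ) :
    signCast k (u * v) = signCast k u * signCast k v := by simp [signCast]

theorem signCast_mul_self {k : Type*} [Field k] (u : ℤˣ) :
    signCast k u * signCast k u = 1 := by
  rw [← signCast_mul, Int.units_mul_self]
  simp [signCast]

theorem signCast_neg {k : Type*} [Field k] (u : ℤˣ) :
    signCast k (-u) = -signCast k u := by simp [signCast]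

section

variable {I : Type*} [DecidableEq I] [Fintype I] {A : Type*} [Fintype A] {Q : FQuiver I A}
  {σ : Q.Involution} (D : DualityStructure σ) {k : Type*} [Field k] [Finite k] {X X' : Type*} [Fintype X]
  [DecidableEq X] [Fintype X'] [DecidableEq X']

/-- The diagonal matrix of the signs `s`. -/
def signMat (k : Type*) [Field k] (c : X → I) : Matrix X X k :=
  Matrix.diagonal fun x => signCast k (D.s (c x))

theorem signMat_mul_self (c : X → I) : signMat D k c * signMat D k c = 1 := by
  rw [signMat, Matrix.diagonal_mul_diagonal]
  simp only [signCast_mul_self, Matrix.diagonal_one]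

/-- Nondegenerate forms on `k^X` with the symmetry prescribed by the duality structure. -/
structure IsSDForm (c : X → I) (b : Matrix X X k) : Prop where
  supp : SupportedOn (fun x y => c x = σ.node (c y)) b
  symm : ∀ x y, b x y = signCast k (D.s (c x)) * b y x
  unit : IsUnit b

/-- The self-dual representations on `k^X`. -/
def sdMat (k : Type*) [Field k] (c : X → I) : Set ((A → Matrix X X k) × Matrix X X k) :=
  {z | z.1 ∈ repMat Q k c ∧ IsSDForm D c z.2 ∧
    ∀ a, (z.1 a).transpose * z.2 = signCast k (D.τ a) • (z.2 * z.1 (σ.arrow a))}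

/-- Isotropic subspaces. -/
def IsIsotropicSubspace (b : Matrix X X k) (W : Submodule k (X → k)) : Prop :=
  ∀ v ∈ W, ∀ w ∈ W, v ⬝ᵥ b.mulVec w = 0

/-- The orthogonal of a subspace. -/
def perpSubspace (b : Matrix X X k) (W : Submodule k (X → k)) : Submodule k (X → k) where
  carrier := {v | ∀ w ∈ W, w ⬝ᵥ b.mulVec v = 0}
  add_mem' hv hv' w hw := by rw [Matrix.mulVec_add, dotProduct_add, hv w hw, hv' w hw, add_zero]
  zero_mem' w _ := by rw [Matrix.mulVec_zero, dotProduct_zero]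
  smul_mem' r v hv w hw := by rw [Matrix.mulVec_smul, dotProduct_smul, hv w hw, smul_zero]

theorem dotProduct_colorProj (c : X → I) (i : I) (v w : X → k) :
    colorProj k c i v ⬝ᵥ w = v ⬝ᵥ colorProj k c i w := by
  simp only [dotProduct, colorProj_apply]
  refine Finset.sum_congr rfl fun x _ => ?_
  split_ifs <;> simp

/-- Invertibility of `b` identifies `W` with a space of functionals whose common kernel is the
orthogonal of `W`. -/
theorem finrank_perpSubspace {b : Matrix X X k} (hb : IsUnit b) (W : Submodule k (X → k)) :
    Module.finrank k W + Module.finrank k (perpSubspace b W) = Fintype.card X := by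
  let B : (X → k) →ₗ[k] Module.Dual k (X → k) :=
    LinearMap.mk₂ k (fun v w => v ⬝ᵥ b.mulVec w)
      (fun v v' w => by rw [add_dotProduct]) (fun r v w => by rw [smul_dotProduct])
      (fun v w w' => by rw [Matrix.mulVec_add, dotProduct_add])
      (fun r v w => by rw [Matrix.mulVec_smul, dotProduct_smul])
  have hB : Function.Injective B := by
    rw [injective_iff_map_eq_zero]
    intro v hv
    have h₁ : ∀ w, v ⬝ᵥ b.mulVec w = 0 := fun w => LinearMap.congr_fun hv w
    have h₂ : ∀ w, v ⬝ᵥ w = 0 := by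
      intro w
      have := h₁ (b⁻¹.mulVec w)
      rwa [Matrix.mulVec_mulVec, Matrix.mul_nonsing_inv _ ((Matrix.isUnit_iff_isUnit_det b).1 hb),
        Matrix.one_mulVec] at this
    exact dotProduct_eq_zero_iff.1 h₂
  have h₁ : perpSubspace b W = (W.map B).dualCoannihilator := by
    ext v
    rw [Submodule.mem_dualCoannihilator]
    constructor
    · rintro h _ ⟨w, hw, rfl⟩
      exact h w hw
    · intro h w hw
      exact h _ ⟨w, hw, rfl⟩
  have := Subspace.finrank_add_finrank_dualCoannihilator_eq (W.map B)
  rwa [← h₁, (Submodule.equivMapOfInjective B hB W).finrank_eq.symm,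
    Module.finrank_fintype_fun_eq_card] at this

variable {D}

namespace IsSDForm

variable {c : X → I} {b : Matrix X X k} (hb : IsSDForm D c b)
include hb

theorem mulVec_colorProj (i : I) (v : X → k) :
    b.mulVec (colorProj k c i v) = colorProj k c (σ.node i) (b.mulVec v) := by
  ext x
  simp only [Matrix.mulVec, dotProduct, colorProj_apply]
  by_cases hx : c x = σ.node i
  · rw [if_pos hx]
    refine Finset.sum_congr rfl fun y _ => ?_
    by_cases hy : c y = i
    · rw [if_pos hy]
    · rw [hb.supp x y fun e => hy (σ.node_involutive.injective (Eq.trans (Eq.symm e) hx)), zero_mul,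
        zero_mul]
  · rw [if_neg hx]
    refine Finset.sum_eq_zero fun y _ => ?_
    by_cases hy : c y = i
    · rw [hb.supp x y fun e => hx (Eq.trans e (congrArg σ.node hy)), zero_mul]
    · rw [if_neg hy, mul_zero]

theorem form_colorProj (i : I) (v w : X → k) :
    v ⬝ᵥ b.mulVec (colorProj k c i w) = colorProj k c (σ.node i) v ⬝ᵥ b.mulVec w := by
  rw [hb.mulVec_colorProj, dotProduct_colorProj]

/-- The sign of the symmetry depends on the node, so exchanging arguments is possible only against a
homogeneous vector. Statements about orthogonals therefore decompose a vector into homogeneous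
parts, which is where gradedness enters. -/
theorem form_symm_of_colorProj (i : I) (v w : X → k) :
    v ⬝ᵥ b.mulVec (colorProj k c i w)
      = signCast k (D.s i) * (colorProj k c i w ⬝ᵥ b.mulVec v) := by
  simp only [Matrix.mulVec, dotProduct, Finset.mul_sum, colorProj_apply]
  rw [Finset.sum_comm]
  refine Finset.sum_congr rfl fun x _ => Finset.sum_congr rfl fun y _ => ?_
  by_cases h : c x = i
  · rw [if_pos h]
    have e := hb.symm x y
    rw [h] at e
    linear_combination (-(signCast k (D.s i) * w x * v y)) * e
      - (v y * b y x * w x) * signCast_mul_self (k := k) (D.s i)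
  · rw [if_neg h]
    ring

theorem perp_graded {W : Submodule k (X → k)} (hW : IsGradedSubspace c W) :
    IsGradedSubspace c (perpSubspace b W) := by
  intro i v hv w hw
  rw [hb.form_colorProj]
  exact hv _ (hW _ w hw)

theorem le_perp_iff {W W' : Submodule k (X → k)} (hW : IsGradedSubspace c W) :
    W ≤ perpSubspace b W' ↔ W' ≤ perpSubspace b W := by
  have key : ∀ {W W' : Submodule k (X → k)}, IsGradedSubspace c W → W ≤ perpSubspace b W' →
      W' ≤ perpSubspace b W := by
    intro W W' hW h v hv w hw
    rw [← sum_colorProj c w, sum_dotProduct]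
    refine Finset.sum_eq_zero fun i _ => ?_
    have h₁ := hb.form_symm_of_colorProj i v w
    rw [h (hW i w hw) v hv] at h₁
    have h₂ := congrArg (fun x => signCast k (D.s i) * x) h₁
    simp only [mul_zero, ← mul_assoc, signCast_mul_self, one_mul] at h₂
    exact h₂.symm
  refine ⟨key hW, fun h v hv w hw => ?_⟩
  rw [← sum_colorProj c v, Matrix.mulVec_sum, dotProduct_sum]
  refine Finset.sum_eq_zero fun i _ => ?_
  rw [hb.form_symm_of_colorProj, h hw _ (hW i v hv), mul_zero]

theorem perp_perp {W : Submodule k (X → k)} (hW : IsGradedSubspace c W) :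
    perpSubspace b (perpSubspace b W) = W := by
  symm
  refine Submodule.eq_of_le_of_finrank_le ?_ ?_
  · rw [hb.le_perp_iff hW]
  · have h₁ := finrank_perpSubspace hb.unit W
    have h₂ := finrank_perpSubspace hb.unit (perpSubspace b W)
    omega

/-- The part of `W^⊥` of colour `i` sees only the part `W'` of `W` of colour `σ(i)`. The orthogonal
of `W'` contains every vector without component of colour `i`, so counting dimensions in the whole
space gives the codimension within that colour. -/
theorem gdim_perp {W : Submodule k (X → k)} (hW : IsGradedSubspace c W) (i : I) :
    gdim c (perpSubspace b W) i = colorDim c i - gdim c W (σ.node i) := by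
  obtain ⟨W', hW'⟩ : ∃ W', W' = W.map (colorProj k c (σ.node i)) := ⟨_, rfl⟩
  have h₁ : (perpSubspace b W').map (colorProj k c i) = (perpSubspace b W).map (colorProj k c i) := by
    apply le_antisymm
    · rintro _ ⟨v, hv, rfl⟩
      refine ⟨colorProj k c i v, fun w hw => ?_, colorProj_self c i v⟩
      rw [hb.form_colorProj]
      exact hv _ (hW' ▸ ⟨w, hw, rfl⟩)
    · rintro _ ⟨v, hv, rfl⟩
      refine ⟨v, ?_, rfl⟩
      rw [hW']
      rintro _ ⟨w, hw, rfl⟩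
      exact hv _ (hW _ w hw)
  have h₂ : LinearMap.ker (colorProj k c i) ≤ perpSubspace b W' := by
    rw [hW']
    rintro v hv _ ⟨w, hw, rfl⟩
    rw [← hb.form_colorProj, LinearMap.mem_ker.1 hv, Matrix.mulVec_zero, dotProduct_zero]
  have h₃ := finrank_perpSubspace hb.unit W'
  have h₄ := (colorProj k c i).finrank_range_add_finrank_ker
  have h₅ := ((colorProj k c i).domRestrict (perpSubspace b W')).finrank_range_add_finrank_ker
  rw [LinearMap.range_domRestrict, h₁, LinearMap.ker_domRestrict] at h₅
  have h₆ : Module.finrank k ((LinearMap.ker (colorProj k c i)).comap (perpSubspace b W').subtype)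
      = Module.finrank k (LinearMap.ker (colorProj k c i)) :=
    (Submodule.comapSubtypeEquivOfLe h₂).finrank_eq
  have h₇ := congrFun (gdim_top (k := k) c) i
  rw [gdim, ← LinearMap.range_eq_map] at h₇
  rw [Module.finrank_fintype_fun_eq_card] at h₄
  simp only [toLat] at h₇
  unfold gdim
  rw [← hW']
  change _ + Module.finrank k ((LinearMap.ker (colorProj k c i)).comap
    (perpSubspace b W').subtype) = _ at h₅
  omega

theorem colorDim_invariant : σ.act (colorDim c) = colorDim c := by
  funext i
  have h := hb.gdim_perp IsGradedSubspace.top i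
  have h₁ : perpSubspace b (⊤ : Submodule k (X → k)) = ⊥ := by
    have := finrank_perpSubspace hb.unit (⊤ : Submodule k (X → k))
    rw [finrank_top, Module.finrank_fintype_fun_eq_card] at this
    exact Submodule.finrank_eq_zero.1 (by omega)
  rw [h₁, gdim_bot, gdim_top] at h
  simp only [Pi.zero_apply, toLat] at h
  simp only [FQuiver.Involution.act]
  omega

end IsSDForm

variable {θ : Module.Dual ℤ (I → ℤ)}

theorem stability_invariant (hθ : σ.Compatible θ) {d : I → ℤ} (hd : σ.act d = d) : θ d = 0 := by
  have := hθ d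
  rw [hd] at this
  omega

section Perp

variable {c : X → I} {m : A → Matrix X X k} {b : Matrix X X k} (h : (m, b) ∈ sdMat D k c)
include h

theorem form_mulVec (a : A) (v w : X → k) :
    (m a).mulVec v ⬝ᵥ b.mulVec w
      = signCast k (D.τ a) * (v ⬝ᵥ b.mulVec ((m (σ.arrow a)).mulVec w)) := by
  have := congrArg (fun M => v ⬝ᵥ M.mulVec w) (h.2.2 a)
  simp only [Matrix.smul_mulVec, dotProduct_smul, smul_eq_mul, ← Matrix.mulVec_mulVec] at this
  rw [← this, Matrix.dotProduct_mulVec v, Matrix.vecMul_transpose]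

/-- The orthogonal of a subrepresentation of a self-dual representation. -/
def perpInv (W : invLat c m) : invLat c m :=
  ⟨perpSubspace b W.1, h.2.1.perp_graded W.2.1, by
    intro a v hv w hw
    have := form_mulVec h (σ.arrow a) w v
    rw [σ.arrow_involutive a, hv _ (W.2.2 _ w hw)] at this
    have h₂ := congrArg (fun x => signCast k (D.τ (σ.arrow a)) * x) this
    simp only [mul_zero, ← mul_assoc, signCast_mul_self, one_mul] at h₂
    exact h₂.symm⟩

theorem le_perpInv_iff (W W' : invLat c m) : W ≤ perpInv h W' ↔ W' ≤ perpInv h W :=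
  h.2.1.le_perp_iff W.2.1

theorem perpInv_perpInv (W : invLat c m) : perpInv h (perpInv h W) = W :=
  Subtype.ext (h.2.1.perp_perp W.2.1)

theorem isIsotropic_iff (W : invLat c m) : IsIsotropicSubspace b W.1 ↔ W ≤ perpInv h W :=
  ⟨fun h v hv w hw => h w hw v hv, fun h v hv _ hw => h hw v hv⟩

/-- The dimension vector of `W^⊥` is that of the whole space minus `σ` of that of `W`. Compatibility
makes the degree of the invariant first term zero and changes the sign of the second. -/
theorem latDeg_perpInv (hθ : σ.Compatible θ) (W : invLat c m) :
    latDeg θ (perpInv h W) = latDeg θ W := by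
  have h₁ : gdim c (perpInv h W).1 = toLat (colorDim c) - σ.act (gdim c W.1) := by
    funext i
    exact h.2.1.gdim_perp W.2.1 i
  unfold latDeg
  rw [h₁, map_sub, hθ, stability_invariant hθ (d := toLat (colorDim c)), zero_sub, neg_neg]
  funext i
  exact congrArg Nat.cast (congrFun h.2.1.colorDim_invariant i)

end Perp

/-- The reduction of a self-dual representation at the subrepresentation `u` is semistable. -/
def SDSemistableAt (θ : Module.Dual ℤ (I → ℤ)) {c : X → I} {m : A → Matrix X X k}
    (b : Matrix X X k) (u : invLat c m) : Prop :=
  ∀ W : invLat c m, IsIsotropicSubspace b W.1 → u ≤ W → latDeg θ W ≤ latDeg θ u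

theorem sdSemistableAt_iff {c : X → I} {m : A → Matrix X X k} {b : Matrix X X k}
    (h : (m, b) ∈ sdMat D k c) (u : invLat c m) :
    SDSemistableAt θ b u ↔ SemistableReduction (latDeg θ) (perpInv h) u :=
  forall_congr' fun W => by rw [isIsotropic_iff h]

theorem exists_sdSemistableAt {c : X → I} {m : A → Matrix X X k} {b : Matrix X X k}
    (h : (m, b) ∈ sdMat D k c) (θ : Module.Dual ℤ (I → ℤ)) :
    ∃ u : invLat c m, IsIsotropicSubspace b u.1 ∧ PositiveInterval (latDeg θ) ⊥ u ∧
      SDSemistableAt θ b u := by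
  obtain ⟨u, h₁, h₂, h₃⟩ := exists_positive_semistableReduction (isSlopeData (c := c) (m := m) θ)
    (perpInv h) (le_perpInv_iff h) ⊥ fun _ => bot_le
  exact ⟨u, (isIsotropic_iff h u).2 h₁, h₂, (sdSemistableAt_iff h u).2 h₃⟩

theorem sdSemistableAt_unique (hθ : σ.Compatible θ) {c : X → I} {m : A → Matrix X X k}
    {b : Matrix X X k} (h : (m, b) ∈ sdMat D k c) {u u' : invLat c m}
    (hu : IsIsotropicSubspace b u.1) (hp : PositiveInterval (latDeg θ) ⊥ u)
    (hs : SDSemistableAt θ b u)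
    (hu' : IsIsotropicSubspace b u'.1) (hp' : PositiveInterval (latDeg θ) ⊥ u')
    (hs' : SDSemistableAt θ b u') : u = u' :=
  positive_semistableReduction_unique (isSlopeData θ) (perpInv h) (le_perpInv_iff h)
    (perpInv_perpInv h) (latDeg_perpInv h hθ) (fun _ => bot_le) ((isIsotropic_iff h u).1 hu) hp
    ((sdSemistableAt_iff h u).1 hs) ((isIsotropic_iff h u').1 hu') hp'
    ((sdSemistableAt_iff h u').1 hs')

variable (D)

/-- The semistable self-dual representations on `k^X`. -/
def sdSet (θ : Module.Dual ℤ (I → ℤ)) (k : Type*) [Field k] (c : X → I) :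
    Set ((A → Matrix X X k) × Matrix X X k) :=
  {z | z ∈ sdMat D k c ∧ SDSemistableAt θ z.2 (⊥ : invLat c z.1)}

/-- The action of automorphisms on self-dual representations. -/
def conjSD {c : X → I} (g : gradedGL k c) (z : (A → Matrix X X k) × Matrix X X k) :
    (A → Matrix X X k) × Matrix X X k :=
  (conjRep g z.1, ((g.1⁻¹ : (Matrix X X k)ˣ) : Matrix X X k).transpose * z.2 *
    ((g.1⁻¹ : (Matrix X X k)ˣ) : Matrix X X k))

theorem conjSD_one {c : X → I} (z : (A → Matrix X X k) × Matrix X X k) :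
    conjSD (1 : gradedGL k c) z = z := by
  simp [conjSD, conjRep_one]

theorem conjSD_mul {c : X → I} (g h : gradedGL k c) (z : (A → Matrix X X k) × Matrix X X k) :
    conjSD (g * h) z = conjSD g (conjSD h z) := by
  simp [conjSD, conjRep_mul, mul_assoc]

variable {D}

theorem isSDForm_conj {c : X → I} {b t : Matrix X X k} (hb : IsSDForm D c b) (ht : IsGraded c t)
    (hu : IsUnit t) : IsSDForm D c (t.transpose * b * t) where
  supp := by
    refine SupportedOn.mul (P := fun x y => c x = σ.node (c y)) (P' := fun x y => c x = c y)
      (SupportedOn.mul (SupportedOn.transpose ht) hb.supp ?_) ht ?_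
    · rintro x y z h₁ h₂
      exact Eq.trans (Eq.symm h₁) h₂
    · rintro x y z h₁ h₂
      rw [h₁, h₂]
  symm x y := by
    rw [Matrix.mul_assoc]
    simp only [Matrix.mul_apply, Matrix.transpose_apply, Finset.mul_sum]
    rw [Finset.sum_comm]
    refine Finset.sum_congr rfl fun p _ => Finset.sum_congr rfl fun r _ => ?_
    rw [hb.symm r p]
    by_cases h : c r = c x
    · rw [h]; ring
    · rw [ht r x h]; ring
  unit := ((Matrix.isUnit_transpose t).2 hu |>.mul hb.unit).mul hu

theorem conjSD_mem {c : X → I} (g : gradedGL k c) {z : (A → Matrix X X k) × Matrix X X k}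
    (hz : z ∈ sdMat D k c) : conjSD g z ∈ sdMat D k c := by
  refine ⟨conjRep_mem g hz.1, isSDForm_conj hz.2.1 g.2.unit_inv (Units.isUnit _), fun a => ?_⟩
  have h₁ : (g.1 : Matrix X X k).transpose * ((g.1⁻¹ : (Matrix X X k)ˣ) : Matrix X X k).transpose
      = 1 := by
    rw [← Matrix.transpose_mul, Units.inv_mul, Matrix.transpose_one]
  simp only [conjSD, conjRep, Matrix.transpose_mul]
  calc _ = ((g.1⁻¹ : (Matrix X X k)ˣ) : Matrix X X k).transpose * (z.1 a).transpose *
        ((g.1 : Matrix X X k).transpose * ((g.1⁻¹ : (Matrix X X k)ˣ) : Matrix X X k).transpose) *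
        z.2 * ((g.1⁻¹ : (Matrix X X k)ˣ) : Matrix X X k) := by
        simp only [Matrix.mul_assoc]
    _ = ((g.1⁻¹ : (Matrix X X k)ˣ) : Matrix X X k).transpose * ((z.1 a).transpose * z.2) *
        ((g.1⁻¹ : (Matrix X X k)ˣ) : Matrix X X k) := by
        rw [h₁]; simp only [Matrix.mul_assoc, Matrix.mul_one]
    _ = _ := by
        rw [hz.2.2 a]
        simp only [Matrix.mul_smul, Matrix.smul_mul, Matrix.mul_assoc]
        congr 3
        rw [← Matrix.mul_assoc ((g.1⁻¹ : (Matrix X X k)ˣ) : Matrix X X k), Units.inv_mul,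
          Matrix.one_mul]

theorem conjSD_form {c : X → I} (g : gradedGL k c) (z : (A → Matrix X X k) × Matrix X X k)
    (v w : X → k) :
    glEquiv g v ⬝ᵥ (conjSD g z).2.mulVec (glEquiv g w) = v ⬝ᵥ z.2.mulVec w := by
  simp only [conjSD, glEquiv_apply, ← Matrix.mulVec_mulVec]
  rw [Matrix.mulVec_mulVec w, Units.inv_mul, Matrix.one_mulVec, Matrix.dotProduct_mulVec,
    Matrix.vecMul_transpose, Matrix.mulVec_mulVec, Units.inv_mul, Matrix.one_mulVec]

theorem isIsotropic_glMap {c : X → I} (g : gradedGL k c) {z : (A → Matrix X X k) × Matrix X X k}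
    (W : invLat c z.1) :
    IsIsotropicSubspace (conjSD g z).2 (glMap g W).1 ↔ IsIsotropicSubspace z.2 W.1 := by
  constructor
  · intro h v hv w hw
    rw [← conjSD_form g]
    exact h _ ⟨v, hv, rfl⟩ _ ⟨w, hw, rfl⟩
  · rintro h _ ⟨v, hv, rfl⟩ _ ⟨w, hw, rfl⟩
    exact (conjSD_form g z v w).trans (h v hv w hw)

theorem glMap_surjective {c : X → I} (g : gradedGL k c) {m : A → Matrix X X k} :
    Function.Surjective (glMap g : invLat c m → invLat c (conjRep g m)) := by
  intro W
  have := (mapInv_convex (0 : Module.Dual ℤ (I → ℤ)) (glEquiv g).injective (glEquiv_colorProj g)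
    (glEquiv_conjRep g m)).convex ⊥ ⊤ W
  refine this ?_ ?_
  · rw [mapInv_bot]; exact bot_le
  · rw [mapInv_top]; exact le_top

theorem latDeg_glMap {c : X → I} (g : gradedGL k c) {m : A → Matrix X X k} (W : invLat c m) :
    latDeg θ (glMap g W) = latDeg θ W :=
  congrArg θ (gdim_map (glEquiv g).injective (glEquiv_colorProj g) W.1)

theorem glMap_le_iff {c : X → I} (g : gradedGL k c) {m : A → Matrix X X k} (W W' : invLat c m) :
    glMap g W ≤ glMap g W' ↔ W ≤ W' :=
  Submodule.map_le_map_iff_of_injective (glEquiv g).injective W.1 W'.1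

theorem sdSemistableAt_glMap {c : X → I} (g : gradedGL k c)
    {z : (A → Matrix X X k) × Matrix X X k} (u : invLat c z.1) :
    SDSemistableAt θ (conjSD g z).2 (m := (conjSD g z).1) (glMap g u) ↔
      SDSemistableAt θ z.2 u := by
  constructor
  · intro h W hW hu
    have := h (glMap g W) ((isIsotropic_glMap g W).2 hW) ((glMap_le_iff g _ _).2 hu)
    exact (latDeg_glMap g W).ge.trans (this.trans (latDeg_glMap g u).le)
  · intro h W hW hu
    obtain ⟨W, rfl⟩ := glMap_surjective g W
    exact (latDeg_glMap g W).le.trans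
      ((h W ((isIsotropic_glMap g W).1 hW) ((glMap_le_iff g _ _).1 hu)).trans (latDeg_glMap g u).ge)

end

/-! ### Self-dual representations in hyperbolic coordinates -/

section Blocks

variable {k : Type*} [Field k] {X₁ X₂ : Type*} [Fintype X₁] [DecidableEq X₁] [Fintype X₂]
  [DecidableEq X₂]

/-- Block matrices with three rows and columns, of which the first and last have the same size. -/
def blk (a : Matrix X₁ X₁ k) (b : Matrix X₁ X₂ k) (c : Matrix X₁ X₁ k)
    (d : Matrix X₂ X₁ k) (e : Matrix X₂ X₂ k) (f : Matrix X₂ X₁ k)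
    (g : Matrix X₁ X₁ k) (h : Matrix X₁ X₂ k) (i : Matrix X₁ X₁ k) :
    Matrix ((X₁ ⊕ X₂) ⊕ X₁) ((X₁ ⊕ X₂) ⊕ X₁) k :=
  Matrix.fromBlocks (Matrix.fromBlocks a b d e) (Matrix.fromRows c f) (Matrix.fromCols g h) i

variable (a a' : Matrix X₁ X₁ k) (b b' : Matrix X₁ X₂ k) (c c' : Matrix X₁ X₁ k)
    (d d' : Matrix X₂ X₁ k) (e e' : Matrix X₂ X₂ k) (f f' : Matrix X₂ X₁ k)
    (g g' : Matrix X₁ X₁ k) (h h' : Matrix X₁ X₂ k) (i i' : Matrix X₁ X₁ k)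

theorem blk_mul : blk a b c d e f g h i * blk a' b' c' d' e' f' g' h' i'
    = blk (a * a' + b * d' + c * g') (a * b' + b * e' + c * h') (a * c' + b * f' + c * i')
      (d * a' + e * d' + f * g') (d * b' + e * e' + f * h') (d * c' + e * f' + f * i')
      (g * a' + h * d' + i * g') (g * b' + h * e' + i * h') (g * c' + h * f' + i * i') := by
  ext ((x | x) | x) ((y | y) | y) <;> simp [blk, Matrix.mul_apply, Fintype.sum_sum_type]

theorem blk_transpose : (blk a b c d e f g h i).transpose
    = blk a.transpose d.transpose g.transpose b.transpose e.transpose h.transpose c.transpose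
      f.transpose i.transpose := by
  ext ((x | x) | x) ((y | y) | y) <;> simp [blk]

theorem blk_smul (r : k) : r • blk a b c d e f g h i
    = blk (r • a) (r • b) (r • c) (r • d) (r • e) (r • f) (r • g) (r • h) (r • i) := by
  ext ((x | x) | x) ((y | y) | y) <;> simp [blk]

theorem blk_one : (1 : Matrix ((X₁ ⊕ X₂) ⊕ X₁) ((X₁ ⊕ X₂) ⊕ X₁) k) = blk 1 0 0 0 1 0 0 0 1 := by
  ext ((x | x) | x) ((y | y) | y) <;> simp [blk, Matrix.one_apply]

variable {a a' b b' c c' d d' e e' f f' g g' h h' i i'}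

theorem blk_inj : blk a b c d e f g h i = blk a' b' c' d' e' f' g' h' i' ↔
    a = a' ∧ b = b' ∧ c = c' ∧ d = d' ∧ e = e' ∧ f = f' ∧ g = g' ∧ h = h' ∧ i = i' := by
  simp only [blk, Matrix.fromBlocks_inj, Matrix.fromRows_inj.eq_iff, Matrix.fromCols_inj.eq_iff]
  tauto

theorem exists_blk (M : Matrix ((X₁ ⊕ X₂) ⊕ X₁) ((X₁ ⊕ X₂) ⊕ X₁) k) :
    ∃ a b c d e f g h i, M = blk a b c d e f g h i :=
  ⟨fun x y => M (.inl (.inl x)) (.inl (.inl y)), fun x y => M (.inl (.inl x)) (.inl (.inr y)),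
    fun x y => M (.inl (.inl x)) (.inr y), fun x y => M (.inl (.inr x)) (.inl (.inl y)),
    fun x y => M (.inl (.inr x)) (.inl (.inr y)), fun x y => M (.inl (.inr x)) (.inr y),
    fun x y => M (.inr x) (.inl (.inl y)), fun x y => M (.inr x) (.inl (.inr y)),
    fun x y => M (.inr x) (.inr y), by ext ((x | x) | x) ((y | y) | y) <;> rfl⟩

theorem supportedOn_blk {P : (X₁ ⊕ X₂) ⊕ X₁ → (X₁ ⊕ X₂) ⊕ X₁ → Prop} :
    SupportedOn P (blk a b c d e f g h i) ↔
      (SupportedOn (fun x y => P (.inl (.inl x)) (.inl (.inl y))) a ∧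
      SupportedOn (fun x y => P (.inl (.inl x)) (.inl (.inr y))) b ∧
      SupportedOn (fun x y => P (.inl (.inl x)) (.inr y)) c) ∧
      (SupportedOn (fun x y => P (.inl (.inr x)) (.inl (.inl y))) d ∧
      SupportedOn (fun x y => P (.inl (.inr x)) (.inl (.inr y))) e ∧
      SupportedOn (fun x y => P (.inl (.inr x)) (.inr y)) f) ∧
      (SupportedOn (fun x y => P (.inr x) (.inl (.inl y))) g ∧
      SupportedOn (fun x y => P (.inr x) (.inl (.inr y))) h ∧
      SupportedOn (fun x y => P (.inr x) (.inr y)) i) := by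
  constructor
  · intro H
    exact ⟨⟨fun x y => H (.inl (.inl x)) (.inl (.inl y)), fun x y => H (.inl (.inl x)) (.inl (.inr y)),
      fun x y => H (.inl (.inl x)) (.inr y)⟩, ⟨fun x y => H (.inl (.inr x)) (.inl (.inl y)),
      fun x y => H (.inl (.inr x)) (.inl (.inr y)), fun x y => H (.inl (.inr x)) (.inr y)⟩,
      fun x y => H (.inr x) (.inl (.inl y)), fun x y => H (.inr x) (.inl (.inr y)),
      fun x y => H (.inr x) (.inr y)⟩
  · rintro ⟨⟨h₁, h₂, h₃⟩, ⟨h₄, h₅, h₆⟩, h₇, h₈, h₉⟩ ((x | x) | x) ((y | y) | y)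
    exacts [h₁ x y, h₂ x y, h₃ x y, h₄ x y, h₅ x y, h₆ x y, h₇ x y, h₈ x y, h₉ x y]

theorem blk_upper : blk a b c 0 e f 0 0 i
    = Matrix.fromBlocks (Matrix.fromBlocks a b 0 e) (Matrix.fromRows c f) 0 i := by
  ext ((x | x) | x) ((y | y) | y) <;> simp [blk]

theorem isUnit_blk : IsUnit (blk a b c 0 e f 0 0 i) ↔ IsUnit a ∧ IsUnit e ∧ IsUnit i := by
  rw [blk_upper, Matrix.isUnit_fromBlocks_zero₂₁, Matrix.isUnit_fromBlocks_zero₂₁, and_assoc]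

end Blocks

section

variable {I : Type*} [DecidableEq I] [Fintype I] {A : Type*} [Fintype A] {Q : FQuiver I A}
  {σ : Q.Involution} (D : DualityStructure σ) {k : Type u₁} [Field k] [Finite k]
  {X₁ X₂ : Type u₂} [Fintype X₁]
  [DecidableEq X₁] [Fintype X₂] [DecidableEq X₂]

/-- Whenever the product of the two node signs is constant on the support of a block, the sign
matrices can be moved past it. All the sign computations with blocks below rest on this. -/
theorem signMat_sandwich (c₁ : X₁ → I) (c₂ : X₂ → I) {M : Matrix X₁ X₂ k} {u : ℤˣ}
    (hM : SupportedOn (fun x y => D.s (c₁ x) * D.s (c₂ y) = u) M) :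
    signMat D k c₁ * M * signMat D k c₂ = signCast k u • M := by
  ext x y
  rw [signMat, signMat, Matrix.mul_diagonal, Matrix.diagonal_mul, Matrix.smul_apply, smul_eq_mul]
  by_cases h : D.s (c₁ x) * D.s (c₂ y) = u
  · rw [← h, signCast_mul]; ring
  · rw [hM x y h]; ring

theorem signMat_mul_of_sandwich {c₁ : X₁ → I} {c₂ : X₂ → I} {M : Matrix X₁ X₂ k} {u : ℤˣ}
    (hM : SupportedOn (fun x y => D.s (c₁ x) * D.s (c₂ y) = u) M) :
    signMat D k c₁ * M = signCast k u • (M * signMat D k c₂) := by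
  rw [← Matrix.smul_mul, ← signMat_sandwich D c₁ c₂ hM, Matrix.mul_assoc, signMat_mul_self,
    Matrix.mul_one]

theorem IsSDForm.eq_signMat_mul {D : DualityStructure σ} {c : X₁ → I} {h : Matrix X₁ X₁ k}
    (hh : IsSDForm D c h) : signMat D k c * h.transpose = h := by
  ext x y
  rw [signMat, Matrix.diagonal_mul, Matrix.transpose_apply, ← hh.symm x y]

theorem IsSDForm.transpose_eq {D : DualityStructure σ} {c : X₁ → I} {h : Matrix X₁ X₁ k}
    (hh : IsSDForm D c h) : h.transpose = signMat D k c * h := by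
  conv_rhs => rw [← hh.eq_signMat_mul]
  rw [← Matrix.mul_assoc, signMat_mul_self, Matrix.one_mul]

/-- The colours of `U ⊕ N ⊕ U*`. -/
abbrev sdColor (σ : Q.Involution) (c₁ : X₁ → I) (c₂ : X₂ → I) : (X₁ ⊕ X₂) ⊕ X₁ → I :=
  Sum.elim (Sum.elim c₁ c₂) fun x => σ.node (c₁ x)

/-- The orthogonal sum of a form on `N` and the hyperbolic form on `U ⊕ U*`. -/
def hypForm (c₁ : X₁ → I) (h : Matrix X₂ X₂ k) : Matrix ((X₁ ⊕ X₂) ⊕ X₁) ((X₁ ⊕ X₂) ⊕ X₁) k :=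
  blk 0 0 (signMat D k c₁) 0 h 0 1 0 0

variable {D}

theorem signMat_apply_ne (c : X₁ → I) {x y : X₁} (h : x ≠ y) : signMat D k c x y = 0 :=
  Matrix.diagonal_apply_ne _ h

/-- The asymmetric choice of the signs in one corner and `1` in the opposite one is exactly what the
symmetry prescribed by `s` demands of a hyperbolic plane, since `s_{σ(i)} = s_i`. -/
theorem isSDForm_hypForm (c₁ : X₁ → I) (c₂ : X₂ → I) (h : Matrix X₂ X₂ k) :
    IsSDForm D (sdColor σ c₁ c₂) (hypForm D c₁ h) ↔ IsSDForm D c₂ h := by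
  constructor
  · intro H
    refine ⟨(supportedOn_blk.1 H.supp).2.1.2.1, fun x y => H.symm (.inl (.inr x)) (.inl (.inr y)), ?_⟩
    obtain ⟨M, hM⟩ := H.unit.exists_right_inv
    obtain ⟨a, b, c, d, e, f, g, h', i, rfl⟩ := exists_blk M
    rw [hypForm, blk_mul, blk_one, blk_inj] at hM
    refine IsUnit.of_mul_eq_one e ?_
    simpa using hM.2.2.2.2.1
  · intro H
    refine ⟨supportedOn_blk.2 ⟨⟨SupportedOn.zero, SupportedOn.zero, fun x y hxy =>
      signMat_apply_ne _ ?_⟩, ⟨SupportedOn.zero, H.supp, SupportedOn.zero⟩,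
      fun x y hxy => Matrix.one_apply_ne ?_, SupportedOn.zero, SupportedOn.zero⟩, ?_, ?_⟩
    · rintro rfl
      exact hxy (σ.node_involutive _).symm
    · rintro rfl
      exact hxy rfl
    · rintro ((x | x) | x) ((y | y) | y)
      · simp [hypForm, blk]
      · simp [hypForm, blk]
      · by_cases hxy : x = y
        · subst hxy
          simp [hypForm, blk, signMat, sdColor]
        · simp [hypForm, blk, signMat_apply_ne _ hxy, Matrix.one_apply_ne (Ne.symm hxy)]
      · simp [hypForm, blk]
      · exact H.symm x y
      · simp [hypForm, blk]
      · by_cases hxy : x = y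
        · subst hxy
          simp [hypForm, blk, signMat, sdColor, D.s_node, signCast_mul_self]
        · simp [hypForm, blk, signMat_apply_ne _ (Ne.symm hxy), Matrix.one_apply_ne hxy]
      · simp [hypForm, blk]
      · simp [hypForm, blk]
    · refine IsUnit.of_mul_eq_one (blk 0 0 1 0 h⁻¹ 0 (signMat D k c₁) 0 0) ?_
      rw [hypForm, blk_mul, blk_one, blk_inj]
      simp [signMat_mul_self, Matrix.mul_nonsing_inv _ ((Matrix.isUnit_iff_isUnit_det h).1 H.unit)]

/-- The subspace `U` of `U ⊕ N ⊕ U*`. -/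
def stdSub (k : Type*) [Field k] (X₁ X₂ : Type*) : Submodule k ((X₁ ⊕ X₂) ⊕ X₁ → k) :=
  LinearMap.range (inlVec k (X₁ ⊕ X₂) X₁ ∘ₗ inlVec k X₁ X₂)

theorem stdSub_map_le_iff {a : Matrix X₁ X₁ k} {b : Matrix X₁ X₂ k} {c : Matrix X₁ X₁ k}
    {d : Matrix X₂ X₁ k} {e : Matrix X₂ X₂ k} {f : Matrix X₂ X₁ k}
    {g : Matrix X₁ X₁ k} {h : Matrix X₁ X₂ k} {i : Matrix X₁ X₁ k} :
    (∀ v ∈ stdSub k X₁ X₂, (blk a b c d e f g h i).mulVec v ∈ stdSub k X₁ X₂) ↔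
      d = 0 ∧ g = 0 := by
  constructor
  · intro H
    have H' : ∀ y, ∃ w, inlVec k (X₁ ⊕ X₂) X₁ (inlVec k X₁ X₂ w)
        = (blk a b c d e f g h i).mulVec (Pi.single (.inl (.inl y)) 1) := by
      intro y
      have e : inlVec k (X₁ ⊕ X₂) X₁ (inlVec k X₁ X₂ (Pi.single y 1))
          = Pi.single (Sum.inl (Sum.inl y)) 1 := by
        ext ((z | z) | z) <;> simp [inlVec_apply, Pi.single_apply]
      rw [← e]
      exact H _ ⟨_, rfl⟩
    constructor
    · ext x y
      obtain ⟨w, hw⟩ := H' y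
      have := congrFun hw (.inl (.inr x))
      rw [Matrix.mulVec_single_one] at this
      exact this.symm
    · ext x y
      obtain ⟨w, hw⟩ := H' y
      have := congrFun hw (.inr x)
      rw [Matrix.mulVec_single_one] at this
      exact this.symm
  · rintro ⟨rfl, rfl⟩ _ ⟨v, rfl⟩
    refine ⟨a.mulVec v, ?_⟩
    ext ((x | x) | x) <;>
      simp [blk, inlVec_apply, Matrix.mulVec, dotProduct, Fintype.sum_sum_type]

theorem stdSub_graded (σ : Q.Involution) (c₁ : X₁ → I) (c₂ : X₂ → I) :
    IsGradedSubspace (sdColor σ c₁ c₂) (stdSub k X₁ X₂) := by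
  rintro i _ ⟨v, rfl⟩
  refine ⟨colorProj k c₁ i v, ?_⟩
  simp only [LinearMap.comp_apply]
  rw [inlVec_colorProj c₁ c₂, inlVec_colorProj (Sum.elim c₁ c₂) fun x => σ.node (c₁ x)]

theorem gdim_stdSub (σ : Q.Involution) (c₁ : X₁ → I) (c₂ : X₂ → I) :
    gdim (sdColor σ c₁ c₂) (stdSub k X₁ X₂) = toLat (colorDim c₁) := by
  refine gdim_range c₁ (inlVec_injective.comp inlVec_injective) fun i v => ?_
  simp only [LinearMap.comp_apply]
  rw [inlVec_colorProj c₁ c₂, inlVec_colorProj (Sum.elim c₁ c₂) fun x => σ.node (c₁ x)]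

theorem hypForm_inlVec (h : Matrix X₂ X₂ k) (v w : X₁ ⊕ X₂ → k) :
    inlVec k (X₁ ⊕ X₂) X₁ v ⬝ᵥ (hypForm D c₁ h).mulVec (inlVec k (X₁ ⊕ X₂) X₁ w)
      = resInr k X₁ X₂ v ⬝ᵥ h.mulVec (resInr k X₁ X₂ w) := by
  simp [hypForm, blk, inlVec_apply, resInr_apply, Matrix.mulVec, dotProduct, Fintype.sum_sum_type]

/-! #### Semistability conditions in hyperbolic coordinates -/

variable (θ : Module.Dual ℤ (I → ℤ)) (c₁ : X₁ → I) (c₂ : X₂ → I) (p : A → Matrix X₁ X₁ k)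
    (b : A → Matrix X₁ X₂ k) (r : A → Matrix X₂ X₂ k) (q : A → Matrix (X₁ ⊕ X₂) X₁ k)
    (p' : A → Matrix X₁ X₁ k)
    (U : invLat (sdColor σ c₁ c₂)
      fun a => Matrix.fromBlocks (Matrix.fromBlocks (p a) (b a) 0 (r a)) (q a) 0 (p' a))
    (hU : U.1 = stdSub k X₁ X₂)
include hU

theorem positive_stdSub_iff : PositiveInterval (latDeg θ) ⊥ U ↔
    PositiveInterval (latDeg (c := c₁) (m := p) θ) ⊥ ⊤ := by
  have h₁ := (mapInv_convex θ (c := c₁) (c' := Sum.elim c₁ c₂) (m := p)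
    (m' := fun a => Matrix.fromBlocks (p a) (b a) 0 (r a)) inlVec_injective
    (inlVec_colorProj c₁ c₂) fun a v => fromBlocks_mulVec_inl (p a) (b a) (r a) v).positive_iff ⊥ ⊤
  have h₂ := (mapInv_convex θ (c := Sum.elim c₁ c₂) (c' := sdColor σ c₁ c₂)
    (m := fun a => Matrix.fromBlocks (p a) (b a) 0 (r a))
    (m' := fun a => Matrix.fromBlocks (Matrix.fromBlocks (p a) (b a) 0 (r a)) (q a) 0 (p' a))
    inlVec_injective
    (inlVec_colorProj _ _) fun a v => fromBlocks_mulVec_inl _ (q a) (p' a) v).positive_iff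
    (mapInv _ (inlVec_colorProj c₁ c₂) (fun a v => fromBlocks_mulVec_inl (p a) (b a) (r a) v) ⊥)
    (mapInv _ (inlVec_colorProj c₁ c₂) (fun a v => fromBlocks_mulVec_inl (p a) (b a) (r a) v) ⊤)
  rw [mapInv_bot] at h₁
  rw [← h₁]
  rw [mapInv_bot, mapInv_bot] at h₂
  rw [← h₂]
  convert Iff.rfl
  refine Subtype.ext (Eq.trans ?_ hU.symm)
  change ((⊤ : Submodule k (X₁ → k)).map (inlVec k X₁ X₂)).map (inlVec k (X₁ ⊕ X₂) X₁) = _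
  rw [← Submodule.map_comp, ← LinearMap.range_eq_map]
  rfl

/-- Isotropic subrepresentations above `U` lie in `U^⊥ = U ⊕ N`. The interval from `U` to `U^⊥` is
the lattice of subrepresentations of `N`, pulled back to `U ⊕ N` and then included; isotropy is
tested in `N`, and the degree changes by a constant. -/
theorem sdSemistableAt_stdSub_iff (h : Matrix X₂ X₂ k) :
    SDSemistableAt θ (hypForm D c₁ h) U ↔
      SDSemistableAt θ h (⊥ : invLat c₂ r) := by
  have hc := comapInv_convex θ (c := Sum.elim c₁ c₂) (c' := c₂)
    (m := fun a => Matrix.fromBlocks (p a) (b a) 0 (r a)) (m' := r)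
    (resInr_colorProj c₁ c₂) (inrVec_colorProj c₁ c₂) (fun v => rfl)
    fun a v => fromBlocks_mulVec_resInr (p a) (b a) (r a) v
  have hm := mapInv_convex θ (c := Sum.elim c₁ c₂) (c' := sdColor σ c₁ c₂)
    (m := fun a => Matrix.fromBlocks (p a) (b a) 0 (r a))
    (m' := fun a => Matrix.fromBlocks (Matrix.fromBlocks (p a) (b a) 0 (r a)) (q a) 0 (p' a))
    inlVec_injective
    (inlVec_colorProj _ _) fun a v => fromBlocks_mulVec_inl _ (q a) (p' a) v
  let F₁ : invLat c₂ r → invLat (Sum.elim c₁ c₂) fun a => Matrix.fromBlocks (p a) (b a) 0 (r a) :=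
    comapInv (resInr k X₁ X₂) (resInr_colorProj c₁ c₂)
      fun a v => fromBlocks_mulVec_resInr (p a) (b a) (r a) v
  let F₂ : (invLat (Sum.elim c₁ c₂) fun a => Matrix.fromBlocks (p a) (b a) 0 (r a)) →
      invLat (sdColor σ c₁ c₂)
        fun a => Matrix.fromBlocks (Matrix.fromBlocks (p a) (b a) 0 (r a)) (q a) 0 (p' a) :=
    mapInv (inlVec k (X₁ ⊕ X₂) X₁) (inlVec_colorProj _ _)
      fun a v => fromBlocks_mulVec_inl _ (q a) (p' a) v
  have hbot : F₂ (F₁ ⊥) = U := by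
    refine Subtype.ext (Eq.trans ?_ hU.symm)
    change ((⊥ : Submodule k (X₂ → k)).comap (resInr k X₁ X₂)).map (inlVec k (X₁ ⊕ X₂) X₁) = _
    rw [Submodule.comap_bot, ker_resInr, ← LinearMap.range_comp]
    rfl
  have hiso : ∀ W, IsIsotropicSubspace (hypForm D c₁ h) (F₂ (F₁ W)).1 ↔
      IsIsotropicSubspace h W.1 := by
    intro W
    constructor
    · intro H v hv w hw
      have := H (inlVec k (X₁ ⊕ X₂) X₁ (inrVec k X₁ X₂ v)) ⟨_, hv, rfl⟩
        (inlVec k (X₁ ⊕ X₂) X₁ (inrVec k X₁ X₂ w)) ⟨_, hw, rfl⟩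
      rwa [hypForm_inlVec] at this
    · rintro H _ ⟨v, hv, rfl⟩ _ ⟨w, hw, rfl⟩
      rw [hypForm_inlVec]
      exact H _ hv _ hw
  have hdeg : ∀ W, latDeg θ (F₂ (F₁ W)) ≤ latDeg θ U ↔ latDeg θ W ≤ latDeg θ (⊥ : invLat c₂ r) := by
    intro W
    obtain ⟨C, hC⟩ := hc.deg_eq
    obtain ⟨C', hC'⟩ := hm.deg_eq
    rw [← hbot, hC', hC', hC, hC]
    constructor <;> intro H <;> linarith
  constructor
  · intro H W hW _
    refine (hdeg W).1 (H _ ((hiso W).2 hW) ?_)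
    rw [← hbot]
    exact (hm.le_iff _ _).2 ((hc.le_iff _ _).2 bot_le)
  · intro H W hW hUW
    -- Pairing with the basis vectors of `U` reads off, up to sign, the coordinates in `U*`; these
    -- vanish on the isotropic `W`, which contains `U`.
    have hW' : W ≤ F₂ (F₁ ⊤) := by
      intro v hv
      refine ⟨resInl k _ _ v, trivial, ?_⟩
      have hv' : resInr k (X₁ ⊕ X₂) X₁ v = 0 := by
        ext x
        have h₁ : inlVec k (X₁ ⊕ X₂) X₁ (inlVec k X₁ X₂ (Pi.single x 1)) ∈ W.1 :=
          hUW (by rw [hU]; exact ⟨_, rfl⟩)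
        have h₂ := hW _ h₁ _ hv
        have e : inlVec k (X₁ ⊕ X₂) X₁ (inlVec k X₁ X₂ (Pi.single x 1))
            = Pi.single (Sum.inl (Sum.inl x)) 1 := by
          ext ((z | z) | z) <;> simp [inlVec_apply, Pi.single_apply]
        rw [e, single_one_dotProduct] at h₂
        have h₃ : signCast k (D.s (c₁ x)) * v (.inr x) = 0 := by
          rw [← h₂]
          simp [hypForm, blk, Matrix.mulVec, dotProduct, Fintype.sum_sum_type, signMat,
            Matrix.diagonal_apply]
        have h₄ := congrArg (fun z => signCast k (D.s (c₁ x)) * z) h₃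
        simp only [mul_zero, ← mul_assoc, signCast_mul_self, one_mul] at h₄
        exact h₄
      conv_rhs => rw [← inlVec_add_inrVec v, hv', map_zero, add_zero]
    have hbot' : F₂ (F₁ ⊥) ≤ W := by rw [hbot]; exact hUW
    obtain ⟨W₁, rfl⟩ := hm.convex _ _ W hbot' hW'
    obtain ⟨W₂, rfl⟩ := hc.convex _ _ W₁ ((hm.le_iff _ _).1 hbot') ((hm.le_iff _ _).1 hW')
    exact (hdeg W₂).2 (H W₂ ((hiso W₂).1 hW) bot_le)

end

/-! ### Counting self-dual representations with an isotropic subrepresentation -/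

section

variable {I : Type*} [DecidableEq I] [Fintype I] {A : Type*} [Fintype A] {Q : FQuiver I A}
  {σ : Q.Involution} (D : DualityStructure σ) {k : Type u₁} [Field k] [Finite k]
  {X₁ X₂ : Type u₂} [Fintype X₁]
  [DecidableEq X₁] [Fintype X₂] [DecidableEq X₂]

/-- The possible components `U* → U` of a self-dual representation on `U ⊕ N ⊕ U*`. -/
def cornerRep (k : Type*) [Field k] (c₁ : X₁ → I) : Set (A → Matrix X₁ X₁ k) :=
  {f | ∀ a, SupportedOn (fun x y => c₁ x = Q.tgt a ∧ σ.node (c₁ y) = Q.src a) (f a) ∧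
    (f a).transpose * signMat D k c₁ = signCast k (D.τ a) • f (σ.arrow a)}

/-- The matrix entries are functions on triples of an arrow, a row and a column. Duality exchanges
`(a, x, y)` and `(σ(a), y, x)` with sign `τ_a s_{c(x)}`, so the fixed arrows contribute their
symmetric or antisymmetric matrices. -/
theorem ncard_cornerRep [DecidableEq A] (h2 : (2 : k) ≠ 0) (c₁ : X₁ → I) : ∃ n : ℕ,
    (2 * n : ℤ) = ((Finset.univ.filter fun z : A × X₁ × X₁ => c₁ z.2.1 = Q.tgt z.1 ∧
        σ.node (c₁ z.2.2) = Q.src z.1).card : ℤ)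
      + ∑ z : A × X₁ × X₁ with (c₁ z.2.1 = Q.tgt z.1 ∧ σ.node (c₁ z.2.2) = Q.src z.1) ∧
        (σ.arrow z.1, z.2.2, z.2.1) = z, ((D.τ z.1 * D.s (c₁ z.2.1) : ℤˣ) : ℤ) ∧
    (cornerRep D k c₁).ncard = Nat.card k ^ n := by
  have hT : ∀ z : A × X₁ × X₁, c₁ z.2.1 = Q.tgt z.1 ∧ σ.node (c₁ z.2.2) = Q.src z.1 →
      c₁ z.2.2 = Q.tgt (σ.arrow z.1) ∧ σ.node (c₁ z.2.1) = Q.src (σ.arrow z.1) := by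
    rintro ⟨a, x, y⟩ ⟨h₁, h₂⟩
    rw [σ.tgt_arrow, σ.src_arrow]
    exact ⟨by rw [← h₂, σ.node_involutive], by rw [h₁]⟩
  obtain ⟨n, hn, hn'⟩ := ncard_sign_symmetric h2
    (fun z : A × X₁ × X₁ => c₁ z.2.1 = Q.tgt z.1 ∧ σ.node (c₁ z.2.2) = Q.src z.1)
    (fun z => (σ.arrow z.1, z.2.2, z.2.1)) (fun z => by simp [σ.arrow_involutive z.1])
    hT (fun z => D.τ z.1 * D.s (c₁ z.2.1)) (by
      -- The sign is constant on orbits because `τ_a τ_{σ(a)}` is the product of the signs at the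
      -- two ends of `a`.
      rintro ⟨a, x, y⟩ ⟨h₁, h₂⟩
      dsimp only at h₁ h₂ ⊢
      have h₃ := D.τ_mul a
      have h₄ : D.s (c₁ y) = D.s (Q.src a) := by rw [← h₂, D.s_node]
      rw [h₄, h₁, show D.τ (σ.arrow a) = D.τ a * (D.s (Q.src a) * D.s (Q.tgt a)) by
        rw [← h₃, ← mul_assoc, Int.units_mul_self, one_mul], mul_comm (D.s (Q.src a)),
        mul_assoc, mul_assoc, Int.units_mul_self, mul_one])
  refine ⟨n, hn, hn' ▸ ?_⟩
  refine Set.ncard_congr (fun f _ z => f z.1 z.2.1 z.2.2) ?_ ?_ ?_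
  · intro f hf
    refine ⟨fun z hz => (hf z.1).1 _ _ hz, fun z _ => ?_⟩
    have := congrFun (congrFun (hf z.1).2 z.2.2) z.2.1
    rw [signMat, Matrix.mul_diagonal, Matrix.transpose_apply, Matrix.smul_apply, smul_eq_mul] at this
    change f (σ.arrow z.1) z.2.2 z.2.1 = signCast k (D.τ z.1 * D.s (c₁ z.2.1)) * _
    rw [signCast_mul, mul_assoc, mul_comm (signCast k (D.s _)), this, ← mul_assoc,
      signCast_mul_self, one_mul]
  · intro f g _ _ h
    ext a x y
    exact congrFun h (a, x, y)
  · rintro f ⟨h₁, h₂⟩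
    refine ⟨fun a => Matrix.of fun x y => f (a, x, y),
      fun a => ⟨fun x y hxy => h₁ (a, x, y) hxy, ?_⟩, rfl⟩
    ext y x
    rw [signMat, Matrix.mul_diagonal, Matrix.transpose_apply, Matrix.smul_apply, smul_eq_mul]
    change f (a, x, y) * _ = _ * f (σ.arrow a, y, x)
    by_cases hz : c₁ x = Q.tgt a ∧ σ.node (c₁ y) = Q.src a
    · rw [show f (σ.arrow a, y, x) = signCast k (D.τ a * D.s (c₁ x)) * f (a, x, y) from
        h₂ (a, x, y) hz, signCast_mul, ← mul_assoc, ← mul_assoc, signCast_mul_self, one_mul, mul_comm]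
    · rw [h₁ (a, x, y) hz, h₁ (σ.arrow a, y, x), zero_mul, mul_zero]
      intro h
      have := hT _ h
      simp only [σ.arrow_involutive a] at this
      exact hz this

/-- The symmetry condition on the components `U* → U` of isometries. -/
def cornerGL (k : Type*) [Field k] (c₁ : X₁ → I) : Set (Matrix X₁ X₁ k) :=
  {w | SupportedOn (fun x y => c₁ x = σ.node (c₁ y)) w ∧ w + w.transpose * signMat D k c₁ = 0}

/-- Here the involution transposes a matrix with sign `-s`, because these corners preserve the
hyperbolic form infinitesimally. The exponent minus the one in `ncard_cornerRep` is `𝓔(d)`. -/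
theorem ncard_cornerGL (h2 : (2 : k) ≠ 0) (c₁ : X₁ → I) : ∃ n : ℕ,
    (2 * n : ℤ) = ((Finset.univ.filter fun z : X₁ × X₁ => c₁ z.1 = σ.node (c₁ z.2)).card : ℤ)
      + ∑ z : X₁ × X₁ with c₁ z.1 = σ.node (c₁ z.2) ∧ z.swap = z, ((-D.s (c₁ z.1) : ℤˣ) : ℤ) ∧
    (cornerGL D k c₁).ncard = Nat.card k ^ n := by
  have hT : ∀ z : X₁ × X₁, c₁ z.1 = σ.node (c₁ z.2) → c₁ z.2 = σ.node (c₁ z.1) := by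
    intro z h
    rw [h, σ.node_involutive]
  obtain ⟨n, hn, hn'⟩ := ncard_sign_symmetric h2 (fun z : X₁ × X₁ => c₁ z.1 = σ.node (c₁ z.2))
    Prod.swap Prod.swap_swap hT (fun z => -D.s (c₁ z.1)) (by
      intro z h
      rw [Prod.fst_swap, h, D.s_node])
  refine ⟨n, hn, hn' ▸ ?_⟩
  refine Set.ncard_congr (fun f _ z => f z.1 z.2) ?_ ?_ ?_
  · rintro f ⟨h₁, h₂⟩
    refine ⟨fun z hz => h₁ _ _ hz, fun z _ => ?_⟩
    have := congrFun (congrFun h₂ z.2) z.1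
    rw [signMat, Matrix.add_apply, Matrix.mul_diagonal, Matrix.transpose_apply,
      Matrix.zero_apply] at this
    change f z.2 z.1 = signCast k (-D.s (c₁ z.1)) * _
    rw [signCast_neg]
    linear_combination this
  · intro f g _ _ h
    ext x y
    exact congrFun h (x, y)
  · rintro f ⟨h₁, h₂⟩
    refine ⟨Matrix.of fun x y => f (x, y), ⟨fun x y hxy => h₁ (x, y) hxy, ?_⟩, rfl⟩
    ext y x
    rw [signMat, Matrix.add_apply, Matrix.mul_diagonal, Matrix.transpose_apply, Matrix.of_apply,
      Matrix.of_apply]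
    by_cases hz : c₁ x = σ.node (c₁ y)
    · rw [show f (y, x) = signCast k (-D.s (c₁ x)) * f (x, y) from h₂ (x, y) hz, signCast_neg,
        Matrix.zero_apply]
      ring
    · rw [h₁ (x, y) hz, h₁ (y, x), zero_mul, add_zero, Matrix.zero_apply]
      exact fun h => hz (hT (y, x) h)

variable {D}

/-- Self-dual representations on `U ⊕ N ⊕ U*` with isotropic subrepresentation `U`. -/
def sdBlocks (D : DualityStructure σ) (p : A → Matrix X₁ X₁ k) (r : A → Matrix X₂ X₂ k)
    (h : Matrix X₂ X₂ k) (f : A → Matrix X₂ X₁ k) (q : A → Matrix X₁ X₁ k) (a : A) :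
    Matrix ((X₁ ⊕ X₂) ⊕ X₁) ((X₁ ⊕ X₂) ⊕ X₁) k :=
  Matrix.fromBlocks (Matrix.fromBlocks (p a)
    (signCast k (D.τ (σ.arrow a)) • ((f (σ.arrow a)).transpose * h)) 0 (r a))
    (Matrix.fromRows (q a) (f a)) 0 (signCast k (D.τ a) • (p (σ.arrow a)).transpose)

theorem sdBlocks_eq (p : A → Matrix X₁ X₁ k) (r : A → Matrix X₂ X₂ k)
    (h : Matrix X₂ X₂ k) (f : A → Matrix X₂ X₁ k) (q : A → Matrix X₁ X₁ k) (a : A) :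
    sdBlocks D p r h f q a = blk (p a)
      (signCast k (D.τ (σ.arrow a)) • ((f (σ.arrow a)).transpose * h)) (q a) 0 (r a) (f a) 0 0
      (signCast k (D.τ a) • (p (σ.arrow a)).transpose) := blk_upper.symm

theorem blk_transpose_mul_hypForm {c₁ : X₁ → I} {p c p' : Matrix X₁ X₁ k} {b : Matrix X₁ X₂ k}
    {r : Matrix X₂ X₂ k} {f : Matrix X₂ X₁ k} (h : Matrix X₂ X₂ k) :
    (blk p b c 0 r f 0 0 p').transpose * hypForm D c₁ h = blk 0 0 (p.transpose * signMat D k c₁)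
      0 (r.transpose * h) (b.transpose * signMat D k c₁) p'.transpose (f.transpose * h)
      (c.transpose * signMat D k c₁) := by
  rw [hypForm, blk_transpose, blk_mul]
  simp

theorem hypForm_mul_blk {c₁ : X₁ → I} {p c p' : Matrix X₁ X₁ k} {b : Matrix X₁ X₂ k}
    {r : Matrix X₂ X₂ k} {f : Matrix X₂ X₁ k} (h : Matrix X₂ X₂ k) :
    hypForm D c₁ h * (blk p b c 0 r f 0 0 p') = blk 0 0 (signMat D k c₁ * p')
      0 (h * r) (h * f) p b c := by
  rw [hypForm, blk_mul]
  simp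

theorem signCast_τ_mul (a : A) : signCast k (D.τ a) * signCast k (D.τ (σ.arrow a))
    = signCast k (D.s (Q.src a) * D.s (Q.tgt a)) := by
  rw [← signCast_mul, D.τ_mul]

/-- The component on `U*` is dual to the one on `U` up to the sign `τ`. The signs fit together by
`τ_a τ_{σ(a)} = s_i s_j`. -/
theorem transpose_mul_signMat {c₁ : X₁ → I} {a : A} {p : Matrix X₁ X₁ k}
    (hp : SupportedOn (fun x y => c₁ x = Q.tgt a ∧ c₁ y = Q.src a) p) :
    p.transpose * signMat D k c₁ = signCast k (D.τ a) • (signMat D k c₁ *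
      (signCast k (D.τ (σ.arrow a)) • p.transpose)) := by
  have h₁ : SupportedOn (fun x y => D.s (c₁ x) * D.s (c₁ y) = D.s (Q.src a) * D.s (Q.tgt a))
      p.transpose := hp.transpose.mono fun x y h => by rw [h.1, h.2]
  rw [Matrix.mul_smul, smul_smul, signCast_τ_mul, signMat_mul_of_sandwich D h₁, smul_smul,
    signCast_mul_self, one_smul]

theorem offdiag_compatible {c₁ : X₁ → I} {c₂ : X₂ → I} {h : Matrix X₂ X₂ k} (hh : IsSDForm D c₂ h)
    {a : A} {f : Matrix X₂ X₁ k} (hf : SupportedOn (fun x y => c₂ x = Q.tgt (σ.arrow a) ∧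
      σ.node (c₁ y) = Q.src (σ.arrow a)) f) :
    (signCast k (D.τ (σ.arrow a)) • (f.transpose * h)).transpose * signMat D k c₁
      = signCast k (D.τ a) • (h * f) := by
  have h₁ : SupportedOn (fun x y => D.s (c₂ x) * D.s (c₁ y) = D.s (Q.src a) * D.s (Q.tgt a))
      (h * f) := by
    refine SupportedOn.mul hh.supp hf ?_
    rintro x y z e ⟨e₁, e₂⟩
    have e₃ : c₁ z = Q.tgt a := σ.node_involutive.injective (e₂.trans (σ.src_arrow a))
    rw [e, e₁, e₃, σ.tgt_arrow, D.s_node, D.s_node]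
  rw [Matrix.transpose_smul, Matrix.transpose_mul, Matrix.transpose_transpose, hh.transpose_eq,
    Matrix.smul_mul, Matrix.mul_assoc (signMat D k c₂) h f, signMat_sandwich D c₂ c₁ h₁, smul_smul,
    ← signCast_τ_mul a, mul_left_comm, signCast_mul_self, mul_one]

theorem sdBlocks_mem (c₁ : X₁ → I) (c₂ : X₂ → I) {p : A → Matrix X₁ X₁ k} {r : A → Matrix X₂ X₂ k}
    {h : Matrix X₂ X₂ k} {f : A → Matrix X₂ X₁ k} {q : A → Matrix X₁ X₁ k}
    (hp : p ∈ repMat Q k c₁) (hr : (r, h) ∈ sdMat D k c₂)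
    (hf : ∀ a, SupportedOn (fun x y => c₂ x = Q.tgt a ∧ σ.node (c₁ y) = Q.src a) (f a))
    (hq : q ∈ cornerRep D k c₁) :
    (sdBlocks D p r h f q, hypForm D c₁ h) ∈ sdMat D k (sdColor σ c₁ c₂) := by
  refine ⟨fun a => ?_, (isSDForm_hypForm c₁ c₂ h).2 hr.2.1, fun a => ?_⟩
  · dsimp only
    rw [sdBlocks_eq]
    refine supportedOn_blk.2 ⟨⟨hp a, SupportedOn.smul (SupportedOn.mul (hf _).transpose hr.2.1.supp ?_) _,
      (hq a).1⟩, ⟨SupportedOn.zero, hr.1 a, hf a⟩, SupportedOn.zero, SupportedOn.zero,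
      SupportedOn.smul ((hp _).transpose.mono ?_) _⟩
    · rintro x y z ⟨h₁, h₂⟩ h₃
      rw [σ.src_arrow] at h₂
      rw [σ.tgt_arrow, h₃] at h₁
      exact ⟨σ.node_involutive.injective h₂, σ.node_involutive.injective h₁⟩
    · rintro x y ⟨h₁, h₂⟩
      change σ.node _ = _ ∧ σ.node _ = _
      rw [h₁, h₂, σ.tgt_arrow, σ.src_arrow, σ.node_involutive, σ.node_involutive]
      exact ⟨rfl, rfl⟩
  · dsimp only
    rw [sdBlocks_eq, sdBlocks_eq, blk_transpose_mul_hypForm, hypForm_mul_blk, blk_smul, blk_inj]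
    refine ⟨(smul_zero _).symm, (smul_zero _).symm, ?_, (smul_zero _).symm, hr.2.2 a, ?_, ?_, ?_,
      (hq a).2⟩
    · rw [σ.arrow_involutive a]
      exact transpose_mul_signMat (hp a)
    · exact offdiag_compatible hr.2.1 (hf _)
    · rw [Matrix.transpose_smul, Matrix.transpose_transpose]
    · rw [σ.arrow_involutive a, smul_smul, signCast_mul_self, one_smul]

/-- Comparing the blocks of the compatibility equation shows that the component on `U*` is dual to
that on `U`, the component `N → U` is dual to that from `U*` to `N`, and the component `U* → U` is
symmetric up to sign. Nothing else is constrained. -/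
theorem exists_sdBlocks (c₁ : X₁ → I) (c₂ : X₂ → I)
    {m : A → Matrix ((X₁ ⊕ X₂) ⊕ X₁) ((X₁ ⊕ X₂) ⊕ X₁) k}
    {h : Matrix X₂ X₂ k} (hm : (m, hypForm D c₁ h) ∈ sdMat D k (sdColor σ c₁ c₂))
    (hU : stdSub k X₁ X₂ ∈ invLat (sdColor σ c₁ c₂) m) :
    ∃ p r f q, p ∈ repMat Q k c₁ ∧ (r, h) ∈ sdMat D k c₂ ∧
      (∀ a, SupportedOn (fun x y => c₂ x = Q.tgt a ∧ σ.node (c₁ y) = Q.src a) (f a)) ∧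
      q ∈ cornerRep D k c₁ ∧ m = sdBlocks D p r h f q := by
  have H := fun a => exists_blk (m a)
  choose p b q d r f g g' p' H using H
  have hd : ∀ a, d a = 0 ∧ g a = 0 := fun a => stdSub_map_le_iff.1 (H a ▸ hU.2 a)
  have h₀ := fun a => supportedOn_blk.1 (H a ▸ (show SupportedOn _ (m a) from hm.1 a))
  have hc := hm.2.2
  dsimp only at hc
  have key : ∀ a, g' a = 0 ∧ p' a = signCast k (D.τ a) • (p (σ.arrow a)).transpose ∧
      (r a).transpose * h = signCast k (D.τ a) • (h * r (σ.arrow a)) ∧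
      b a = signCast k (D.τ (σ.arrow a)) • ((f (σ.arrow a)).transpose * h) ∧
      (q a).transpose * signMat D k c₁ = signCast k (D.τ a) • q (σ.arrow a) := by
    -- The vanishing of `g'`, the component from `N` to `U*`, expresses that `U^⊥` is invariant
    -- along with `U`.
    have h₁ : ∀ a, (p' a).transpose = signCast k (D.τ a) • p (σ.arrow a) ∧
      (g' a).transpose = 0 ∧
      (r a).transpose * h = signCast k (D.τ a) • (h * r (σ.arrow a)) ∧
      (f a).transpose * h = signCast k (D.τ a) • b (σ.arrow a) ∧
      (q a).transpose * signMat D k c₁ = signCast k (D.τ a) • q (σ.arrow a) := by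
      intro a
      have h₂ := hc a
      rw [H a, H (σ.arrow a), (hd a).1, (hd a).2, (hd _).1, (hd _).2, hypForm, blk_transpose,
        blk_mul, blk_mul, blk_smul, blk_inj] at h₂
      simp only [Matrix.transpose_zero, mul_zero, Matrix.mul_zero, Matrix.zero_mul, add_zero,
        zero_add, Matrix.mul_one, Matrix.one_mul, smul_zero] at h₂
      exact ⟨h₂.2.2.2.2.2.2.1, h₂.2.2.2.1, h₂.2.2.2.2.1, h₂.2.2.2.2.2.2.2.1, h₂.2.2.2.2.2.2.2.2⟩
    intro a
    obtain ⟨h₂, h₃, h₄, -, h₆⟩ := h₁ a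
    have h₅ := (h₁ (σ.arrow a)).2.2.2.1
    refine ⟨?_, ?_, h₄, ?_, h₆⟩
    · rw [← Matrix.transpose_transpose (g' a), h₃, Matrix.transpose_zero]
    · rw [← Matrix.transpose_transpose (p' a), h₂, Matrix.transpose_smul]
    · rw [h₅, smul_smul, signCast_mul_self, one_smul, σ.arrow_involutive a]
  refine ⟨p, r, f, q, fun a => (h₀ a).1.1, ⟨fun a => (h₀ a).2.1.2.1,
    (isSDForm_hypForm c₁ c₂ h).1 hm.2.1, fun a => (key a).2.2.1⟩, fun a => (h₀ a).2.1.2.2,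
    fun a => ⟨(h₀ a).1.2.2, (key a).2.2.2.2⟩, ?_⟩
  funext a
  rw [sdBlocks_eq, H a, (hd a).1, (hd a).2, (key a).1, ← (key a).2.1, ← (key a).2.2.2.1]

variable (D)

/-- The self-dual representations on `U ⊕ N ⊕ U*` in normal form. -/
def sdSlice (θ : Module.Dual ℤ (I → ℤ)) (k : Type*) [Field k] (c₁ : X₁ → I) (c₂ : X₂ → I) :
    Set ((A → Matrix ((X₁ ⊕ X₂) ⊕ X₁) ((X₁ ⊕ X₂) ⊕ X₁) k) ×
      Matrix ((X₁ ⊕ X₂) ⊕ X₁) ((X₁ ⊕ X₂) ⊕ X₁) k) :=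
  {z | z ∈ sdMat D k (sdColor σ c₁ c₂) ∧ (∃ h, z.2 = hypForm D c₁ h) ∧
    ∃ U : invLat (sdColor σ c₁ c₂) z.1, U.1 = stdSub k X₁ X₂ ∧
      PositiveInterval (latDeg θ) ⊥ U ∧ SDSemistableAt θ z.2 U}

theorem hypForm_inj {c₁ : X₁ → I} {h h' : Matrix X₂ X₂ k} (e : hypForm D c₁ h = hypForm D c₁ h') :
    h = h' := (blk_inj.1 e).2.2.2.2.1

/-- The factors count, in this order, the representation on `U`, the self-dual representation on `N`
together with its form, the components `U* → N`, and the components `U* → U`. -/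
theorem ncard_sdSlice (θ : Module.Dual ℤ (I → ℤ)) (c₁ : X₁ → I) (c₂ : X₂ → I) :
    (sdSlice D θ k c₁ c₂).ncard = (repSet Q IntervalPredicate.positive θ k c₁).ncard *
      (sdSet D θ k c₂).ncard * Nat.card k ^ (Finset.univ.filter fun z : A × X₂ × X₁ =>
          c₂ z.2.1 = Q.tgt z.1 ∧ σ.node (c₁ z.2.2) = Q.src z.1).card *
      (cornerRep D k c₁).ncard := by
  rw [← ncard_supportedOn_family (fun a x y => c₂ x = Q.tgt a ∧ σ.node (c₁ y) = Q.src a),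
    ← Set.ncard_prod, ← Set.ncard_prod, ← Set.ncard_prod]
  symm
  refine Set.ncard_congr (fun z _ => (sdBlocks D z.1.1.1 z.1.1.2.1 z.1.1.2.2 z.1.2 z.2,
    hypForm D c₁ z.1.1.2.2)) ?_ ?_ ?_
  · rintro ⟨⟨⟨p, r, h⟩, f⟩, q⟩ ⟨⟨⟨⟨h₁, h₂⟩, h₃, h₄⟩, h₅⟩, h₆⟩
    refine ⟨sdBlocks_mem c₁ c₂ h₁ h₃ h₅ h₆, ⟨h, rfl⟩, ⟨stdSub k X₁ X₂, stdSub_graded σ c₁ c₂,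
      fun a => ?_⟩, rfl, ?_, ?_⟩
    · dsimp only
      rw [sdBlocks_eq]
      exact stdSub_map_le_iff.2 ⟨rfl, rfl⟩
    · exact (positive_stdSub_iff θ c₁ c₂ p _ r _ _ _ rfl).2 h₂
    · exact (sdSemistableAt_stdSub_iff θ c₁ c₂ p _ r _ _ _ rfl h).2 h₄
  · rintro ⟨⟨⟨p, r, h⟩, f⟩, q⟩ ⟨⟨⟨p', r', h'⟩, f'⟩, q'⟩ _ _ e
    obtain ⟨e₁, e₂⟩ := Prod.mk.inj e
    have e₃ := fun a => congrFun e₁ a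
    simp only [sdBlocks_eq, blk_inj] at e₃
    obtain rfl := hypForm_inj D e₂
    obtain rfl : p = p' := funext fun a => (e₃ a).1
    obtain rfl : q = q' := funext fun a => (e₃ a).2.2.1
    obtain rfl : r = r' := funext fun a => (e₃ a).2.2.2.2.1
    obtain rfl : f = f' := funext fun a => (e₃ a).2.2.2.2.2.1
    rfl
  · rintro ⟨m, b⟩ ⟨h₁, ⟨h, rfl⟩, U, hU, h₂, h₃⟩
    obtain ⟨p, r, f, q, hp, hr, hf, hq, rfl⟩ := exists_sdBlocks c₁ c₂ h₁ (hU ▸ U.2)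
    exact ⟨(((p, r, h), f), q), ⟨⟨⟨⟨hp, (positive_stdSub_iff θ c₁ c₂ p _ r _ _ U hU).1 h₂⟩,
      hr, (sdSemistableAt_stdSub_iff θ c₁ c₂ p _ r _ _ U hU h).1 h₃⟩, hf⟩, hq⟩, rfl⟩

end

/-! ### Stabilisers and existence of normal forms -/

section

variable {I : Type*} [DecidableEq I] [Fintype I] {A : Type*} [Fintype A] {Q : FQuiver I A}
  {σ : Q.Involution} {D : DualityStructure σ} {k : Type u₁} [Field k] [Finite k]
  {X₁ X₂ : Type u₂} [Fintype X₁]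
  [DecidableEq X₁] [Fintype X₂] [DecidableEq X₂]

theorem hypForm_conj {c₁ : X₁ → I} (a y e : Matrix X₁ X₁ k) (x : Matrix X₁ X₂ k)
    (c : Matrix X₂ X₂ k) (z : Matrix X₂ X₁ k) (h : Matrix X₂ X₂ k) :
    (blk a x y 0 c z 0 0 e).transpose * hypForm D c₁ h * blk a x y 0 c z 0 0 e
      = blk 0 0 (a.transpose * signMat D k c₁ * e) 0 (c.transpose * h * c)
        (c.transpose * h * z + x.transpose * signMat D k c₁ * e) (e.transpose * a)
        (e.transpose * x + z.transpose * h * c)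
        (e.transpose * y + z.transpose * h * z + y.transpose * signMat D k c₁ * e) := by
  rw [blk_transpose_mul_hypForm, blk_mul]
  simp

theorem signMat_mul_of_graded {c₁ : X₁ → I} {a : Matrix X₁ X₁ k} (ha : IsGraded c₁ a) :
    signMat D k c₁ * a = a * signMat D k c₁ := by
  have h : SupportedOn (fun x y => D.s (c₁ x) * D.s (c₁ y) = 1) a :=
    ha.mono fun x y h => by rw [h, Int.units_mul_self]
  rw [signMat_mul_of_sandwich D h]
  simp [signCast]

theorem transpose_mul_signMat_of_supp {c₁ : X₁ → I} {c₂ : X₂ → I} {h : Matrix X₂ X₂ k}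
    (hh : IsSDForm D c₂ h) {z : Matrix X₂ X₁ k}
    (hz : SupportedOn (fun x y => c₂ x = σ.node (c₁ y)) z) :
    h.transpose * z * signMat D k c₁ = h * z := by
  have h₁ : SupportedOn (fun x y => D.s (c₂ x) * D.s (c₁ y) = 1) (h * z) := by
    refine SupportedOn.mul hh.supp hz ?_
    intro x y w e e'
    rw [e, e', D.s_node, D.s_node, Int.units_mul_self]
  rw [hh.transpose_eq, Matrix.mul_assoc (signMat D k c₂) h z, signMat_sandwich D c₂ c₁ h₁]
  simp [signCast]

/-- The symmetry of the form induced on `U*`. It lets half of this form solve the inhomogeneous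
version of the equation that defines `cornerGL`. -/
theorem transpose_conj_signMat {c₁ : X₁ → I} {c₂ : X₂ → I} {h : Matrix X₂ X₂ k}
    (hh : IsSDForm D c₂ h) {z : Matrix X₂ X₁ k}
    (hz : SupportedOn (fun x y => c₂ x = σ.node (c₁ y)) z) :
    (z.transpose * h * z).transpose * signMat D k c₁ = z.transpose * h * z := by
  rw [Matrix.transpose_mul, Matrix.transpose_mul, Matrix.transpose_transpose, Matrix.mul_assoc,
    transpose_mul_signMat_of_supp hh hz, Matrix.mul_assoc]

/-- The form on `N` may change, so the block on `N` runs through the whole group `GL(N)` and not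
only through isometries; this matches the denominator `#GL(N)` in `sdMass`. The remaining freedom
consists of `GL(U)`, the maps `U* → N`, and the corners `U* → U`, which form a translate of
`cornerGL`. -/
theorem ncard_hypForm_stabilizer (h2 : (2 : k) ≠ 0) (c₁ : X₁ → I) (c₂ : X₂ → I)
    {h : Matrix X₂ X₂ k} (hh : IsSDForm D c₂ h) :
    {t : Matrix ((X₁ ⊕ X₂) ⊕ X₁) ((X₁ ⊕ X₂) ⊕ X₁) k | (IsGraded (sdColor σ c₁ c₂) t ∧ IsUnit t) ∧
      (∀ v ∈ stdSub k X₁ X₂, t.mulVec v ∈ stdSub k X₁ X₂) ∧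
      ∃ h', t.transpose * hypForm D c₁ h * t = hypForm D c₁ h'}.ncard
    = Nat.card (gradedGL k c₁) * Nat.card (gradedGL k c₂) *
      Nat.card k ^ (Finset.univ.filter fun z : X₂ × X₁ => c₂ z.1 = σ.node (c₁ z.2)).card *
      (cornerGL D k c₁).ncard := by
  rw [← ncard_supportedOn (fun x y => c₂ x = σ.node (c₁ y)), card_gradedGL, card_gradedGL,
    ← Set.ncard_prod, ← Set.ncard_prod, ← Set.ncard_prod]
  symm
  -- With blocks `a, x, y` in the first row, `c, z` in the second and `e` in the last, the equations
  -- are `e^T a = 1`, `e^T x + z^T h c = 0` and `e^T y + z^T h z + y^T S e = 0`, where `S` is the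
  -- sign matrix. The first two determine `e` and `x`. For `a⁻¹ y` the third is an affine equation
  -- with particular solution `-½ z^T h z`, and `w` runs through the solutions of the homogeneous
  -- one.
  refine Set.ncard_congr (fun s _ => blk s.1.1.1 (-(s.1.1.1 * s.1.2.transpose * h * s.1.1.2))
    (s.1.1.1 * (s.2 - (2 : k)⁻¹ • (s.1.2.transpose * h * s.1.2))) 0 s.1.1.2 s.1.2 0 0
    (s.1.1.1⁻¹).transpose) ?_ ?_ ?_
  · rintro ⟨⟨⟨a, c⟩, z⟩, w⟩ ⟨⟨⟨⟨ha, hau⟩, hc, hcu⟩, hz⟩, hw, hw'⟩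
    dsimp only at ha hau hc hcu hw hw' ⊢
    change SupportedOn (fun x y => c₂ x = σ.node (c₁ y)) z at hz
    have hau' := (Matrix.isUnit_iff_isUnit_det a).1 hau
    have hzt : SupportedOn (fun x y => σ.node (c₁ x) = c₂ y) z.transpose :=
      hz.transpose.mono fun x y e => e.symm
    have hzh : SupportedOn (fun x y => σ.node (c₁ x) = σ.node (c₂ y)) (z.transpose * h) :=
      SupportedOn.mul hzt hh.supp fun x y w e e' => Eq.trans e e'
    have he : (a.transpose * signMat D k c₁ * (a⁻¹).transpose) = signMat D k c₁ := by
      have h₁ := signMat_mul_of_graded (D := D) (c₁ := c₁) (a := a.transpose)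
        (ha.transpose.mono fun x y e => e.symm)
      rw [← h₁, Matrix.mul_assoc, ← Matrix.transpose_mul, Matrix.nonsing_inv_mul _ hau',
        Matrix.transpose_one, Matrix.mul_one]
    have hzs := transpose_mul_signMat_of_supp hh hz
    refine ⟨⟨supportedOn_blk.2 ⟨⟨ha, ?_, ?_⟩, ⟨SupportedOn.zero, hc, hz⟩, SupportedOn.zero,
      SupportedOn.zero, ?_⟩, isUnit_blk.2 ⟨hau, hcu, ?_⟩⟩, stdSub_map_le_iff.2 ⟨rfl, rfl⟩,
      c.transpose * h * c, ?_⟩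
    · refine SupportedOn.neg ?_
      rw [Matrix.mul_assoc a]
      refine SupportedOn.mul (SupportedOn.mul ha hzh ?_) hc ?_
        (P'' := fun x y => c₁ x = c₂ y) (P := fun x y => c₁ x = c₂ y)
      · exact fun x y w e e' => Eq.trans e (σ.node_involutive.injective e')
      · exact fun x y w e e' => Eq.trans e e'
    · refine SupportedOn.mul ha (P' := fun x y => c₁ x = σ.node (c₁ y)) ?_
        (fun x y w e e' => Eq.trans e e')
      rw [sub_eq_add_neg]
      refine SupportedOn.add hw (SupportedOn.neg (SupportedOn.smul (SupportedOn.mul hzh hz ?_) _))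
      exact fun x y w e e' => Eq.trans (σ.node_involutive.injective e) e'
    · exact ha.inv.transpose.mono fun x y e => congrArg σ.node (Eq.symm e)
    · exact (Matrix.isUnit_transpose _).2 ((Matrix.isUnit_nonsing_inv_iff).2 hau)
    · rw [hypForm_conj, he]
      refine blk_inj.2 ⟨rfl, rfl, rfl, rfl, rfl, ?_, ?_, ?_, ?_⟩
      · calc _ = c.transpose * (h * z) - c.transpose * (h.transpose * z *
              (a.transpose * signMat D k c₁ * (a⁻¹).transpose)) := by
              simp only [Matrix.transpose_neg, Matrix.transpose_mul, Matrix.transpose_transpose,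
                Matrix.neg_mul, Matrix.mul_assoc, sub_eq_add_neg]
          _ = 0 := by rw [he, hzs, sub_self]
      · rw [Matrix.transpose_transpose, Matrix.nonsing_inv_mul _ hau']
      · rw [Matrix.transpose_transpose, Matrix.mul_neg, Matrix.mul_assoc a, Matrix.mul_assoc a,
          Matrix.nonsing_inv_mul_cancel_left _ _ hau']
        exact neg_add_cancel _
      · rw [Matrix.transpose_transpose, Matrix.nonsing_inv_mul_cancel_left _ _ hau',
          Matrix.transpose_mul, Matrix.mul_assoc _ a.transpose, Matrix.mul_assoc _ _ (a⁻¹).transpose,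
          he, Matrix.transpose_sub, Matrix.transpose_smul, Matrix.sub_mul, Matrix.smul_mul,
          transpose_conj_signMat hh hz]
        have h₃ : (2 : k)⁻¹ • (z.transpose * h * z) + (2 : k)⁻¹ • (z.transpose * h * z)
            = z.transpose * h * z := by
          rw [← add_smul, ← two_mul, mul_inv_cancel₀ h2, one_smul]
        calc _ = (w + w.transpose * signMat D k c₁) + (z.transpose * h * z -
              ((2 : k)⁻¹ • (z.transpose * h * z) + (2 : k)⁻¹ • (z.transpose * h * z))) := by abel
          _ = 0 := by rw [hw', h₃, sub_self, add_zero]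
  · rintro ⟨⟨⟨a, c⟩, z⟩, w⟩ ⟨⟨⟨a', c'⟩, z'⟩, w'⟩ ⟨⟨⟨⟨ha, hau⟩, hc, hcu⟩, hz⟩, hw, hw'⟩ _ e
    dsimp only at e hau
    obtain ⟨rfl, -, e₁, -, rfl, rfl, -⟩ := blk_inj.1 e
    have hau' := (Matrix.isUnit_iff_isUnit_det a).1 hau
    have := congrArg (fun M => a⁻¹ * M) e₁
    simp only [Matrix.nonsing_inv_mul_cancel_left _ _ hau', sub_left_inj] at this
    rw [this]
  · rintro t ⟨⟨htg, htu⟩, hst, h', ht⟩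
    obtain ⟨a, x, y, d, c, z, g, l, e, rfl⟩ := exists_blk t
    obtain ⟨rfl, rfl⟩ := stdSub_map_le_iff.1 hst
    have hcalc : (blk a x y 0 c z 0 l e).transpose * hypForm D c₁ h * blk a x y 0 c z 0 l e
        = blk 0 (a.transpose * signMat D k c₁ * l) (a.transpose * signMat D k c₁ * e)
          (l.transpose * a) (c.transpose * h * c + l.transpose * x +
            x.transpose * signMat D k c₁ * l) (l.transpose * y + c.transpose * h * z +
            x.transpose * signMat D k c₁ * e)
          (e.transpose * a) (e.transpose * x + z.transpose * h * c + y.transpose * signMat D k c₁ * l)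
          (e.transpose * y + z.transpose * h * z + y.transpose * signMat D k c₁ * e) := by
      rw [hypForm, blk_transpose, blk_mul, blk_mul, blk_inj]
      refine ⟨?_, ?_, ?_, ?_, ?_, ?_, ?_, ?_, ?_⟩ <;> (simp; try abel)
    rw [hcalc] at ht
    obtain ⟨-, -, -, e₁, -, -, e₂, e₃, e₄⟩ := blk_inj.1 ht
    have hau : IsUnit a := by
      exact IsUnit.of_mul_eq_one e.transpose (mul_eq_one_comm.1 e₂)
    have hau' := (Matrix.isUnit_iff_isUnit_det a).1 hau
    -- The component from `N` to `U*` vanishes because the new form must again pair `U` and `N` to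
    -- zero, while `a` is invertible.
    have hl : l = 0 := by
      have := congrArg (fun M => M * a⁻¹) e₁
      simp only [Matrix.mul_nonsing_inv_cancel_right _ _ hau', Matrix.zero_mul] at this
      rw [← Matrix.transpose_transpose l, this, Matrix.transpose_zero]
    subst hl
    have he : a⁻¹ = e.transpose := Matrix.inv_eq_left_inv e₂
    have hee : e = (a⁻¹).transpose := by rw [he, Matrix.transpose_transpose]
    obtain ⟨⟨g₁, -, g₂⟩, ⟨-, g₃, g₄⟩, -⟩ := supportedOn_blk.1 htg
    have hcu : IsUnit c := (isUnit_blk.1 htu).2.1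
    rw [← he, Matrix.mul_zero, add_zero] at e₃
    rw [← he] at e₄
    have hz : SupportedOn (fun x y => c₂ x = σ.node (c₁ y)) z := g₄
    have hzs := transpose_mul_signMat_of_supp hh hz
    have hzt : SupportedOn (fun x y => σ.node (c₁ x) = c₂ y) z.transpose :=
      hz.transpose.mono fun x y e => e.symm
    have hzh : SupportedOn (fun x y => σ.node (c₁ x) = σ.node (c₂ y)) (z.transpose * h) :=
      SupportedOn.mul hzt hh.supp fun x y w e e' => Eq.trans e e'
    have hye : y.transpose * signMat D k c₁ * e = (a⁻¹ * y).transpose * signMat D k c₁ := by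
      have := signMat_mul_of_graded (D := D) (c₁ := c₁) (a := e)
        (by rw [hee]; exact (IsGraded.inv g₁).transpose.mono fun x y e => e.symm)
      rw [Matrix.mul_assoc, this, Matrix.transpose_mul, ← hee, Matrix.mul_assoc]
    refine ⟨(((a, c), z), a⁻¹ * y + (2 : k)⁻¹ • (z.transpose * h * z)),
      ⟨⟨⟨⟨g₁, hau⟩, g₃, hcu⟩, hz⟩, ?_, ?_⟩, ?_⟩
    · refine SupportedOn.add (SupportedOn.mul (IsGraded.inv g₁) g₂ ?_)
        (SupportedOn.smul (SupportedOn.mul hzh hz ?_) _)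
      · exact fun x y w e e' => Eq.trans e e'
      · exact fun x y w e e' => Eq.trans (σ.node_involutive.injective e) e'
    · have h₃ : (2 : k)⁻¹ • (z.transpose * h * z) + (2 : k)⁻¹ • (z.transpose * h * z)
            = z.transpose * h * z := by
        rw [← add_smul, ← two_mul, mul_inv_cancel₀ h2, one_smul]
      dsimp only
      rw [Matrix.transpose_add, Matrix.transpose_smul, Matrix.add_mul, Matrix.smul_mul,
        transpose_conj_signMat hh hz]
      rw [hye] at e₄
      calc _ = a⁻¹ * y + ((2 : k)⁻¹ • (z.transpose * h * z) + (2 : k)⁻¹ • (z.transpose * h * z))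
            + (a⁻¹ * y).transpose * signMat D k c₁ := by abel
        _ = 0 := by rw [h₃]; exact e₄
    · dsimp only
      rw [← hee, add_sub_cancel_right, Matrix.mul_nonsing_inv_cancel_left _ _ hau']
      congr 1
      rw [Matrix.mul_assoc a, Matrix.mul_assoc a, ← Matrix.mul_neg, ← eq_neg_of_add_eq_zero_left e₃,
        Matrix.mul_nonsing_inv_cancel_left _ _ hau']

end

/-! ### Normal forms -/

section

variable {I : Type*} [DecidableEq I] [Fintype I] {A : Type*} [Fintype A] {Q : FQuiver I A}
  {σ : Q.Involution} {D : DualityStructure σ} {k : Type u₁} [Field k] [Finite k]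
  {X₁ X₂ : Type u₂} [Fintype X₁]
  [DecidableEq X₁] [Fintype X₂] [DecidableEq X₂]

theorem colorDim_node (c₁ : X₁ → I) : colorDim (fun x => σ.node (c₁ x)) = σ.act (colorDim c₁) := by
  funext i
  simp only [colorDim, FQuiver.Involution.act]
  congr 1
  ext x
  simp only [Finset.mem_filter, Finset.mem_univ, true_and]
  constructor
  · rintro h
    rw [← h, σ.node_involutive]
  · intro h
    rw [h, σ.node_involutive]

/-- A basis adapted to an isotropic subspace and its orthogonal. -/
theorem exists_adapted_flag {c₁ : X₁ → I} {c₂ : X₂ → I}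
    {b : Matrix ((X₁ ⊕ X₂) ⊕ X₁) ((X₁ ⊕ X₂) ⊕ X₁) k} (hb : IsSDForm D (sdColor σ c₁ c₂) b)
    {W : Submodule k ((X₁ ⊕ X₂) ⊕ X₁ → k)} (hW : IsGradedSubspace (sdColor σ c₁ c₂) W)
    (hi : IsIsotropicSubspace b W) (hd : gdim (sdColor σ c₁ c₂) W = toLat (colorDim c₁)) :
    ∃ t : Matrix ((X₁ ⊕ X₂) ⊕ X₁) ((X₁ ⊕ X₂) ⊕ X₁) k, IsGraded (sdColor σ c₁ c₂) t ∧ IsUnit t ∧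
      (∀ v ∈ stdSub k X₁ X₂, t.mulVec v ∈ W) ∧
      ∀ v, t.mulVec (inlVec k (X₁ ⊕ X₂) X₁ v) ∈ perpSubspace b W := by
  have hp : gdim (sdColor σ c₁ c₂) (perpSubspace b W) = toLat (colorDim (Sum.elim c₁ c₂)) := by
    funext i
    have h₁ := congrFun (colorDim_sum (Sum.elim c₁ c₂) fun x => σ.node (c₁ x)) i
    have h₂ := congrFun (colorDim_node (σ := σ) c₁) i
    simp only [Pi.add_apply, FQuiver.Involution.act] at h₁ h₂
    rw [hb.gdim_perp hW, hd, h₁, h₂]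
    simp [toLat]
  -- First `W^⊥`, which has the dimension vector of `U ⊕ N`, is moved to the first two blocks; then,
  -- inside these blocks, `W` is moved to the first one.
  obtain ⟨g, hg⟩ := exists_gradedGL_adapted (Sum.elim c₁ c₂) (fun x => σ.node (c₁ x))
    (hb.perp_graded hW) hp
  have hψ : ∀ i v, (glEquiv g⁻¹).toLinearMap.comp (inlVec k (X₁ ⊕ X₂) X₁)
      (colorProj k (Sum.elim c₁ c₂) i v) = colorProj k (sdColor σ c₁ c₂) i
        ((glEquiv g⁻¹).toLinearMap.comp (inlVec k (X₁ ⊕ X₂) X₁) v) := by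
    intro i v
    simp only [LinearMap.comp_apply]
    rw [inlVec_colorProj _ fun x => σ.node (c₁ x)]
    exact glEquiv_colorProj g⁻¹ i _
  have hψi : Function.Injective ((glEquiv g⁻¹).toLinearMap.comp (inlVec k (X₁ ⊕ X₂) X₁)) :=
    (glEquiv g⁻¹).injective.comp inlVec_injective
  have hψr : ∀ v, glEquiv g⁻¹ (inlVec k (X₁ ⊕ X₂) X₁ v) ∈ perpSubspace b W := by
    intro v
    have : inlVec k (X₁ ⊕ X₂) X₁ v ∈ (perpSubspace b W).map (glEquiv g).toLinearMap := hg ▸ ⟨v, rfl⟩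
    obtain ⟨w, hw, e⟩ := this
    rw [← e]
    have := glEquiv_inv_apply g⁻¹ w
    rw [inv_inv] at this
    change glEquiv g⁻¹ (glEquiv g w) ∈ perpSubspace b W
    rw [this]
    exact hw
  have hψW : (W.comap ((glEquiv g⁻¹).toLinearMap.comp (inlVec k (X₁ ⊕ X₂) X₁))).map
      ((glEquiv g⁻¹).toLinearMap.comp (inlVec k (X₁ ⊕ X₂) X₁)) = W := by
    rw [Submodule.map_comap_eq, inf_eq_right]
    intro w hw
    have hw' : w ∈ perpSubspace b W := fun v hv => hi v hv w hw
    have : glEquiv g w ∈ LinearMap.range (inlVec k (X₁ ⊕ X₂) X₁) := hg ▸ ⟨w, hw', rfl⟩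
    obtain ⟨v, hv⟩ := this
    refine ⟨v, ?_⟩
    have := glEquiv_inv_apply g⁻¹ w
    rw [inv_inv] at this
    exact (congrArg (glEquiv g⁻¹) hv).trans this
  obtain ⟨g', hg'⟩ := exists_gradedGL_adapted c₁ c₂ (hW.comap hψ)
    (by rw [← hd, ← gdim_map hψi hψ, hψW])
  have hB : IsGraded (sdColor σ c₁ c₂) (Matrix.fromBlocks
      ((g'.1⁻¹ : (Matrix (X₁ ⊕ X₂) (X₁ ⊕ X₂) k)ˣ) : Matrix (X₁ ⊕ X₂) (X₁ ⊕ X₂) k) 0 0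
      (1 : Matrix X₁ X₁ k)) := by
    rintro (x | x) (y | y) hxy
    · exact g'.2.unit_inv x y hxy
    · rfl
    · rfl
    · exact Matrix.one_apply_ne fun e => hxy (by rw [e])
  have hmul : ∀ v, (((g.1⁻¹ : (Matrix ((X₁ ⊕ X₂) ⊕ X₁) ((X₁ ⊕ X₂) ⊕ X₁) k)ˣ) :
      Matrix ((X₁ ⊕ X₂) ⊕ X₁) ((X₁ ⊕ X₂) ⊕ X₁) k) * Matrix.fromBlocks
      ((g'.1⁻¹ : (Matrix (X₁ ⊕ X₂) (X₁ ⊕ X₂) k)ˣ) : Matrix (X₁ ⊕ X₂) (X₁ ⊕ X₂) k) 0 0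
      (1 : Matrix X₁ X₁ k)).mulVec (inlVec k (X₁ ⊕ X₂) X₁ v)
      = glEquiv g⁻¹ (inlVec k (X₁ ⊕ X₂) X₁ (glEquiv g'⁻¹ v)) := by
    intro v
    rw [← Matrix.mulVec_mulVec, ← fromBlocks_mulVec_inl]
    rfl
  refine ⟨((g.1⁻¹ : (Matrix ((X₁ ⊕ X₂) ⊕ X₁) ((X₁ ⊕ X₂) ⊕ X₁) k)ˣ) :
      Matrix ((X₁ ⊕ X₂) ⊕ X₁) ((X₁ ⊕ X₂) ⊕ X₁) k) * Matrix.fromBlocks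
      ((g'.1⁻¹ : (Matrix (X₁ ⊕ X₂) (X₁ ⊕ X₂) k)ˣ) : Matrix (X₁ ⊕ X₂) (X₁ ⊕ X₂) k) 0 0
      (1 : Matrix X₁ X₁ k), SupportedOn.mul g.2.unit_inv hB fun _ _ _ => Eq.trans,
      (Units.isUnit _).mul (Matrix.isUnit_fromBlocks_zero₂₁.2 ⟨Units.isUnit _, isUnit_one⟩), ?_, ?_⟩
  · rintro _ ⟨v, rfl⟩
    rw [LinearMap.comp_apply, hmul]
    have : inlVec k X₁ X₂ v ∈ (W.comap ((glEquiv g⁻¹).toLinearMap.comp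
      (inlVec k (X₁ ⊕ X₂) X₁))).map (glEquiv g').toLinearMap := hg' ▸ ⟨v, rfl⟩
    obtain ⟨w, hw, e⟩ := this
    have := glEquiv_inv_apply g'⁻¹ w
    rw [inv_inv] at this
    rw [← e]
    change glEquiv g⁻¹ (inlVec k (X₁ ⊕ X₂) X₁ (glEquiv g'⁻¹ (glEquiv g' w))) ∈ W
    rw [this]
    exact hw
  · intro v
    rw [hmul]
    exact hψr _

theorem isIsotropic_stdSub (c₁ : X₁ → I) (h : Matrix X₂ X₂ k) :
    IsIsotropicSubspace (hypForm D c₁ h) (stdSub k X₁ X₂) := by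
  rintro _ ⟨v, rfl⟩ _ ⟨w, rfl⟩
  simp only [LinearMap.comp_apply]
  rw [hypForm_inlVec]
  have : resInr k X₁ X₂ (inlVec k X₁ X₂ v) = 0 := rfl
  rw [this, zero_dotProduct]

/-- Forms in adapted bases. -/
theorem exists_blk_of_isotropic {c₁ : X₁ → I} {c₂ : X₂ → I}
    {b : Matrix ((X₁ ⊕ X₂) ⊕ X₁) ((X₁ ⊕ X₂) ⊕ X₁) k} (hb : IsSDForm D (sdColor σ c₁ c₂) b)
    (h : ∀ x z, b (.inl (.inl x)) (.inl z) = 0) :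
    ∃ P h R P' R' N, b = blk 0 0 P 0 h R P' R' N := by
  refine ⟨fun x y => b (.inl (.inl x)) (.inr y), fun x y => b (.inl (.inr x)) (.inl (.inr y)),
    fun x y => b (.inl (.inr x)) (.inr y), fun x y => b (.inr x) (.inl (.inl y)),
    fun x y => b (.inr x) (.inl (.inr y)), fun x y => b (.inr x) (.inr y), ?_⟩
  ext ((x | x) | x) ((y | y) | y)
  · exact h _ _
  · exact h _ _
  · rfl
  · rw [hb.symm, h, mul_zero]; rfl
  all_goals rfl

theorem transpose_mul_mul_mul {X : Type*} [Fintype X] (t u b : Matrix X X k) :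
    (t * u).transpose * b * (t * u) = u.transpose * (t.transpose * b * t) * u := by
  simp only [Matrix.transpose_mul, Matrix.mul_assoc]

/-- A Witt decomposition by completing the square: rescale `U*` until its pairing with `U` is
standard, then correct `N` and `U*` by vectors of `U`, which changes neither that pairing nor the
form on `N`. -/
theorem exists_hypForm_conj_of_blk (h2 : (2 : k) ≠ 0) {c₁ : X₁ → I} {c₂ : X₂ → I}
    {P P' N : Matrix X₁ X₁ k} {h : Matrix X₂ X₂ k} {R : Matrix X₂ X₁ k} {R' : Matrix X₁ X₂ k}
    (hb : IsSDForm D (sdColor σ c₁ c₂) (blk 0 0 P 0 h R P' R' N)) :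
    ∃ t : Matrix ((X₁ ⊕ X₂) ⊕ X₁) ((X₁ ⊕ X₂) ⊕ X₁) k, IsGraded (sdColor σ c₁ c₂) t ∧ IsUnit t ∧
      (∀ v ∈ stdSub k X₁ X₂, t.mulVec v ∈ stdSub k X₁ X₂) ∧
      ∃ h', t.transpose * blk 0 0 P 0 h R P' R' N * t = hypForm D c₁ h' := by
  have hPu : IsUnit P := by
    obtain ⟨M, hM⟩ := hb.unit.exists_right_inv
    obtain ⟨a, b, c, d, e, f, g, h', i, rfl⟩ := exists_blk M
    rw [blk_mul, blk_one, blk_inj] at hM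
    refine IsUnit.of_mul_eq_one g ?_
    simpa using hM.1
  have hPg : IsGraded c₁ P := (supportedOn_blk.1 hb.supp).1.2.2.mono fun x y h =>
    h.trans (σ.node_involutive _)
  -- The rescaling of `U*` that turns the pairing `P` into the sign matrix.
  obtain ⟨e, he⟩ : ∃ e, e = P⁻¹ * signMat D k c₁ := ⟨_, rfl⟩
  have hPe : P * e = signMat D k c₁ := by
    rw [he, Matrix.mul_nonsing_inv_cancel_left _ _ ((Matrix.isUnit_iff_isUnit_det P).1 hPu)]
  have hSg : IsGraded c₁ (signMat D k c₁) := fun x y h => signMat_apply_ne _ fun e => h (by rw [e])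
  have hSu : IsUnit (signMat D k c₁) := IsUnit.of_mul_eq_one _ (signMat_mul_self D c₁)
  have heg : IsGraded c₁ e := by
    rw [he]
    exact SupportedOn.mul hPg.inv hSg fun _ _ _ => Eq.trans
  have heu : IsUnit e := by
    rw [he]
    exact ((Matrix.isUnit_nonsing_inv_iff).2 hPu).mul hSu
  have ht₂ : IsGraded (sdColor σ c₁ c₂) (blk 1 0 0 0 1 0 0 0 e) := supportedOn_blk.2
    ⟨⟨IsGraded.one (c := c₁), SupportedOn.zero, SupportedOn.zero⟩,
      ⟨SupportedOn.zero, IsGraded.one (c := c₂), SupportedOn.zero⟩, SupportedOn.zero,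
      SupportedOn.zero, heg.mono fun x y h => congrArg σ.node h⟩
  have hu₂ : IsUnit (blk (1 : Matrix X₁ X₁ k) 0 0 0 (1 : Matrix X₂ X₂ k) 0 0 0 e) :=
    isUnit_blk.2 ⟨isUnit_one, isUnit_one, heu⟩
  have hb₂ := isSDForm_conj hb ht₂ hu₂
  have hcalc : (blk (1 : Matrix X₁ X₁ k) 0 0 0 (1 : Matrix X₂ X₂ k) 0 0 0 e).transpose *
      blk 0 0 P 0 h R P' R' N * blk 1 0 0 0 1 0 0 0 e
      = blk 0 0 (signMat D k c₁) 0 h (R * e) (e.transpose * P') (e.transpose * R')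
        (e.transpose * N * e) := by
    rw [blk_transpose, blk_mul, blk_mul, ← hPe]
    simp
  rw [hcalc] at hb₂
  obtain ⟨R₁, hR₁⟩ : ∃ R₁, R₁ = e.transpose * R' := ⟨_, rfl⟩
  obtain ⟨N₁, hN₁⟩ : ∃ N₁, N₁ = e.transpose * N * e := ⟨_, rfl⟩
  rw [← hR₁, ← hN₁] at hb₂ hcalc
  -- The opposite corner is then forced by the symmetry of the form.
  have h₁ : e.transpose * P' = 1 := by
    ext x y
    have := hb₂.symm (.inr x) (.inl (.inl y))
    change (e.transpose * P') x y = signCast k (D.s (σ.node (c₁ x))) * signMat D k c₁ y x at this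
    rw [this, D.s_node]
    by_cases hxy : x = y
    · subst hxy
      rw [signMat, Matrix.diagonal_apply_eq, signCast_mul_self, Matrix.one_apply_eq]
    · rw [signMat_apply_ne _ (Ne.symm hxy), mul_zero, Matrix.one_apply_ne hxy]
  have h₃ : R₁.transpose * signMat D k c₁ = R * e := by
    ext x y
    have := hb₂.symm (.inr y) (.inl (.inr x))
    change R₁ y x = signCast k (D.s (σ.node (c₁ y))) * (R * e) x y at this
    rw [signMat, Matrix.mul_diagonal, Matrix.transpose_apply, this, D.s_node, mul_comm, ← mul_assoc,
      signCast_mul_self, one_mul]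
  have h₄ : N₁.transpose * signMat D k c₁ = N₁ := by
    ext x y
    have := hb₂.symm (.inr y) (.inr x)
    change N₁ y x = signCast k (D.s (σ.node (c₁ y))) * N₁ x y at this
    rw [signMat, Matrix.mul_diagonal, Matrix.transpose_apply, this, D.s_node, mul_comm, ← mul_assoc,
      signCast_mul_self, one_mul]
  rw [h₁] at hb₂ hcalc
  obtain ⟨-, -, -, hR, hN⟩ := supportedOn_blk.1 hb₂.supp
  -- The corner `N₁` is corrected from both arguments of the form, equally by its symmetry; hence
  -- the factor one half.
  refine ⟨blk 1 0 0 0 1 0 0 0 e * blk 1 (-R₁) (-((2 : k)⁻¹ • N₁)) 0 1 0 0 0 1,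
    SupportedOn.mul ht₂ (supportedOn_blk.2 ⟨⟨IsGraded.one (c := c₁), hR.neg.mono fun x y e =>
      σ.node_involutive.injective e, (hN.smul _).neg.mono fun x y e =>
      σ.node_involutive.injective e⟩,
      ⟨SupportedOn.zero, IsGraded.one (c := c₂), SupportedOn.zero⟩, SupportedOn.zero,
      SupportedOn.zero, IsGraded.one (c := fun x => σ.node (c₁ x))⟩) fun _ _ _ => Eq.trans,
    hu₂.mul (isUnit_blk.2 ⟨isUnit_one, isUnit_one, isUnit_one⟩), ?_, h, ?_⟩
  · rw [blk_mul]
    exact stdSub_map_le_iff.2 ⟨by simp, by simp⟩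
  · rw [transpose_mul_mul_mul, hcalc, hypForm, blk_transpose, blk_mul, blk_mul, blk_inj]
    refine ⟨by simp, by simp, by simp, by simp, by simp, ?_, by simp, by simp, ?_⟩
    · simp only [Matrix.mul_zero, Matrix.mul_one, add_zero, Matrix.transpose_neg, Matrix.transpose_one,
        Matrix.one_mul, Matrix.neg_mul, Matrix.transpose_zero, Matrix.zero_mul, zero_add, ← h₃]
      simp
    · have h₅ : (2 : k)⁻¹ • N₁ + (2 : k)⁻¹ • N₁ = N₁ := by
        rw [← add_smul, ← two_mul, mul_inv_cancel₀ h2, one_smul]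
      simp only [Matrix.mul_zero, Matrix.mul_one, add_zero, Matrix.transpose_neg, Matrix.transpose_one,
        Matrix.one_mul, Matrix.neg_mul, Matrix.transpose_zero, Matrix.zero_mul, zero_add,
        Matrix.transpose_smul, Matrix.smul_mul, h₄]
      calc _ = N₁ - ((2 : k)⁻¹ • N₁ + (2 : k)⁻¹ • N₁) := by abel
        _ = 0 := by rw [h₅, sub_self]

/-- Normal forms of self-dual structures with respect to isotropic subspaces. -/
theorem exists_hypForm_conj (h2 : (2 : k) ≠ 0) {c₁ : X₁ → I} {c₂ : X₂ → I}
    {b : Matrix ((X₁ ⊕ X₂) ⊕ X₁) ((X₁ ⊕ X₂) ⊕ X₁) k} (hb : IsSDForm D (sdColor σ c₁ c₂) b)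
    {W : Submodule k ((X₁ ⊕ X₂) ⊕ X₁ → k)} (hW : IsGradedSubspace (sdColor σ c₁ c₂) W)
    (hi : IsIsotropicSubspace b W) (hd : gdim (sdColor σ c₁ c₂) W = toLat (colorDim c₁)) :
    ∃ g : gradedGL k (sdColor σ c₁ c₂), W.map (glEquiv g).toLinearMap = stdSub k X₁ X₂ ∧
      ∃ h, ((g.1⁻¹ : (Matrix ((X₁ ⊕ X₂) ⊕ X₁) ((X₁ ⊕ X₂) ⊕ X₁) k)ˣ) :
        Matrix ((X₁ ⊕ X₂) ⊕ X₁) ((X₁ ⊕ X₂) ⊕ X₁) k).transpose * b *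
        ((g.1⁻¹ : (Matrix ((X₁ ⊕ X₂) ⊕ X₁) ((X₁ ⊕ X₂) ⊕ X₁) k)ˣ) :
        Matrix ((X₁ ⊕ X₂) ⊕ X₁) ((X₁ ⊕ X₂) ⊕ X₁) k) = hypForm D c₁ h := by
  obtain ⟨t₁, ht₁, hu₁, hs₁, hp₁⟩ := exists_adapted_flag hb hW hi hd
  have hb₁ := isSDForm_conj hb ht₁ hu₁
  have hz : ∀ x z, (t₁.transpose * b * t₁) (.inl (.inl x)) (.inl z) = 0 := by
    intro x z
    have h₁ := hp₁ (Pi.single z 1) _ (hs₁ _ ⟨Pi.single x 1, rfl⟩)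
    have e₁ : inlVec k (X₁ ⊕ X₂) X₁ (Pi.single z 1) = Pi.single (Sum.inl z) 1 := by
      ext (z | z) <;> simp [inlVec_apply, Pi.single_apply]
    have e₂ : inlVec k (X₁ ⊕ X₂) X₁ (inlVec k X₁ X₂ (Pi.single x 1))
        = Pi.single (Sum.inl (Sum.inl x)) 1 := by
      ext ((z | z) | z) <;> simp [inlVec_apply, Pi.single_apply]
    rw [LinearMap.comp_apply, e₁, e₂, Matrix.mulVec_single_one, Matrix.mulVec_single_one] at h₁
    rw [← h₁, Matrix.mul_assoc, Matrix.mul_apply']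
    rfl
  obtain ⟨P, h, R, P', R', N, hblk⟩ := exists_blk_of_isotropic hb₁ hz
  rw [hblk] at hb₁
  obtain ⟨t₂, ht₂, hu₂, hs₂, h', hh'⟩ := exists_hypForm_conj_of_blk h2 hb₁
  rw [← hblk] at hh'
  have hu := hu₁.mul hu₂
  have hg : IsGraded (sdColor σ c₁ c₂) ((hu.unit : (Matrix ((X₁ ⊕ X₂) ⊕ X₁) ((X₁ ⊕ X₂) ⊕ X₁) k)ˣ) :
      Matrix ((X₁ ⊕ X₂) ⊕ X₁) ((X₁ ⊕ X₂) ⊕ X₁) k) := SupportedOn.mul ht₁ ht₂ fun _ _ _ => Eq.trans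
  let g : gradedGL k (sdColor σ c₁ c₂) := ⟨hu.unit, hg⟩
  have hgW : (stdSub k X₁ X₂).map (glEquiv g).toLinearMap = W := by
    refine eq_of_le_of_gdim_le ((stdSub_graded σ c₁ c₂).map (glEquiv_colorProj g)) ?_ fun i => ?_
    · rintro _ ⟨v, hv, rfl⟩
      change (t₁ * t₂).mulVec v ∈ W
      rw [← Matrix.mulVec_mulVec]
      exact hs₁ _ (hs₂ v hv)
    · rw [hd, gdim_map (glEquiv g).injective (glEquiv_colorProj g), gdim_stdSub]
  refine ⟨g⁻¹, ?_, h', ?_⟩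
  · rw [← hgW, ← Submodule.map_comp]
    convert Submodule.map_id _
    refine LinearMap.ext fun v => ?_
    have := glEquiv_inv_apply g⁻¹ v
    rw [inv_inv] at this
    exact this
  · change ((hu.unit⁻¹⁻¹ : (Matrix ((X₁ ⊕ X₂) ⊕ X₁) ((X₁ ⊕ X₂) ⊕ X₁) k)ˣ) :
        Matrix ((X₁ ⊕ X₂) ⊕ X₁) ((X₁ ⊕ X₂) ⊕ X₁) k).transpose * b * _ = _
    rw [← hh', inv_inv, ← transpose_mul_mul_mul]
    rfl

/-- The self-dual analogue of the Hall count. The slice requires that `U` be the standard subspace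
and that the form be hyperbolic around some form on `N`; every point can be moved there by the
normal form, and the stabiliser count does not depend on the point. -/
theorem sd_count (h2 : (2 : k) ≠ 0) {θ : Module.Dual ℤ (I → ℤ)} (hθ : σ.Compatible θ)
    (c₁ : X₁ → I) (c₂ : X₂ → I) :
    {z | z ∈ sdMat D k (sdColor σ c₁ c₂) ∧ ∃ U : invLat (sdColor σ c₁ c₂) z.1,
      gdim (sdColor σ c₁ c₂) U.1 = toLat (colorDim c₁) ∧ IsIsotropicSubspace z.2 U.1 ∧
      PositiveInterval (latDeg θ) ⊥ U ∧ SDSemistableAt θ z.2 U}.ncard *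
      (Nat.card (gradedGL k c₁) * Nat.card (gradedGL k c₂) *
        Nat.card k ^ (Finset.univ.filter fun z : X₂ × X₁ => c₂ z.1 = σ.node (c₁ z.2)).card *
        (cornerGL D k c₁).ncard) =
      Nat.card (gradedGL k (sdColor σ c₁ c₂)) *
      ((repSet Q IntervalPredicate.positive θ k c₁).ncard *
      (sdSet D θ k c₂).ncard * Nat.card k ^ (Finset.univ.filter fun z : A × X₂ × X₁ =>
          c₂ z.2.1 = Q.tgt z.1 ∧ σ.node (c₁ z.2.2) = Q.src z.1).card *
      (cornerRep D k c₁).ncard) := by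
  rw [← ncard_sdSlice]
  have glPos : ∀ (g : gradedGL k (sdColor σ c₁ c₂)) {z : (A → Matrix ((X₁ ⊕ X₂) ⊕ X₁)
      ((X₁ ⊕ X₂) ⊕ X₁) k) × Matrix ((X₁ ⊕ X₂) ⊕ X₁) ((X₁ ⊕ X₂) ⊕ X₁) k}
      (U : invLat (sdColor σ c₁ c₂) z.1), PositiveInterval (latDeg θ) ⊥ U →
      PositiveInterval (latDeg θ) ⊥ (glMap g U) := by
    intro g z U h
    rw [← glMap_bot g]
    exact (holds_glMap θ IntervalPredicate.positive g _ _).2 h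
  refine slice_count (G := gradedGL k (sdColor σ c₁ c₂)) conjSD conjSD_one conjSD_mul _
    (sdSlice D θ k c₁ c₂) ?_ ?_ ?_ _ ?_
  · rintro ⟨m, b⟩ ⟨h₁, ⟨h, rfl⟩, U, hU, h₂, h₃⟩
    refine ⟨h₁, U, ?_, ?_, h₂, h₃⟩
    · rw [hU, gdim_stdSub]
    · rw [hU]
      exact isIsotropic_stdSub c₁ h
  · rintro g z ⟨h₁, U, hd, hi, hp, hs⟩
    refine ⟨conjSD_mem g h₁, glMap g U, ?_, (isIsotropic_glMap g U).2 hi, glPos g U hp,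
      (sdSemistableAt_glMap g U).2 hs⟩
    rw [← hd]
    exact gdim_map (glEquiv g).injective (glEquiv_colorProj g) U.1
  · rintro z ⟨h₁, U, hd, hi, hp, hs⟩
    obtain ⟨g, hg, h, hh⟩ := exists_hypForm_conj h2 h₁.2.1 U.2.1 hi hd
    exact ⟨g, conjSD_mem g h₁, ⟨h, hh⟩, glMap g U, hg, glPos g U hp,
      (sdSemistableAt_glMap g U).2 hs⟩
  · rintro ⟨m, b⟩ ⟨h₁, ⟨h, rfl⟩, U, hU, hp, hs⟩
    rw [← ncard_hypForm_stabilizer h2 c₁ c₂ ((isSDForm_hypForm c₁ c₂ h).1 h₁.2.1)]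
    refine Eq.trans ?_ (ncard_gradedGL_set (sdColor σ c₁ c₂)
      {t | (∀ v ∈ stdSub k X₁ X₂, t.mulVec v ∈ stdSub k X₁ X₂) ∧
      ∃ h', t.transpose * hypForm D c₁ h * t = hypForm D c₁ h'})
    -- Inversion is needed because a group element acts on forms through its inverse. That `g` fixes
    -- `U` follows from uniqueness of the reduction.
    refine Set.ncard_congr (fun g _ => g⁻¹) ?_ ?_ ?_
    · rintro g ⟨h₂, ⟨h', hh'⟩, U', hU', hp', hs'⟩
      have h₄ : glMap g U = U' := by
        refine sdSemistableAt_unique hθ h₂ ((isIsotropic_glMap g U).2 ?_) (glPos g U hp)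
          ((sdSemistableAt_glMap g U).2 hs) ?_ hp' hs'
        · rw [hU]
          exact isIsotropic_stdSub c₁ h
        · rw [hU']
          have := isIsotropic_stdSub (D := D) c₁ h'
          rw [← hh'] at this
          exact this
      refine ⟨?_, h', hh'⟩
      intro v hv
      have h₅ : U.1.map (glEquiv g).toLinearMap = stdSub k X₁ X₂ := by
        rw [← hU', ← h₄]
        rfl
      rw [← h₅] at hv
      obtain ⟨w, hw, rfl⟩ := hv
      have := glEquiv_inv_apply g⁻¹ w
      rw [inv_inv] at this
      change glEquiv g⁻¹ (glEquiv g w) ∈ _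
      rw [this, ← hU]
      exact hw
    · intro g g' _ _ e
      exact inv_injective e
    · rintro g ⟨hg, h', hh'⟩
      refine ⟨g⁻¹, ⟨conjSD_mem _ h₁, ⟨h', ?_⟩, glMap g⁻¹ U, ?_, glPos _ U hp,
        (sdSemistableAt_glMap g⁻¹ U).2 hs⟩, inv_inv g⟩
      · rw [← hh']
        simp [conjSD]
      · have h₅ := map_glEquiv_eq g hg
        change U.1.map (glEquiv g⁻¹).toLinearMap = _
        rw [hU]
        conv_lhs => rw [← h₅]
        rw [← Submodule.map_comp]
        convert Submodule.map_id _
        refine LinearMap.ext fun v => ?_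
        have := glEquiv_inv_apply g⁻¹ v
        rw [inv_inv] at this
        exact this

end

/-! ### Stratification by the dimension vectors of subrepresentations -/

theorem ncard_eq_sum_ncard {Ω ι : Type*} [Finite Ω] {S : Set Ω} (T : ι → Set Ω) (s : Finset ι)
    (hS : ∀ x, x ∈ S ↔ ∃ i ∈ s, x ∈ T i)
    (hT : ∀ x, ∀ i ∈ s, ∀ j ∈ s, x ∈ T i → x ∈ T j → i = j) :
    S.ncard = ∑ i ∈ s, (T i).ncard := by
  classical
  have := Fintype.ofFinite Ω
  have e : S = ↑(s.biUnion fun i => (T i).toFinset) := by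
    ext x
    rw [hS]
    simp
  rw [e, Set.ncard_coe_finset, Finset.card_biUnion]
  · exact Finset.sum_congr rfl fun i _ => (Set.ncard_eq_toFinset_card' _).symm
  · intro i hi j hj hij
    rw [Function.onFun, Finset.disjoint_left]
    intro x hx hx'
    exact hij (hT x i hi j hj (by simpa using hx) (by simpa using hx'))

section

variable {I : Type*} [DecidableEq I] [Fintype I] {A : Type*} [Fintype A] (Q : FQuiver I A)
  {σ : Q.Involution} (D : DualityStructure σ)
  {k : Type u₁} [Field k] [Finite k] {X X' : Type u₂} [Fintype X] [Fintype X'] [DecidableEq X]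
  [DecidableEq X']

theorem exists_gdim_eq {c : X → I} (W : Submodule k (X → k)) :
    ∃ d, d ≤ colorDim c ∧ gdim c W = toLat d := by
  refine ⟨fun i => (gdim c W i).toNat, fun i => ?_, ?_⟩
  · have h₁ := gdim_mono (c := c) (le_top : W ≤ ⊤) i
    rw [gdim_top] at h₁
    exact Int.toNat_le.2 h₁
  · funext i
    exact (Int.toNat_of_nonneg (gdim_nonneg i)).symm

theorem toLat_injective : Function.Injective (toLat : (I → ℕ) → I → ℤ) := fun d d' h => by
  funext i
  exact Int.ofNat.inj (congrFun h i)

/-- Representations with a subrepresentation of given dimension vector and with given properties. -/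
def repStratum (P₁ P₂ : IntervalPredicate.{max u₁ u₂}) (θ : Module.Dual ℤ (I → ℤ)) (k : Type u₁)
    [Field k] (c : X → I) (d : I → ℕ) : Set (A → Matrix X X k) :=
  {m | m ∈ repMat Q k c ∧ ∃ W : invLat c m, gdim c W.1 = toLat d ∧
    P₁.holds (latDeg θ) latRk ⊥ W ∧ P₂.holds (latDeg θ) latRk W ⊤}

/-- Allows one to pass from the standard coordinates for `a + b` to the disjoint union of those for
`a` and `b`. Only an injection is constructed; the other inequality follows by symmetry. -/
theorem ncard_repStratum_congr (P₁ P₂ : IntervalPredicate.{max u₁ u₂}) (θ : Module.Dual ℤ (I → ℤ))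
    {c : X → I} {c' : X' → I} (h : colorDim c = colorDim c') (d : I → ℕ) :
    (repStratum Q P₁ P₂ θ k c d).ncard = (repStratum Q P₁ P₂ θ k c' d).ncard := by
  have key : ∀ {X X' : Type u₂} [Fintype X] [Fintype X'] [DecidableEq X] [DecidableEq X']
      {c : X → I} {c' : X' → I}, colorDim c = colorDim c' →
      (repStratum Q P₁ P₂ θ k c d).ncard ≤ (repStratum Q P₁ P₂ θ k c' d).ncard := by
    intro X X' _ _ _ _ c c' h
    obtain ⟨e, he⟩ := exists_color_equiv h
    refine Set.ncard_le_ncard_of_injOn (fun m a => (m a).submatrix e.symm e.symm) ?_ ?_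
      (Set.toFinite _)
    · rintro m ⟨h₁, W, hW, h₂, h₃⟩
      have hm := fun a v => reindex_mulVec e (m a) v
      have hc := reindex_colorProj (k := k) e he
      refine ⟨reindex_mem_repMat Q e he h₁, mapInv (LinearEquiv.funCongrLeft k k e.symm).toLinearMap
        hc hm W, ?_, ?_, ?_⟩
      · exact (gdim_map (LinearEquiv.funCongrLeft k k e.symm).injective hc W.1).trans hW
      · rw [← mapInv_bot (LinearEquiv.funCongrLeft k k e.symm).toLinearMap hc hm]
        exact (P₁.transfer (mapInv_convex θ (LinearEquiv.funCongrLeft k k e.symm).injective hc hm)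
          ⊥ W).2 h₂
      · rw [← mapInv_top (LinearEquiv.funCongrLeft k k e.symm) hc hm]
        exact (P₂.transfer (mapInv_convex θ (LinearEquiv.funCongrLeft k k e.symm).injective hc hm)
          W ⊤).2 h₃
    · intro m _ m' _ hmm
      funext a
      have := congrArg (fun M => M.submatrix e e) (congrFun hmm a)
      simpa using this
  exact le_antisymm (key h) (key h.symm)

/-- Uniqueness of the first filtration step makes its dimension vector well defined, so the strata
are disjoint. -/
theorem ncard_repSet_hn_cons (θ : Module.Dual ℤ (I → ℤ)) (c : X → I) {μ : ℚ} {l : List ℚ}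
    (hl : ∀ ν ∈ l, ν < μ) :
    (repSet Q (IntervalPredicate.hn (μ :: l)) θ k c).ncard = ∑ d ∈ Finset.Iic (colorDim c),
      (repStratum Q (IntervalPredicate.semistable μ) (IntervalPredicate.hn l) θ k c d).ncard := by
  refine ncard_eq_sum_ncard _ _ (fun m => ?_) ?_
  · constructor
    · rintro ⟨h₁, W, -, h₂, h₃⟩
      obtain ⟨d, hd, hW⟩ := exists_gdim_eq (c := c) W.1
      exact ⟨d, Finset.mem_Iic.2 hd, h₁, W, hW, h₂, h₃⟩
    · rintro ⟨d, -, h₁, W, -, h₂, h₃⟩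
      exact ⟨h₁, W, le_top, h₂, h₃⟩
  · rintro m d - d' - ⟨-, W, hW, h₂, h₃⟩ ⟨-, W', hW', h₂', h₃'⟩
    have := HNInterval.unique (isSlopeData θ) hl h₂ h₃ h₂' h₃'
    exact toLat_injective (by rw [← hW, ← hW', this])

/-- The source of convergence: only slopes of dimension vectors below that of the whole space can
occur in a filtration, so larger finite lists of positive slopes describe the same representations.
-/
theorem repSet_hn_eq_positive (θ : Module.Dual ℤ (I → ℤ)) (c : X → I) {l : List ℚ}
    (hl : l.Pairwise (· > ·)) (hpos : ∀ μ ∈ l, 0 < μ)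
    (H : ∀ d ≤ colorDim c, d ≠ 0 → 0 < slope θ d → slope θ d ∈ l) :
    repSet Q (IntervalPredicate.hn l) θ k c = repSet Q IntervalPredicate.positive θ k c := by
  ext m
  refine and_congr_right fun _ => ⟨fun h => HNInterval.positive (isSlopeData θ) hpos h, fun h => ?_⟩
  refine PositiveInterval.hn (isSlopeData θ) hl bot_le h fun W W' _ hWW _ ν hν hs => Or.inl ?_
  obtain ⟨d, hd⟩ : ∃ d : I → ℕ, d = fun i => (gdim c W'.1 i - gdim c W.1 i).toNat := ⟨_, rfl⟩
  have hd' : toLat d = gdim c W'.1 - gdim c W.1 := by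
    funext i
    rw [hd]
    exact Int.toNat_of_nonneg (sub_nonneg.2 (gdim_mono hWW.le i))
  have hdeg : θ (toLat d) = latDeg θ W' - latDeg θ W := by rw [hd', map_sub]; rfl
  have hrk : ((∑ i, d i : ℕ) : ℤ) = latRk W' - latRk W := by
    rw [latRk, latRk, ← Finset.sum_sub_distrib]
    push_cast
    exact Finset.sum_congr rfl fun i _ => congrFun hd' i
  have hlt := (isSlopeData (c := c) (m := m) θ).rk_strictMono hWW
  have hslope : slope θ d = ν := by
    unfold slope
    rw [hdeg, ← Int.cast_natCast (∑ i, d i), hrk, div_eq_iff]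
    · unfold shift at hs
      push_cast
      linarith
    · exact_mod_cast (sub_pos.2 hlt).ne'
  rw [← hslope]
  refine H d (fun i => ?_) ?_ (hslope ▸ hν)
  · have h₁ := gdim_mono (c := c) (le_top : W'.1 ≤ ⊤) i
    rw [gdim_top] at h₁
    have h₂ := gdim_nonneg (c := c) (W := W.1) i
    have h₃ := congrFun hd' i
    simp only [toLat, Pi.sub_apply] at h₁ h₃
    exact_mod_cast show (d i : ℤ) ≤ colorDim c i by linarith
  · rintro rfl
    simp only [Pi.zero_apply, Finset.sum_const_zero, Nat.cast_zero] at hrk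
    omega

/-! ### Strata of self-dual representations. -/

variable {Q}

theorem reindex_mem_sdMat {c : X → I} {c' : X' → I} (e : X ≃ X') (he : ∀ x, c' (e x) = c x)
    {z : (A → Matrix X X k) × Matrix X X k} (hz : z ∈ sdMat D k c) :
    ((fun a => (z.1 a).submatrix e.symm e.symm), z.2.submatrix e.symm e.symm) ∈ sdMat D k c' := by
  refine ⟨reindex_mem_repMat Q e he hz.1, ⟨fun x y hxy => hz.2.1.supp _ _ fun h => hxy ?_,
    fun x y => ?_, (Matrix.isUnit_submatrix_equiv _ _).2 hz.2.1.unit⟩, fun a => ?_⟩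
  · dsimp only at h ⊢
    rwa [← he, ← he, e.apply_symm_apply, e.apply_symm_apply] at h
  · have := hz.2.1.symm (e.symm x) (e.symm y)
    rwa [← he, e.apply_symm_apply] at this
  · have := congrArg (fun M => M.submatrix e.symm e.symm) (hz.2.2 a)
    simp only [Matrix.submatrix_mul_equiv, Matrix.transpose_submatrix]
    exact this

theorem reindex_form (e : X ≃ X') (b : Matrix X X k) (v w : X → k) :
    LinearEquiv.funCongrLeft k k e.symm v ⬝ᵥ
      (b.submatrix e.symm e.symm).mulVec (LinearEquiv.funCongrLeft k k e.symm w)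
      = v ⬝ᵥ b.mulVec w := by
  rw [← reindex_mulVec]
  exact Equiv.sum_comp e.symm fun x => v x * b.mulVec w x

/-- Self-dual representations with a destabilising subrepresentation of given dimension vector. -/
def sdStratum (θ : Module.Dual ℤ (I → ℤ)) (k : Type*) [Field k] (c : X → I) (d : I → ℕ) :
    Set ((A → Matrix X X k) × Matrix X X k) :=
  {z | z ∈ sdMat D k c ∧ ∃ U : invLat c z.1, gdim c U.1 = toLat d ∧ IsIsotropicSubspace z.2 U.1 ∧
    PositiveInterval (latDeg θ) ⊥ U ∧ SDSemistableAt θ z.2 U}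

theorem ncard_sdStratum_congr (θ : Module.Dual ℤ (I → ℤ))
    {c : X → I} {c' : X' → I} (h : colorDim c = colorDim c') (d : I → ℕ) :
    (sdStratum D θ k c d).ncard = (sdStratum D θ k c' d).ncard := by
  have key : ∀ {X X' : Type u₂} [Fintype X] [Fintype X'] [DecidableEq X] [DecidableEq X']
      {c : X → I} {c' : X' → I}, colorDim c = colorDim c' →
      (sdStratum D θ k c d).ncard ≤ (sdStratum D θ k c' d).ncard := by
    intro X X' _ _ _ _ c c' h
    obtain ⟨e, he⟩ := exists_color_equiv h
    refine Set.ncard_le_ncard_of_injOn (fun z => ((fun a => (z.1 a).submatrix e.symm e.symm),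
      z.2.submatrix e.symm e.symm)) ?_ ?_ (Set.toFinite _)
    · rintro z ⟨h₁, U, hU, hi, hp, hs⟩
      have hm := fun a v => reindex_mulVec e (z.1 a) v
      have hc := reindex_colorProj (k := k) e he
      have hcon := mapInv_convex θ (LinearEquiv.funCongrLeft k k e.symm).injective hc hm
      have hdim := fun W => gdim_map (c := c) (LinearEquiv.funCongrLeft k k e.symm).injective hc W
      have hiso : ∀ W : Submodule k (X → k), IsIsotropicSubspace (z.2.submatrix e.symm e.symm)
          (W.map (LinearEquiv.funCongrLeft k k e.symm).toLinearMap) ↔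
          IsIsotropicSubspace z.2 W := by
        intro W
        constructor
        · intro H v hv w hw
          rw [← reindex_form e]
          exact H _ ⟨v, hv, rfl⟩ _ ⟨w, hw, rfl⟩
        · rintro H _ ⟨v, hv, rfl⟩ _ ⟨w, hw, rfl⟩
          exact (reindex_form e z.2 v w).trans (H v hv w hw)
      refine ⟨reindex_mem_sdMat D e he h₁, mapInv (LinearEquiv.funCongrLeft k k e.symm).toLinearMap
        hc hm U, (hdim U.1).trans hU, (hiso U.1).2 hi, ?_, ?_⟩
      · rw [← mapInv_bot (LinearEquiv.funCongrLeft k k e.symm).toLinearMap hc hm]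
        exact (hcon.positive_iff ⊥ U).2 hp
      · intro W' hW' hUW'
        obtain ⟨W, rfl⟩ := hcon.convex ⊥ ⊤ W' ((mapInv_bot _ hc hm).trans_le bot_le)
          (le_top.trans_eq (mapInv_top _ hc hm).symm)
        exact (congrArg θ (hdim W.1)).trans_le ((hs W ((hiso W.1).1 hW')
          ((hcon.le_iff _ _).1 hUW')).trans_eq (congrArg θ (hdim U.1)).symm)
    · rintro z _ z' _ hzz
      obtain ⟨h₁, h₂⟩ := Prod.mk.inj hzz
      refine Prod.ext (funext fun a => ?_) ?_
      · have := congrArg (fun M => M.submatrix e e) (congrFun h₁ a)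
        simpa using this
      · have := congrArg (fun M => M.submatrix e e) h₂
        simpa using this
  exact le_antisymm (key h) (key h.symm)

/-- Existence and uniqueness of the canonical reduction stratify all self-dual representations by
the dimension vector `d` of `U`. The bound on `H(d)` is the inclusion of `U` in `U^⊥` in dimensions.
-/
theorem ncard_sdMat {θ : Module.Dual ℤ (I → ℤ)} (hθ : σ.Compatible θ) (c : X → I) :
    (sdMat D k c).ncard = ∑ d ∈ Finset.Iic (colorDim c) with ∀ i, σ.hyp d i ≤ colorDim c i,
      (sdStratum D θ k c d).ncard := by
  refine ncard_eq_sum_ncard _ _ (fun z => ?_) ?_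
  · constructor
    · rintro hz
      obtain ⟨U, hi, hp, hs⟩ := exists_sdSemistableAt (m := z.1) (b := z.2) hz θ
      obtain ⟨d, hd, hU⟩ := exists_gdim_eq (c := c) U.1
      refine ⟨d, Finset.mem_filter.2 ⟨Finset.mem_Iic.2 hd, fun i => ?_⟩, hz, U, hU, hi, hp, hs⟩
      have h₁ := gdim_mono (c := c) ((isIsotropic_iff (m := z.1) (b := z.2) hz U).1 hi) i
      have h₂ := hz.2.1.gdim_perp U.2.1 i
      change gdim c U.1 i ≤ gdim c (perpSubspace z.2 U.1) i at h₁
      rw [h₂, hU] at h₁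
      simp only [toLat, FQuiver.Involution.hyp, FQuiver.Involution.act, Pi.add_apply] at h₁ ⊢
      omega
    · rintro ⟨d, -, hz, -⟩
      exact hz
  · rintro z d - d' - ⟨hz, U, hU, hi, hp, hs⟩ ⟨-, U', hU', hi', hp', hs'⟩
    have := sdSemistableAt_unique hθ (m := z.1) (b := z.2) hz hi hp hs hi' hp' hs'
    exact toLat_injective (by rw [← hU, ← hU', this])

end

/-! ### The exponents -/

section

variable {I : Type*} [DecidableEq I] [Fintype I] {A : Type*} [Fintype A] {Q : FQuiver I A}
  {σ : Q.Involution} {X₁ X₂ : Type*} [Fintype X₁] [Fintype X₂]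

theorem colorDim_eq_sum (c : X₁ → I) (i : I) : colorDim c i = ∑ x, if c x = i then 1 else 0 :=
  Finset.card_filter _ _

theorem card_filter_color_eq (f : X₁ → I) (g : X₂ → I) :
    (Finset.univ.filter fun z : X₁ × X₂ => f z.1 = g z.2).card
      = ∑ i, colorDim f i * colorDim g i := by
  simp only [colorDim_eq_sum, Finset.card_filter, Fintype.sum_prod_type, Finset.sum_mul_sum]
  symm
  rw [Finset.sum_comm]
  refine Finset.sum_congr rfl fun x _ => ?_
  rw [Finset.sum_comm]
  refine Finset.sum_congr rfl fun y _ => ?_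
  simp [eq_comm]

theorem card_filter_color_arrow (f : X₁ → I) (g : X₂ → I) (s t : A → I) :
    (Finset.univ.filter fun z : A × X₁ × X₂ => f z.2.1 = t z.1 ∧ g z.2.2 = s z.1).card
      = ∑ a, colorDim f (t a) * colorDim g (s a) := by
  simp only [colorDim_eq_sum, Finset.card_filter, Fintype.sum_prod_type, Finset.sum_mul_sum,
    ite_and, ite_mul, one_mul, zero_mul]

theorem sum_color (c : X₁ → I) (g : I → ℤ) : ∑ x, g (c x) = ∑ i, g i * colorDim c i := by
  simp only [colorDim_eq_sum, Nat.cast_sum, Nat.cast_ite, Nat.cast_one, Nat.cast_zero,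
    Finset.mul_sum, mul_ite, mul_one, mul_zero]
  rw [Finset.sum_comm]
  simp

theorem exists_half {X : Type*} [Finite X] (f : X → X) (hf : Function.Involutive f) :
    ∃ P : Finset X, (∀ x ∈ P, f x ∉ P) ∧ ∀ x, f x ≠ x → x ∈ P ∨ f x ∈ P := by
  classical
  have := Fintype.ofFinite X
  obtain ⟨o⟩ : Nonempty (X ≃ Fin (Fintype.card X)) := ⟨Fintype.equivFin X⟩
  refine ⟨Finset.univ.filter fun x => o x < o (f x), fun x hx hx' => ?_, fun x hx => ?_⟩
  · simp only [Finset.mem_filter, Finset.mem_univ, true_and, hf x] at hx hx'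
    exact lt_asymm hx hx'
  · simp only [Finset.mem_filter, Finset.mem_univ, true_and, hf x]
    rcases lt_trichotomy (o x) (o (f x)) with h | h | h
    · exact Or.inl h
    · exact absurd (o.injective h).symm hx
    · exact Or.inr h

theorem euler_add_left (d d' e : I → ℤ) : Q.euler (d + d') e = Q.euler d e + Q.euler d' e := by
  simp only [FQuiver.euler, Pi.add_apply, add_mul, Finset.sum_add_distrib]
  ring

theorem euler_add_right (d d' e : I → ℤ) : Q.euler e (d + d') = Q.euler e d + Q.euler e d' := by
  simp only [FQuiver.euler, Pi.add_apply, mul_add, Finset.sum_add_distrib]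
  ring

theorem euler_act (d e : I → ℤ) : Q.euler (σ.act d) (σ.act e) = Q.euler e d := by
  simp only [FQuiver.euler, FQuiver.Involution.act]
  congr 1
  · rw [← Equiv.sum_comp σ.node_involutive.toPerm]
    refine Finset.sum_congr rfl fun i _ => ?_
    simp only [Function.Involutive.coe_toPerm, σ.node_involutive i]
    ring
  · rw [← Equiv.sum_comp σ.arrow_involutive.toPerm]
    refine Finset.sum_congr rfl fun a _ => ?_
    simp only [Function.Involutive.coe_toPerm, σ.src_arrow, σ.tgt_arrow, σ.node_involutive (Q.src a),
      σ.node_involutive (Q.tgt a)]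
    ring

variable [DecidableEq A] (D : DualityStructure σ)

/-- Doubling removes the choice of halves of the free orbits: the quadratic part becomes a sum over
all nodes and arrows, and the fixed ones leave linear terms. The quadratic part is then `χ(σ(d),
d)`. -/
theorem two_mul_sdEuler (d : I → ℤ) : 2 * D.sdEuler d =
    ∑ i, d (σ.node i) * d i - ∑ i with σ.node i = i, (D.s i : ℤ) * d i
      - ∑ a, d (σ.node (Q.src a)) * d (Q.tgt a)
      - ∑ a with σ.arrow a = a, ((D.τ a * D.s (Q.tgt a) : ℤˣ) : ℤ) * d (Q.tgt a) := by
  have key : ∀ (x : ℤ) (ε : ℤˣ), 2 * (x * (x + ε) / 2) = x * (x + ε) := by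
    intro x ε
    refine Int.mul_ediv_cancel' ?_
    rcases Int.units_eq_one_or ε with rfl | rfl
    · exact (Int.even_mul_succ_self x).two_dvd
    · have := (Int.even_mul_pred_self x).two_dvd
      simpa [sub_eq_add_neg] using this
  obtain ⟨P₀, h₀, h₀'⟩ := exists_half σ.node σ.node_involutive
  obtain ⟨P₁, h₁, h₁'⟩ := exists_half σ.arrow σ.arrow_involutive
  have e₀ := sum_not_fixed σ.node σ.node_involutive (fun i => d (σ.node i) * d i)
    (fun i => by simp only [σ.node_involutive i]; ring) P₀ h₀ h₀'
  have e₁ := sum_not_fixed σ.arrow σ.arrow_involutive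
    (fun a => d (σ.node (Q.src a)) * d (Q.tgt a))
    (fun a => by simp only [σ.src_arrow, σ.tgt_arrow, σ.node_involutive (Q.tgt a)]; ring) P₁ h₁ h₁'
  have f₀ := Finset.sum_filter_add_sum_filter_not Finset.univ (fun i => σ.node i = i)
    fun i => d (σ.node i) * d i
  have f₁ := Finset.sum_filter_add_sum_filter_not Finset.univ (fun a => σ.arrow a = a)
    fun a => d (σ.node (Q.src a)) * d (Q.tgt a)
  have g₀ : 2 * ∑ i with σ.node i = i, d i * (d i - D.s i) / 2
      = ∑ i with σ.node i = i, d (σ.node i) * d i - ∑ i with σ.node i = i, (D.s i : ℤ) * d i := by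
    rw [Finset.mul_sum, ← Finset.sum_sub_distrib]
    refine Finset.sum_congr rfl fun i hi => ?_
    rw [(Finset.mem_filter.1 hi).2]
    have := key (d i) (-D.s i)
    rw [Units.val_neg, ← sub_eq_add_neg] at this
    rw [this]
    ring
  have g₁ : 2 * ∑ a with σ.arrow a = a, d (Q.tgt a) * (d (Q.tgt a) + D.τ a * D.s (Q.tgt a)) / 2
      = ∑ a with σ.arrow a = a, d (σ.node (Q.src a)) * d (Q.tgt a)
        + ∑ a with σ.arrow a = a, ((D.τ a * D.s (Q.tgt a) : ℤˣ) : ℤ) * d (Q.tgt a) := by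
    rw [Finset.mul_sum, ← Finset.sum_add_distrib]
    refine Finset.sum_congr rfl fun a ha => ?_
    have h₂ := σ.tgt_arrow a
    rw [(Finset.mem_filter.1 ha).2] at h₂
    rw [← h₂, ← Units.val_mul, key]
    ring
  unfold DualityStructure.sdEuler
  rw [e₀, e₁, Int.mul_ediv_cancel_left _ two_ne_zero, Int.mul_ediv_cancel_left _ two_ne_zero]
  simp only [ne_eq] at e₀ e₁
  rw [e₀] at f₀
  rw [e₁] at f₁
  rw [← f₀, ← f₁]
  linear_combination g₀ - g₁

theorem two_mul_sdEuler_eq (d : I → ℤ) : 2 * D.sdEuler d =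
    Q.euler (σ.act d) d - (∑ i with σ.node i = i, (D.s i : ℤ) * d i
      + ∑ a with σ.arrow a = a, ((D.τ a * D.s (Q.tgt a) : ℤˣ) : ℤ) * d (Q.tgt a)) := by
  rw [two_mul_sdEuler, FQuiver.euler]
  simp only [FQuiver.Involution.act]
  ring

theorem act_act (d : I → ℤ) : σ.act (σ.act d) = d := by
  funext i
  simp [FQuiver.Involution.act, σ.node_involutive i]

/-- Polarise `χ(σ(x), x)` for `x = d + σ(d) + n`. The linear parts of `𝓔` cancel, and the cross
terms pair up by `χ(σ(x), σ(y)) = χ(y, x)` and `σ(n) = n`. -/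
theorem sdEuler_hyp_add {d n : I → ℤ} (hn : σ.act n = n) : D.sdEuler (d + σ.act d + n) =
    D.sdEuler n + D.sdEuler d + D.sdEuler (σ.act d) + Q.euler d d + Q.euler d n + Q.euler n d := by
  have hact : ∀ x y : I → ℤ, σ.act (x + y) = σ.act x + σ.act y := fun _ _ => rfl
  have h₁ := two_mul_sdEuler_eq D (d + σ.act d + n)
  have h₂ := two_mul_sdEuler_eq D n
  have h₃ := two_mul_sdEuler_eq D d
  have h₄ := two_mul_sdEuler_eq D (σ.act d)
  have h₅ := euler_act (σ := σ) d n
  have h₆ := euler_act (σ := σ) n d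
  have h₇ := euler_act (σ := σ) d d
  rw [hn] at h₂ h₅ h₆
  rw [act_act] at h₄
  rw [hact, hact, hn, act_act] at h₁
  simp only [euler_add_left, euler_add_right] at h₁
  simp only [Pi.add_apply, mul_add, Finset.sum_add_distrib] at h₁
  refine mul_left_cancel₀ (two_ne_zero (α := ℤ)) ?_
  linear_combination h₁ - h₂ - h₃ - h₄ + h₅ + h₆ + h₇

variable [DecidableEq X₁]

/-- The meaning of `𝓔` in the count: it is the dimension of the corners of the group minus that of
the corners of the representations. A diagonal position contributes the sign of its node or fixed
arrow, which accounts for the linear terms of `𝓔`. -/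
theorem sdEuler_eq_of_corner {c₁ : X₁ → I} {n₀ n₁ : ℕ}
    (h₀ : (2 * n₀ : ℤ) = ((Finset.univ.filter fun z : X₁ × X₁ => c₁ z.1 = σ.node (c₁ z.2)).card : ℤ)
      + ∑ z : X₁ × X₁ with c₁ z.1 = σ.node (c₁ z.2) ∧ z.swap = z, ((-D.s (c₁ z.1) : ℤˣ) : ℤ))
    (h₁ : (2 * n₁ : ℤ) = ((Finset.univ.filter fun z : A × X₁ × X₁ => c₁ z.2.1 = Q.tgt z.1 ∧
        σ.node (c₁ z.2.2) = Q.src z.1).card : ℤ)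
      + ∑ z : A × X₁ × X₁ with (c₁ z.2.1 = Q.tgt z.1 ∧ σ.node (c₁ z.2.2) = Q.src z.1) ∧
        (σ.arrow z.1, z.2.2, z.2.1) = z, ((D.τ z.1 * D.s (c₁ z.2.1) : ℤˣ) : ℤ)) :
    D.sdEuler (toLat (colorDim c₁)) = n₀ - n₁ := by
  have e₀ := card_filter_color_eq c₁ fun x => σ.node (c₁ x)
  have e₁ := card_filter_color_arrow c₁ (fun x => σ.node (c₁ x)) Q.src Q.tgt
  have e₂ : ∑ z : X₁ × X₁ with c₁ z.1 = σ.node (c₁ z.2) ∧ z.swap = z, ((-D.s (c₁ z.1) : ℤˣ) : ℤ)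
      = - ∑ i with σ.node i = i, (D.s i : ℤ) * toLat (colorDim c₁) i := by
    rw [Finset.sum_filter, Fintype.sum_prod_type, Finset.sum_filter, ← Finset.sum_neg_distrib]
    have := sum_color c₁ fun i => if σ.node i = i then -(D.s i : ℤ) else 0
    simp only [ite_mul, zero_mul] at this
    calc _ = ∑ x, if σ.node (c₁ x) = c₁ x then -(D.s (c₁ x) : ℤ) else 0 := by
          refine Finset.sum_congr rfl fun x _ => ?_
          rw [Finset.sum_eq_single x]
          · simp [eq_comm]
          · intro y _ hy
            rw [if_neg]
            rintro ⟨-, h⟩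
            exact hy (Prod.mk.inj h).1
          · simp
      _ = _ := by
          rw [this]
          refine Finset.sum_congr rfl fun i _ => ?_
          split_ifs <;> simp [toLat]
  have e₃ : ∑ z : A × X₁ × X₁ with (c₁ z.2.1 = Q.tgt z.1 ∧ σ.node (c₁ z.2.2) = Q.src z.1) ∧
        (σ.arrow z.1, z.2.2, z.2.1) = z, ((D.τ z.1 * D.s (c₁ z.2.1) : ℤˣ) : ℤ)
      = ∑ a with σ.arrow a = a, ((D.τ a * D.s (Q.tgt a) : ℤˣ) : ℤ) * toLat (colorDim c₁) (Q.tgt a) := by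
    rw [Finset.sum_filter, Fintype.sum_prod_type, Finset.sum_filter]
    refine Finset.sum_congr rfl fun a _ => ?_
    rw [Fintype.sum_prod_type]
    by_cases ha : σ.arrow a = a
    · have h₂ := σ.src_arrow a
      rw [ha] at h₂
      rw [if_pos ha, toLat, colorDim_eq_sum, Nat.cast_sum, Finset.mul_sum]
      refine Finset.sum_congr rfl fun x _ => ?_
      rw [Finset.sum_eq_single x]
      · by_cases hx : c₁ x = Q.tgt a
        · simp [hx, ha, h₂]
        · simp [hx]
      · intro y _ hy
        rw [if_neg]
        rintro ⟨-, h⟩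
        exact hy (Prod.mk.inj (Prod.mk.inj h).2).1
      · simp
    · rw [if_neg ha]
      refine Finset.sum_eq_zero fun x _ => Finset.sum_eq_zero fun y _ => if_neg ?_
      rintro ⟨-, h⟩
      exact ha (Prod.mk.inj h).1
  have e₄ := two_mul_sdEuler D (toLat (colorDim c₁))
  rw [e₂, e₀] at h₀
  rw [e₃, e₁] at h₁
  simp only [colorDim_node, FQuiver.Involution.act] at h₀ h₁
  push_cast at h₀ h₁
  refine mul_left_cancel₀ (two_ne_zero (α := ℤ)) ?_
  rw [e₄, mul_sub, h₀, h₁]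
  simp only [toLat]
  push_cast
  simp only [mul_comm]
  ring

end

/-! ### Products of series -/

theorem sqrtq_sq (k : Type u₁) : sqrtq k ^ 2 = (Nat.card k : QField k) := by
  refine Subtype.ext ?_
  change (sqrtq k : ℝ) ^ 2 = ((Nat.card k : QField k) : ℝ)
  rw [sqrtq, IntermediateField.AdjoinSimple.coe_gen, Real.sq_sqrt (Nat.cast_nonneg _)]
  exact (map_natCast (algebraMap (QField k) ℝ) _).symm

theorem card_field_ne_zero (k : Type u₁) [Field k] [Finite k] : (Nat.card k : QField k) ≠ 0 := by
  exact_mod_cast Nat.card_pos.ne'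

theorem sqrtq_ne_zero (k : Type u₁) [Field k] [Finite k] : sqrtq k ≠ 0 := fun h =>
  card_field_ne_zero k (by rw [← sqrtq_sq, h]; ring)

theorem card_pow_eq (k : Type u₁) [Field k] [Finite k] (n : ℕ) :
    (Nat.card k : QField k) ^ n = sqrtq k ^ (2 * n : ℤ) := by
  rw [← sqrtq_sq, ← pow_mul, ← zpow_natCast]
  push_cast
  rfl

section

variable {I : Type u₂} [DecidableEq I] [Fintype I] {A : Type*} [Fintype A] {Q : FQuiver I A}
  {σ : Q.Involution} {k : Type u₁} [Field k] [Finite k]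

/-- The colours of the standard coordinate space of given dimension vector. -/
def stdColor (d : I → ℕ) : (Σ i, Fin (d i)) → I := Sigma.fst

theorem colorDim_stdColor (d : I → ℕ) : colorDim (stdColor d) = d := by
  funext i
  rw [colorDim, ← Fintype.card_subtype]
  refine (Fintype.card_congr ?_).trans (Fintype.card_fin (d i))
  exact Equiv.sigmaFiberEquiv (Sigma.fst : (Σ i, Fin (d i)) → I) |> fun _ =>
    ⟨fun x => x.2 ▸ x.1.2, fun x => ⟨⟨i, x⟩, rfl⟩, by rintro ⟨⟨j, x⟩, rfl⟩; rfl, fun x => rfl⟩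

theorem card_GL_ne_zero (d : I → ℕ) : (Nat.card (gradedGL k (stdColor d)) : QField k) ≠ 0 := by
  exact_mod_cast Nat.card_pos.ne'

variable (θ : Module.Dual ℤ (I → ℤ))

variable (Q k) in
/-- The normalised number of representations with the given property. -/
def repMass (P : IntervalPredicate.{max u₁ u₂}) (d : I → ℕ) : QField k :=
  ((repSet Q P θ k (stdColor d)).ncard : QField k) / Nat.card (gradedGL k (stdColor d))

/-- The free corner of the matrices and the unipotent radical leave `q^{-χ(b, a)}`, where `a` is the
subrepresentation and `b` the quotient. The factor 2 appears because exponents refer to `q^{1/2}`.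
-/
theorem repStratum_mass {μ : ℚ} {l : List ℚ} (hl : ∀ ν ∈ l, ν < μ) {d a : I → ℕ} (ha : a ≤ d) :
    ((repStratum Q (IntervalPredicate.semistable μ) (IntervalPredicate.hn l) θ k (stdColor d)
      a).ncard : QField k) / Nat.card (gradedGL k (stdColor d))
      = repMass Q k θ (IntervalPredicate.semistable μ) a * repMass Q k θ (IntervalPredicate.hn l)
        (d - a) * sqrtq k ^ (-2 * Q.euler (toLat (d - a)) (toLat a)) := by
  obtain ⟨b, rfl⟩ : ∃ b, d = a + b := ⟨d - a, (add_tsub_cancel_of_le ha).symm⟩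
  rw [add_tsub_cancel_left]
  have hc : colorDim (stdColor (a + b)) = colorDim (Sum.elim (stdColor a) (stdColor b)) := by
    rw [colorDim_sum, colorDim_stdColor, colorDim_stdColor, colorDim_stdColor]
  rw [ncard_repStratum_congr Q _ _ θ hc, card_gradedGL_congr hc]
  have hall := hall_count (k := k) Q (IntervalPredicate.semistable μ) (IntervalPredicate.hn l) θ
    (stdColor a) (stdColor b) fun m W W' h₁ h₂ h₃ h₄ => HNInterval.unique (isSlopeData θ) hl h₁ h₂ h₃ h₄
  rw [card_filter_color_eq, card_filter_color_arrow (stdColor a) (stdColor b) Q.src Q.tgt,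
    colorDim_stdColor, colorDim_stdColor] at hall
  have hall' := congrArg (Nat.cast : ℕ → QField k) hall
  simp only [Nat.cast_mul, Nat.cast_pow] at hall'
  rw [card_pow_eq, card_pow_eq] at hall'
  have e : -2 * Q.euler (toLat b) (toLat a) = 2 * ((∑ x, a (Q.tgt x) * b (Q.src x) : ℕ) : ℤ)
      - 2 * ((∑ i, a i * b i : ℕ) : ℤ) := by
    simp only [FQuiver.euler, toLat]
    push_cast
    simp only [mul_comm]
    ring
  rw [e, zpow_sub₀ (sqrtq_ne_zero k)]
  have h₁ := card_GL_ne_zero (k := k) a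
  have h₂ := card_GL_ne_zero (k := k) b
  have h₃ : (Nat.card (gradedGL k (Sum.elim (stdColor a) (stdColor b))) : QField k) ≠ 0 := by
    rw [← card_gradedGL_congr hc]
    exact card_GL_ne_zero _
  have h₄ := zpow_ne_zero (2 * ((∑ i, a i * b i : ℕ) : ℤ)) (sqrtq_ne_zero k)
  unfold repMass
  rw [div_mul_div_comm, div_mul_div_comm, div_eq_div_iff h₃ (mul_ne_zero (mul_ne_zero h₁ h₂) h₄)]
  unfold repStratum
  linear_combination hall'

theorem repMass_hn_cons {μ : ℚ} {l : List ℚ} (hl : ∀ ν ∈ l, ν < μ) (d : I → ℕ) :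
    repMass Q k θ (IntervalPredicate.hn (μ :: l)) d = ∑ a ∈ Finset.Iic d,
      repMass Q k θ (IntervalPredicate.semistable μ) a * repMass Q k θ (IntervalPredicate.hn l)
        (d - a) * sqrtq k ^ (-2 * Q.euler (toLat (d - a)) (toLat a)) := by
  rw [repMass, ncard_repSet_hn_cons Q θ (stdColor d) hl, colorDim_stdColor, Nat.cast_sum,
    Finset.sum_div]
  exact Finset.sum_congr rfl fun a ha => repStratum_mass θ hl (Finset.mem_Iic.1 ha)

theorem repMass_hn_nil (d : I → ℕ) :
    repMass Q k θ (IntervalPredicate.hn []) d = if d = 0 then 1 else 0 := by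
  split_ifs with hd
  · subst hd
    have h₁ : repSet Q (IntervalPredicate.hn []) θ k (stdColor (0 : I → ℕ)) = Set.univ := by
      ext m
      refine ⟨fun _ => trivial, fun _ => ⟨fun a x => x.2.elim0, ?_⟩⟩
      refine Subtype.ext (Submodule.ext fun v => ⟨fun _ => trivial, fun _ => ?_⟩)
      exact (Submodule.mem_bot k).2 (funext fun x => x.2.elim0)
    have : IsEmpty (Σ i, Fin ((0 : I → ℕ) i)) := ⟨fun x => x.2.elim0⟩
    have h₂ : Nat.card (gradedGL k (stdColor (0 : I → ℕ))) = 1 := by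
      have : Subsingleton (gradedGL k (stdColor (0 : I → ℕ))) :=
        ⟨fun g h => Subtype.ext (Units.ext (Subsingleton.elim _ _))⟩
      exact Nat.card_of_subsingleton 1
    have h₃ : (Set.univ : Set (A → Matrix (Σ i, Fin ((0 : I → ℕ) i)) (Σ i, Fin ((0 : I → ℕ) i)) k)).ncard
        = 1 := by
      rw [Set.ncard_univ]
      exact Nat.card_of_subsingleton 0
    rw [repMass, h₁, h₂, h₃, Nat.cast_one, div_one]
  · have h₁ : repSet Q (IntervalPredicate.hn []) θ k (stdColor d) = ∅ := by
      refine Set.eq_empty_of_forall_notMem ?_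
      rintro m ⟨-, h⟩
      refine hd ?_
      have h₂ := gdim_top (k := k) (stdColor d)
      have h₃ : (⊤ : Submodule k ((Σ i, Fin (d i)) → k)) = ⊥ := (congrArg Subtype.val h).symm
      rw [h₃, gdim_bot, colorDim_stdColor] at h₂
      exact (toLat_injective (h₂.trans rfl : toLat 0 = toLat d)).symm
    rw [repMass, h₁]
    simp

/-- The normalisation by `q^{χ(d,d)/2}` turns the recursion for filtrations into the product of the
quantum torus. -/
theorem list_prod_apply {F : ℚ → QTorus Q k} (hF : ∀ μ d, F μ d =
      sqrtq k ^ Q.euler (toLat d) (toLat d) * repMass Q k θ (IntervalPredicate.semistable μ) d)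
    {l : List ℚ} (hl : l.Pairwise (· > ·)) (d : I → ℕ) : (l.map F).prod d =
      sqrtq k ^ Q.euler (toLat d) (toLat d) * repMass Q k θ (IntervalPredicate.hn l) d := by
  induction l generalizing d with
  | nil =>
    rw [repMass_hn_nil]
    change (if d = 0 then (1 : QField k) else 0) = _
    split_ifs with hd
    · subst hd
      have : Q.euler (toLat 0) (toLat 0) = 0 := by simp [FQuiver.euler, toLat]
      rw [this, zpow_zero, one_mul]
    · rw [mul_zero]
  | cons μ l ih =>
    obtain ⟨h₁, h₂⟩ := List.pairwise_cons.1 hl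
    rw [repMass_hn_cons θ fun ν hν => h₁ ν hν, Finset.mul_sum, List.map_cons, List.prod_cons]
    refine Finset.sum_congr rfl fun a ha => ?_
    rw [hF, ih h₂]
    have e : toLat d = toLat a + toLat (d - a) := by
      funext i
      have : a i ≤ d i := Finset.mem_Iic.1 ha i
      simp only [toLat, Pi.add_apply, Pi.sub_apply]
      omega
    -- With `b = d - a`, the term `-2χ(b, a)` skew-symmetrises the cross terms of `χ(a + b, a + b)`.
    have e' : Q.euler (toLat d) (toLat d) + -2 * Q.euler (toLat (d - a)) (toLat a)
        = Q.skew (toLat a) (toLat (d - a)) + Q.euler (toLat a) (toLat a)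
          + Q.euler (toLat (d - a)) (toLat (d - a)) := by
      rw [e]
      simp only [euler_add_left, euler_add_right, FQuiver.skew]
      ring
    have e'' := congrArg (fun n => sqrtq k ^ n) e'
    simp only [zpow_add₀ (sqrtq_ne_zero k)] at e''
    linear_combination (-(repMass Q k θ (IntervalPredicate.semistable μ) a *
      repMass Q k θ (IntervalPredicate.hn l) (d - a))) * e''

theorem isSlopeProduct_positive {F : ℚ → QTorus Q k} (hF : ∀ μ d, F μ d =
      sqrtq k ^ Q.euler (toLat d) (toLat d) * repMass Q k θ (IntervalPredicate.semistable μ) d) :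
    IsSlopeProduct (fun μ : {μ : ℚ // 0 < μ} => F μ.1)
      fun d => sqrtq k ^ Q.euler (toLat d) (toLat d) * repMass Q k θ IntervalPredicate.positive d := by
  intro d
  -- From the positive slopes of the finitely many dimension vectors below `d` onwards, the
  -- coefficient at `d` is constant.
  let F₀ : Finset {μ : ℚ // 0 < μ} := ((Finset.Iic d).image (slope θ)).subtype fun μ => 0 < μ
  refine Filter.eventually_atTop.2 ⟨F₀, fun S hS => ?_⟩
  have hmap : (S.sort (· ≥ ·)).map (fun μ : {μ : ℚ // 0 < μ} => F μ.1)
      = ((S.sort (· ≥ ·)).map Subtype.val).map F := by rw [List.map_map]; rfl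
  have hl : ((S.sort (· ≥ ·)).map Subtype.val).Pairwise (· > ·) := by
    rw [List.pairwise_map]
    exact S.sortedGT_sort.pairwise
  rw [hmap, list_prod_apply θ hF hl]
  congr 1
  rw [repMass, repMass, repSet_hn_eq_positive Q θ (stdColor d) hl]
  · intro μ hμ
    obtain ⟨ν, -, rfl⟩ := List.mem_map.1 hμ
    exact ν.2
  · intro a ha _ hpos
    rw [colorDim_stdColor] at ha
    refine List.mem_map.2 ⟨⟨slope θ a, hpos⟩, (Finset.mem_sort _).2 (hS ?_), rfl⟩
    exact Finset.mem_subtype.2 (Finset.mem_image_of_mem _ (Finset.mem_Iic.2 ha))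

/-! ### The action on the self-dual series. -/

variable [DecidableEq A] (D : DualityStructure σ)

variable (k) in
/-- The normalised number of semistable self-dual representations. -/
def sdMass (d : I → ℕ) : QField k :=
  ((sdSet D θ k (stdColor d)).ncard : QField k) / Nat.card (gradedGL k (stdColor d))

/-- The components between `U*` and `N` contribute `χ(σ(d), n) = χ(n, d)` to the exponent, and the
corners `U* → U` contribute `𝓔(d)`. -/
theorem sdStratum_mass (h2 : (2 : k) ≠ 0) (hθ : σ.Compatible θ) {d n : I → ℕ} (hn : σ.act n = n) :
    ((sdStratum D θ k (stdColor (σ.hyp d + n)) d).ncard : QField k) /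
      Nat.card (gradedGL k (stdColor (σ.hyp d + n)))
      = repMass Q k θ IntervalPredicate.positive d * sdMass k θ D n
        * sqrtq k ^ (-2 * (D.sdEuler (toLat d) + Q.euler (toLat n) (toLat d))) := by
  have hc : colorDim (stdColor (σ.hyp d + n)) = colorDim (sdColor σ (stdColor d) (stdColor n)) := by
    rw [colorDim_sum, colorDim_sum, colorDim_node, colorDim_stdColor, colorDim_stdColor,
      colorDim_stdColor, FQuiver.Involution.hyp]
    abel
  rw [ncard_sdStratum_congr D θ hc, card_gradedGL_congr hc]
  have hall := sd_count (D := D) h2 hθ (stdColor d) (stdColor n)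
  obtain ⟨n₀, hn₀, hn₀'⟩ := ncard_cornerGL D h2 (stdColor d)
  obtain ⟨n₁, hn₁, hn₁'⟩ := ncard_cornerRep D h2 (stdColor d)
  have hE := sdEuler_eq_of_corner D hn₀ hn₁
  rw [colorDim_stdColor] at hE
  rw [hn₀', hn₁', card_filter_color_eq (stdColor n) fun x => σ.node (stdColor d x),
    card_filter_color_arrow (stdColor n) (fun x => σ.node (stdColor d x)) Q.src Q.tgt,
    colorDim_node, colorDim_stdColor, colorDim_stdColor] at hall
  have hall' := congrArg (Nat.cast : ℕ → QField k) hall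
  simp only [Nat.cast_mul, Nat.cast_pow] at hall'
  rw [card_pow_eq, card_pow_eq, card_pow_eq, card_pow_eq] at hall'
  have e : -2 * (D.sdEuler (toLat d) + Q.euler (toLat n) (toLat d))
      = (2 * ((∑ x, n (Q.tgt x) * σ.act d (Q.src x) : ℕ) : ℤ) + 2 * n₁)
        - (2 * ((∑ i, n i * σ.act d i : ℕ) : ℤ) + 2 * n₀) := by
    have hn' : σ.act (toLat n) = toLat n := funext fun i => congrArg Nat.cast (congrFun hn i)
    rw [hE, ← euler_act (σ := σ), hn']
    simp only [FQuiver.euler, toLat, FQuiver.Involution.act]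
    push_cast
    simp only [mul_comm]
    ring
  rw [e, zpow_sub₀ (sqrtq_ne_zero k), zpow_add₀ (sqrtq_ne_zero k), zpow_add₀ (sqrtq_ne_zero k)]
  have h₁ := card_GL_ne_zero (k := k) d
  have h₂ := card_GL_ne_zero (k := k) n
  have h₃ : (Nat.card (gradedGL k (sdColor σ (stdColor d) (stdColor n))) : QField k) ≠ 0 := by
    rw [← card_gradedGL_congr hc]
    exact card_GL_ne_zero _
  have h₄ := mul_ne_zero (zpow_ne_zero (2 * ((∑ i, n i * σ.act d i : ℕ) : ℤ)) (sqrtq_ne_zero k))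
    (zpow_ne_zero (2 * (n₀ : ℤ)) (sqrtq_ne_zero k))
  unfold repMass sdMass
  rw [div_mul_div_comm, div_mul_div_comm, div_eq_div_iff h₃ (mul_ne_zero (mul_ne_zero h₁ h₂) h₄)]
  unfold sdStratum
  linear_combination hall'

/-- The right-hand side no longer contains `θ`. The powers of `q` agree by `sdEuler_hyp_add`, in
which `χ(d, n) - χ(n, d)` is the twist of the action. -/
theorem smul_eq_total (h2 : (2 : k) ≠ 0) (hθ : σ.Compatible θ) {P : QTorus Q k} {S : QModule D k}
    (hP : ∀ d, P d = sqrtq k ^ Q.euler (toLat d) (toLat d) *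
      repMass Q k θ IntervalPredicate.positive d)
    (hS : ∀ e : σ.InvDim, S e = sqrtq k ^ D.sdEuler (toLat e.1) * sdMass k θ D e.1) (e : σ.InvDim) :
    (P • S) e = sqrtq k ^ D.sdEuler (toLat e.1) *
      (((sdMat D k (stdColor e.1)).ncard : QField k) / Nat.card (gradedGL k (stdColor e.1))) := by
  rw [ncard_sdMat D hθ (stdColor e.1), colorDim_stdColor, Nat.cast_sum, Finset.sum_div,
    Finset.mul_sum]
  refine Finset.sum_congr rfl fun d hd => ?_
  obtain ⟨n, hn⟩ : ∃ n, n = e.subHyp d := ⟨_, rfl⟩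
  rw [← hn]
  have he : e.1 = σ.hyp d + n.1 := by
    rw [hn]
    exact (add_tsub_cancel_of_le (Finset.mem_filter.1 hd).2).symm
  rw [he, sdStratum_mass θ D h2 hθ n.2]
  rw [hP, hS]
  have hn' : σ.act (toLat n.1) = toLat n.1 := funext fun i => congrArg Nat.cast (congrFun n.2 i)
  have h₁ : toLat (σ.hyp d + n.1) = toLat d + σ.act (toLat d) + toLat n.1 := by
    funext i
    simp [toLat, FQuiver.Involution.hyp, FQuiver.Involution.act]
  have h₂ : D.sdEuler (toLat (σ.hyp d + n.1))
      + -2 * (D.sdEuler (toLat d) + Q.euler (toLat n.1) (toLat d))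
      = Q.skew (toLat d) (toLat n.1) + D.sdEuler (σ.act (toLat d)) - D.sdEuler (toLat d)
        + Q.euler (toLat d) (toLat d) + D.sdEuler (toLat n.1) := by
    rw [h₁, sdEuler_hyp_add D hn', FQuiver.skew]
    ring
  have h₃ := congrArg (fun n => sqrtq k ^ n) h₂
  simp only [zpow_add₀ (sqrtq_ne_zero k), zpow_sub₀ (sqrtq_ne_zero k)] at h₃ ⊢
  linear_combination (-(repMass Q k θ IntervalPredicate.positive d * sdMass k θ D n.1)) * h₃

end

/-! ### Sums over isomorphism classes -/

/-- The hypothesis `h` is the orbit-stabiliser formula for the coordinate models of an object. As `G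
≠ 0`, it also says that every class with property `P` has a coordinate model, so that only finitely
many classes contribute. -/
theorem finsum_quotient_eq {Obj : Type*} {st : Setoid Obj} {S : Type*} [Finite S] (obj : S → Obj)
    (aut : Obj → ℕ) {P : Obj → Prop} (hP : ∀ U V, st.r U V → P U → P V) {G : ℕ} (hG : G ≠ 0)
    (h : ∀ U, P U → {s | st.r (obj s) U}.ncard * aut U = G) {K : Type*} [Field K] [CharZero K]
    (x : K) : ∑ᶠ (c : Quotient st) (_ : P c.out), x / (aut c.out : K)
      = x * (({s | P (obj s)}.ncard : K) / G) := by
  classical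
  have := Fintype.ofFinite S
  have hout : ∀ s, st.r (obj s) (Quotient.mk st (obj s)).out := fun s =>
    Setoid.symm (Quotient.mk_out (obj s))
  obtain ⟨T, hT⟩ : ∃ T, T = Finset.univ.filter fun s => P (obj s) := ⟨_, rfl⟩
  obtain ⟨C, hC⟩ : ∃ C, C = T.image fun s => Quotient.mk st (obj s) := ⟨_, rfl⟩
  have hmem : ∀ c : Quotient st, P c.out ↔ c ∈ C := by
    intro c
    rw [hC, Finset.mem_image]
    constructor
    · intro hc
      have h₁ : {s | st.r (obj s) c.out}.Nonempty := by
        rw [Set.nonempty_iff_ne_empty]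
        intro e
        have := h _ hc
        rw [e, Set.ncard_empty, zero_mul] at this
        exact hG this.symm
      obtain ⟨s, hs⟩ := h₁
      refine ⟨s, ?_, ?_⟩
      · rw [hT, Finset.mem_filter]
        exact ⟨Finset.mem_univ _, hP _ _ (st.symm hs) hc⟩
      · rw [← Quotient.out_eq c]
        exact Quotient.sound hs
    · rintro ⟨s, hs, rfl⟩
      rw [hT, Finset.mem_filter] at hs
      exact hP _ _ (hout s) hs.2
  simp only [hmem]
  rw [finsum_mem_finset_eq_sum, Set.ncard_eq_toFinset_card', Set.toFinset_ofPred, ← hT,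
    Finset.card_eq_sum_card_image (fun s => Quotient.mk st (obj s)) T, ← hC, Nat.cast_sum,
    Finset.sum_div, Finset.mul_sum]
  refine Finset.sum_congr rfl fun c hc => ?_
  have hc' := (hmem c).2 hc
  have h₁ : {s | st.r (obj s) c.out}.ncard = (T.filter fun s => Quotient.mk st (obj s) = c).card := by
    rw [← Set.ncard_coe_finset]
    congr 1
    ext s
    rw [Finset.mem_coe, Finset.mem_filter, hT, Finset.mem_filter]
    constructor
    · intro hs
      refine ⟨⟨Finset.mem_univ _, hP _ _ (st.symm hs) hc'⟩, ?_⟩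
      conv_rhs => rw [← Quotient.out_eq c]
      exact Quotient.sound hs
    · rintro ⟨-, rfl⟩
      exact hout s
  have h₂ := h _ hc'
  rw [h₁] at h₂
  have h₃ : (aut c.out : K) ≠ 0 := by
    intro e
    rw [Nat.cast_eq_zero] at e
    rw [e, mul_zero] at h₂
    exact hG h₂.symm
  have h₄ : (G : K) ≠ 0 := Nat.cast_ne_zero.2 hG
  rw [← mul_div_assoc, div_eq_div_iff h₃ h₄, mul_assoc, ← h₂, Nat.cast_mul]

/-- Used with `F s` the isomorphisms from a fixed object to the model `s`: whenever there are any,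
their number is that of the automorphisms. -/
theorem ncard_mul_card {S : Type*} [Finite S] {F : S → Type*} [∀ s, Finite (F s)] {R : S → Prop}
    (hR : ∀ s, R s ↔ Nonempty (F s)) {n : ℕ} (hn : ∀ s, Nonempty (F s) → Nat.card (F s) = n) :
    {s | R s}.ncard * n = Nat.card (Σ s, F s) := by
  classical
  have := Fintype.ofFinite S
  rw [Nat.card_sigma, Set.ncard_eq_toFinset_card', Set.toFinset_ofPred, ← smul_eq_mul,
    ← Finset.sum_const, Finset.sum_filter]
  refine Finset.sum_congr rfl fun s _ => ?_
  split_ifs with hs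
  · exact (hn s ((hR s).1 hs)).symm
  · have : IsEmpty (F s) := not_nonempty_iff.1 fun h => hs ((hR s).2 h)
    exact (Nat.card_of_isEmpty).symm

/-! ### Coordinates -/

section

variable {I : Type u₂} [DecidableEq I] [Fintype I] {A : Type*} {Q : FQuiver I A}
  {k : Type u₁} [Field k] {d : I → ℕ}

/-- The homogeneous vectors of a given colour. -/
def colorIncl (k : Type u₁) [Field k] (d : I → ℕ) (i : I) :
    (Fin (d i) → k) →ₗ[k] ((Σ i, Fin (d i)) → k) where
  toFun v x := if h : x.1 = i then v (h ▸ x.2) else 0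
  map_add' v w := by ext x; by_cases h : x.1 = i <;> simp [h]
  map_smul' r v := by ext x; by_cases h : x.1 = i <;> simp [h]

/-- The coordinates of a given colour. -/
def colorRes (k : Type u₁) [Field k] (d : I → ℕ) (i : I) :
    ((Σ i, Fin (d i)) → k) →ₗ[k] (Fin (d i) → k) where
  toFun v x := v ⟨i, x⟩
  map_add' _ _ := rfl
  map_smul' _ _ := rfl

theorem colorRes_apply (i : I) (v : (Σ i, Fin (d i)) → k) (x : Fin (d i)) :
    colorRes k d i v x = v ⟨i, x⟩ := rfl

theorem colorRes_colorIncl (i : I) (v : Fin (d i) → k) : colorRes k d i (colorIncl k d i v) = v := by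
  ext x
  exact dif_pos rfl

theorem colorRes_colorIncl_ne {i j : I} (h : i ≠ j) (v : Fin (d i) → k) :
    colorRes k d j (colorIncl k d i v) = 0 := by
  ext x
  exact dif_neg fun e => h e.symm

theorem colorIncl_colorRes (i : I) (v : (Σ i, Fin (d i)) → k) :
    colorIncl k d i (colorRes k d i v) = colorProj k (stdColor d) i v := by
  ext ⟨j, x⟩
  by_cases h : j = i
  · subst h
    exact (dif_pos rfl).trans (if_pos rfl).symm
  · exact (dif_neg h).trans (if_neg h).symm

theorem colorProj_colorIncl (i : I) (v : Fin (d i) → k) :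
    colorProj k (stdColor d) i (colorIncl k d i v) = colorIncl k d i v := by
  rw [← colorIncl_colorRes, colorRes_colorIncl]

theorem colorRes_colorProj (i j : I) (v : (Σ i, Fin (d i)) → k) :
    colorRes k d i (colorProj k (stdColor d) j v) = if j = i then colorRes k d i v else 0 := by
  rw [← colorIncl_colorRes]
  split_ifs with h
  · subst h
    rw [colorRes_colorIncl]
  · rw [colorRes_colorIncl_ne h]

theorem colorIncl_injective (i : I) : Function.Injective (colorIncl k d i) :=
  Function.LeftInverse.injective (colorRes_colorIncl i)

theorem ext_colorRes {v w : (Σ i, Fin (d i)) → k} (h : ∀ i, colorRes k d i v = colorRes k d i w) :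
    v = w := by
  ext ⟨i, x⟩
  exact congrFun (h i) x

/-- The sum of a family of subspaces of the homogeneous parts. -/
def totalSub (W : ∀ i, Submodule k (Fin (d i) → k)) : Submodule k ((Σ i, Fin (d i)) → k) :=
  ⨅ i, (W i).comap (colorRes k d i)

theorem mem_totalSub {W : ∀ i, Submodule k (Fin (d i) → k)} {v : (Σ i, Fin (d i)) → k} :
    v ∈ totalSub W ↔ ∀ i, colorRes k d i v ∈ W i := by
  simp [totalSub, Submodule.mem_iInf]

theorem totalSub_graded (W : ∀ i, Submodule k (Fin (d i) → k)) :
    IsGradedSubspace (stdColor d) (totalSub W) := by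
  intro i v hv
  rw [mem_totalSub] at hv ⊢
  intro j
  rw [colorRes_colorProj]
  split_ifs
  · exact hv j
  · exact (W j).zero_mem

theorem colorIncl_mem_totalSub {W : ∀ i, Submodule k (Fin (d i) → k)} {i : I} {v : Fin (d i) → k} :
    colorIncl k d i v ∈ totalSub W ↔ v ∈ W i := by
  rw [mem_totalSub]
  constructor
  · intro h
    have := h i
    rwa [colorRes_colorIncl] at this
  · intro h j
    by_cases hij : i = j
    · subst hij
      rwa [colorRes_colorIncl]
    · rw [colorRes_colorIncl_ne hij]
      exact (W j).zero_mem

theorem exists_totalSub_eq {Z : Submodule k ((Σ i, Fin (d i)) → k)}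
    (hZ : IsGradedSubspace (stdColor d) Z) : ∃ W, totalSub W = Z := by
  refine ⟨fun i => Z.comap (colorIncl k d i), ?_⟩
  ext v
  rw [mem_totalSub]
  simp only [Submodule.mem_comap, colorIncl_colorRes]
  refine ⟨fun h => ?_, fun h i => hZ i v h⟩
  rw [← sum_colorProj (stdColor d) v]
  exact Submodule.sum_mem _ fun i _ => h i

theorem gdim_totalSub (W : ∀ i, Submodule k (Fin (d i) → k)) :
    gdim (stdColor d) (totalSub W) = toLat fun i => Module.finrank k (W i) := by
  funext i
  have h : (totalSub W).map (colorProj k (stdColor d) i) = (W i).map (colorIncl k d i) := by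
    apply le_antisymm
    · rintro _ ⟨v, hv, rfl⟩
      rw [← colorIncl_colorRes]
      exact ⟨_, mem_totalSub.1 hv i, rfl⟩
    · rintro _ ⟨v, hv, rfl⟩
      exact ⟨_, colorIncl_mem_totalSub.2 hv, colorProj_colorIncl i v⟩
  rw [gdim, h, ← (Submodule.equivMapOfInjective _ (colorIncl_injective i) (W i)).finrank_eq]
  rfl

/-! ### Frames -/

/-- Frames are compared with one fixed frame `f`; the resulting families of automorphisms of the
homogeneous parts are the homogeneous automorphisms of the coordinate space. -/
theorem card_frames [Finite k] {V : I → Type*} [∀ i, AddCommGroup (V i)] [∀ i, Module k (V i)]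
    [∀ i, FiniteDimensional k (V i)] (hV : ∀ i, Module.finrank k (V i) = d i) :
    Nat.card (∀ i, V i ≃ₗ[k] (Fin (d i) → k)) = Nat.card (gradedGL k (stdColor d)) := by
  have f : ∀ i, V i ≃ₗ[k] (Fin (d i) → k) := fun i =>
    LinearEquiv.ofFinrankEq _ _ (by rw [hV, Module.finrank_fin_fun])
  let Ψ : (∀ i, V i ≃ₗ[k] (Fin (d i) → k)) → ((Σ i, Fin (d i)) → k) →ₗ[k] ((Σ i, Fin (d i)) → k) :=
    fun φ => ∑ i, colorIncl k d i ∘ₗ (((f i).symm.trans (φ i)).toLinearMap) ∘ₗ colorRes k d i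
  have hΨ : ∀ φ i v, colorRes k d i (Ψ φ v) = φ i ((f i).symm (colorRes k d i v)) := by
    intro φ i v
    simp only [Ψ, LinearMap.sum_apply, map_sum, LinearMap.comp_apply]
    rw [Finset.sum_eq_single i]
    · rw [colorRes_colorIncl]; rfl
    · intro j _ hj
      exact colorRes_colorIncl_ne hj _
    · simp
  have hΨi : ∀ φ, Function.Injective (Ψ φ) := by
    intro φ v w h
    refine ext_colorRes fun i => ?_
    have := congrArg (colorRes k d i) h
    rw [hΨ, hΨ] at this
    exact (f i).symm.injective ((φ i).injective this)
  have hΨc : ∀ φ i v, Ψ φ (colorProj k (stdColor d) i v) = colorProj k (stdColor d) i (Ψ φ v) := by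
    intro φ i v
    refine ext_colorRes fun j => ?_
    rw [hΨ, colorRes_colorProj, colorRes_colorProj]
    split_ifs
    · rw [hΨ]
    · rw [map_zero, map_zero]
  choose g hg using fun φ => exists_gradedGL (stdColor d) (Ψ φ) (hΨi φ) (hΨc φ)
  refine Nat.card_congr (Equiv.ofBijective g ⟨fun φ φ' h => ?_, fun t => ?_⟩)
  · funext i
    ext1 v
    have h₁ := hg φ (colorIncl k d i (f i v))
    rw [h, hg] at h₁
    have := congrArg (colorRes k d i) h₁
    rw [hΨ, hΨ, colorRes_colorIncl, LinearEquiv.symm_apply_apply] at this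
    exact this.symm
  · have key : ∀ (t : gradedGL k (stdColor d)) i v, colorIncl k d i (colorRes k d i
        (glEquiv t (colorIncl k d i v))) = glEquiv t (colorIncl k d i v) := by
      intro t i v
      rw [colorIncl_colorRes, ← glEquiv_colorProj, colorProj_colorIncl]
    have inv : ∀ (t : gradedGL k (stdColor d)) v, glEquiv t⁻¹ (glEquiv t v) = v := by
      intro t v
      have := glEquiv_inv_apply t⁻¹ v
      rwa [inv_inv] at this
    let ψ : ∀ i, (Fin (d i) → k) ≃ₗ[k] (Fin (d i) → k) := fun i =>
      LinearEquiv.ofLinearMap (colorRes k d i ∘ₗ (glEquiv t).toLinearMap ∘ₗ colorIncl k d i)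
        (colorRes k d i ∘ₗ (glEquiv t⁻¹).toLinearMap ∘ₗ colorIncl k d i)
        (LinearMap.ext fun v => by
          simp only [LinearMap.comp_apply, LinearEquiv.coe_coe, key, glEquiv_inv_apply,
            colorRes_colorIncl, LinearMap.id_apply])
        (LinearMap.ext fun v => by
          simp only [LinearMap.comp_apply, LinearEquiv.coe_coe, key, inv,
            colorRes_colorIncl, LinearMap.id_apply])
    refine ⟨fun i => (f i).trans (ψ i), ?_⟩
    have h₁ : ∀ v, glEquiv (g fun i => (f i).trans (ψ i)) v = glEquiv t v := by
      intro v
      refine ext_colorRes fun i => ?_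
      rw [hg, hΨ, LinearEquiv.trans_apply, LinearEquiv.apply_symm_apply]
      change colorRes k d i (glEquiv t (colorIncl k d i (colorRes k d i v))) = _
      rw [colorIncl_colorRes, glEquiv_colorProj, colorRes_colorProj, if_pos rfl]
    refine Subtype.ext (Units.ext (Matrix.ext_of_mulVec_single fun x => ?_))
    exact h₁ _

/-! ### Representations on coordinate spaces -/

theorem mulVec_colorProj_of_mem {m : A → Matrix (Σ i, Fin (d i)) (Σ i, Fin (d i)) k}
    (hm : m ∈ repMat Q k (stdColor d)) (a : A) (v : (Σ i, Fin (d i)) → k) :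
    colorProj k (stdColor d) (Q.tgt a) ((m a).mulVec (colorProj k (stdColor d) (Q.src a) v))
      = (m a).mulVec v := by
  ext x
  simp only [Matrix.mulVec, dotProduct, colorProj_apply]
  by_cases hx : stdColor d x = Q.tgt a
  · rw [if_pos hx]
    refine Finset.sum_congr rfl fun y _ => ?_
    by_cases hy : stdColor d y = Q.src a
    · rw [if_pos hy]
    · rw [hm a x y fun h => hy h.2, zero_mul, zero_mul]
  · rw [if_neg hx]
    refine (Finset.sum_eq_zero fun y _ => ?_).symm
    rw [hm a x y fun h => hx h.1, zero_mul]

/-- The linear map of an arrow that is given by a matrix on the whole coordinate space. -/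
def arrowMap (Q : FQuiver I A) (d : I → ℕ) (m : A → Matrix (Σ i, Fin (d i)) (Σ i, Fin (d i)) k)
    (a : A) : (Fin (d (Q.src a)) → k) →ₗ[k] (Fin (d (Q.tgt a)) → k) :=
  colorRes k d (Q.tgt a) ∘ₗ (m a).mulVecLin ∘ₗ colorIncl k d (Q.src a)

/-- The representation given by matrices. -/
def repOf (Q : FQuiver I A) (d : I → ℕ) (m : A → Matrix (Σ i, Fin (d i)) (Σ i, Fin (d i)) k) :
    Rep Q k where
  V i := Fin (d i) → k
  map a := arrowMap Q d m a

theorem repOf_dim (m : A → Matrix (Σ i, Fin (d i)) (Σ i, Fin (d i)) k) : (repOf Q d m).dim = d :=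
  funext fun _ => Module.finrank_fin_fun k

theorem arrowMap_apply (m : A → Matrix (Σ i, Fin (d i)) (Σ i, Fin (d i)) k) (a : A)
    (v : Fin (d (Q.src a)) → k) : arrowMap Q d m a v
      = colorRes k d (Q.tgt a) ((m a).mulVec (colorIncl k d (Q.src a) v)) := rfl

theorem colorIncl_arrowMap {m : A → Matrix (Σ i, Fin (d i)) (Σ i, Fin (d i)) k}
    (hm : m ∈ repMat Q k (stdColor d)) (a : A) (v : Fin (d (Q.src a)) → k) :
    colorIncl k d (Q.tgt a) (arrowMap Q d m a v)
      = (m a).mulVec (colorIncl k d (Q.src a) v) := by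
  rw [arrowMap_apply, colorIncl_colorRes, ← mulVec_colorProj_of_mem hm, colorProj_self]

theorem mulVec_eq_arrowMap {m : A → Matrix (Σ i, Fin (d i)) (Σ i, Fin (d i)) k}
    (hm : m ∈ repMat Q k (stdColor d)) (a : A) (v : (Σ i, Fin (d i)) → k) :
    (m a).mulVec v = colorIncl k d (Q.tgt a) (arrowMap Q d m a (colorRes k d (Q.src a) v)) := by
  rw [colorIncl_arrowMap hm, colorIncl_colorRes, ← mulVec_colorProj_of_mem hm,
    ← mulVec_colorProj_of_mem hm a (colorProj _ _ _ v), colorProj_self]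

theorem isSubrep_repOf_iff {m : A → Matrix (Σ i, Fin (d i)) (Σ i, Fin (d i)) k}
    (hm : m ∈ repMat Q k (stdColor d)) (W : ∀ i, Submodule k (Fin (d i) → k)) :
    (repOf Q d m).IsSubrep W ↔ totalSub W ∈ invLat (stdColor d) m := by
  rw [mem_invLat]
  constructor
  · intro h
    refine ⟨totalSub_graded W, fun a v hv => ?_⟩
    rw [mulVec_eq_arrowMap hm]
    exact colorIncl_mem_totalSub.2 (h a _ (mem_totalSub.1 hv _))
  · intro h a v hv
    have := h.2 a _ (colorIncl_mem_totalSub.2 hv)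
    exact colorIncl_mem_totalSub.1 ((colorIncl_arrowMap hm a v).symm ▸ this)

theorem colorRes_single {i : I} {y : Σ i, Fin (d i)} (h : y.1 ≠ i) :
    colorRes k d i (Pi.single y 1) = 0 := by
  ext z
  exact Pi.single_eq_of_ne (fun e => h (congrArg Sigma.fst e).symm) _

theorem exists_arrowMap (f : ∀ a, (Fin (d (Q.src a)) → k) →ₗ[k] (Fin (d (Q.tgt a)) → k)) :
    ∃ m ∈ repMat Q k (stdColor d), ∀ a v, arrowMap Q d m a v = f a v := by
  refine ⟨fun a => LinearMap.toMatrix'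
    (colorIncl k d (Q.tgt a) ∘ₗ f a ∘ₗ colorRes k d (Q.src a)), fun a x y hxy => ?_,
    fun a v => ?_⟩
  · change LinearMap.toMatrix' _ x y = 0
    rw [LinearMap.toMatrix'_apply]
    simp only [LinearMap.comp_apply]
    by_cases hx : x.1 = Q.tgt a
    · rw [colorRes_single fun h => hxy ⟨hx, h⟩, map_zero, map_zero]
      rfl
    · exact dif_neg hx
  · rw [arrowMap_apply, LinearMap.toMatrix'_mulVec]
    simp only [LinearMap.comp_apply, colorRes_colorIncl]

theorem arrowMap_injective {m m' : A → Matrix (Σ i, Fin (d i)) (Σ i, Fin (d i)) k}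
    (hm : m ∈ repMat Q k (stdColor d)) (hm' : m' ∈ repMat Q k (stdColor d))
    (h : ∀ a v, arrowMap Q d m a v = arrowMap Q d m' a v) : m = m' := by
  funext a
  refine Matrix.ext_of_mulVec_single fun x => ?_
  rw [mulVec_eq_arrowMap hm, mulVec_eq_arrowMap hm', h]

/-! ### Isomorphism classes -/

section

variable {U V : Rep Q k}

/-- Composition of isomorphisms. -/
def Rep.Iso.trans {W : Rep Q k} (f : U.Iso V) (g : V.Iso W) : U.Iso W :=
  ⟨fun i => (f.1 i).trans (g.1 i), fun a x => by
    simp only [LinearEquiv.trans_apply, f.2, g.2]⟩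

/-- The inverse isomorphism. -/
def Rep.Iso.symm (f : U.Iso V) : V.Iso U :=
  ⟨fun i => (f.1 i).symm, fun a x => by
    rw [LinearEquiv.symm_apply_eq, f.2, LinearEquiv.apply_symm_apply]⟩

instance [Finite k] : Finite (U.Iso V) := by
  have : ∀ i, Finite (U.V i ≃ₗ[k] V.V i) := fun i =>
    have := Module.finite_of_finite k (M := U.V i)
    have := Module.finite_of_finite k (M := V.V i)
    Finite.of_injective _ (DFunLike.coe_injective (F := U.V i ≃ₗ[k] V.V i))
  exact Subtype.finite

theorem Rep.Iso.card_eq (f : U.Iso V) : Nat.card (U.Iso V) = Nat.card (U.Iso U) :=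
  Nat.card_congr
    { toFun := fun g => g.trans f.symm
      invFun := fun g => g.trans f
      left_inv := fun _ => Subtype.ext (funext fun i => LinearEquiv.ext fun _ =>
        (f.1 i).apply_symm_apply _)
      right_inv := fun _ => Subtype.ext (funext fun i => LinearEquiv.ext fun _ =>
        (f.1 i).symm_apply_apply _) }

theorem Rep.Iso.dim_eq (f : U.Iso V) : U.dim = V.dim :=
  funext fun i => (f.1 i).finrank_eq

theorem Rep.Iso.isSubrep_map (f : U.Iso V) {W : ∀ i, Submodule k (U.V i)} (hW : U.IsSubrep W) :
    V.IsSubrep fun i => (W i).map (f.1 i).toLinearMap := by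
  rintro a _ ⟨x, hx, rfl⟩
  exact ⟨U.map a x, hW a x hx, f.2 a x⟩

theorem Rep.Iso.subDim_map (f : U.Iso V) (W : ∀ i, Submodule k (U.V i)) :
    V.subDim (fun i => (W i).map (f.1 i).toLinearMap) = U.subDim W :=
  funext fun i => LinearEquiv.finrank_map_eq (f.1 i) (W i)

theorem Rep.Iso.semistable (f : U.Iso V) {θ : Module.Dual ℤ (I → ℤ)} (h : V.Semistable θ) :
    U.Semistable θ := by
  intro W hW hbot htop
  have := h _ (f.isSubrep_map hW) (fun e => hbot (funext fun i => ?_))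
    (fun e => htop (funext fun i => ?_))
  · rwa [f.subDim_map, ← f.dim_eq] at this
  · have e' := congrFun e i
    rw [eq_bot_iff]
    intro x hx
    have : f.1 i x ∈ (W i).map (f.1 i).toLinearMap := ⟨x, hx, rfl⟩
    rw [e', Submodule.mem_bot, LinearEquiv.map_eq_zero_iff] at this
    exact this
  · have e' := congrFun e i
    rw [eq_top_iff]
    intro x _
    have : f.1 i x ∈ (W i).map (f.1 i).toLinearMap := by rw [e']; trivial
    obtain ⟨y, hy, e⟩ := this
    rwa [← (f.1 i).injective e]

end

/-- By transport of structure, a coordinate model of `U` together with an isomorphism to it is the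
same as a frame of `U`. -/
theorem ncard_repOf_mul_card [Finite k] [Finite A] {U : Rep Q k} (hU : U.dim = d) :
    {m : repMat Q k (stdColor d) | (Rep.isoSetoid Q k).r (repOf Q d m.1) U}.ncard
      * Nat.card (U.Iso U) = Nat.card (gradedGL k (stdColor d)) := by
  have : Finite (A → Matrix (Σ i, Fin (d i)) (Σ i, Fin (d i)) k) := Pi.finite
  rw [ncard_mul_card (F := fun m : repMat Q k (stdColor d) => U.Iso (repOf Q d m.1))
    (fun m => ⟨fun ⟨f⟩ => ⟨f.symm⟩, fun ⟨f⟩ => ⟨f.symm⟩⟩) (fun m ⟨f⟩ => f.card_eq),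
    ← card_frames fun i => congrFun hU i]
  refine Nat.card_congr (Equiv.ofBijective (fun x => x.2.1) ⟨?_, fun φ => ?_⟩)
  · rintro ⟨⟨m, hm⟩, φ, hφ⟩ ⟨⟨m', hm'⟩, φ', hφ'⟩ (h : φ = φ')
    subst h
    obtain rfl : m = m' := arrowMap_injective hm hm' fun a v => by
      obtain ⟨x, rfl⟩ := (φ (Q.src a)).surjective v
      exact (hφ a x).symm.trans (hφ' a x)
    rfl
  · obtain ⟨m, hm, h⟩ := exists_arrowMap (Q := Q) fun a =>
      (φ (Q.tgt a)).toLinearMap ∘ₗ U.map a ∘ₗ (φ (Q.src a)).symm.toLinearMap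
    refine ⟨⟨⟨m, hm⟩, φ, fun a x => ?_⟩, rfl⟩
    refine Eq.trans ?_ (h a (φ (Q.src a) x)).symm
    simp only [LinearMap.comp_apply, LinearEquiv.coe_coe, LinearEquiv.symm_apply_apply]
    rfl

/-! ### Semistability -/

theorem toLat_eq_zero_iff {n : I → ℕ} : n = 0 ↔ ∑ i, n i = 0 := by
  rw [Finset.sum_eq_zero_iff, funext_iff]
  simp

theorem slope_le_iff (θ : Module.Dual ℤ (I → ℤ)) {n : I → ℕ} (hn : n ≠ 0) (μ : ℚ) :
    slope θ n ≤ μ ↔ (θ (toLat n) : ℚ) - μ * ((∑ i, toLat n i : ℤ) : ℚ) ≤ 0 := by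
  have : (0 : ℚ) < ((∑ i, n i : ℕ) : ℚ) :=
    Nat.cast_pos.2 (Nat.pos_of_ne_zero fun h => hn (toLat_eq_zero_iff.2 h))
  rw [slope, div_le_iff₀ this, sub_nonpos]
  simp [toLat]

theorem slope_eq_iff (θ : Module.Dual ℤ (I → ℤ)) {n : I → ℕ} (hn : n ≠ 0) (μ : ℚ) :
    slope θ n = μ ↔ (θ (toLat n) : ℚ) - μ * ((∑ i, toLat n i : ℤ) : ℚ) = 0 := by
  have : ((∑ i, n i : ℕ) : ℚ) ≠ 0 := Nat.cast_ne_zero.2 fun h => hn (toLat_eq_zero_iff.2 h)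
  rw [slope, div_eq_iff this, sub_eq_zero]
  simp [toLat]

theorem shift_totalSub {m : A → Matrix (Σ i, Fin (d i)) (Σ i, Fin (d i)) k}
    (θ : Module.Dual ℤ (I → ℤ)) (μ : ℚ) (W : ∀ i, Submodule k (Fin (d i) → k))
    (hW : totalSub W ∈ invLat (stdColor d) m) :
    shift (latDeg θ) latRk μ (⟨totalSub W, hW⟩ : invLat (stdColor d) m)
      = (θ (toLat fun i => Module.finrank k (W i)) : ℚ)
        - μ * ((∑ i, toLat (fun i => Module.finrank k (W i)) i : ℤ) : ℚ) := by
  simp only [shift, latDeg, latRk, gdim_totalSub]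

theorem totalSub_eq_bot_iff {W : ∀ i, Submodule k (Fin (d i) → k)} :
    totalSub W = ⊥ ↔ W = fun _ => ⊥ := by
  constructor
  · intro h
    funext i
    rw [eq_bot_iff]
    intro v hv
    have := colorIncl_mem_totalSub.2 hv
    rw [h, Submodule.mem_bot] at this
    rw [Submodule.mem_bot, ← colorRes_colorIncl (k := k) i v, this, map_zero]
  · rintro rfl
    rw [eq_bot_iff]
    intro v hv
    exact ext_colorRes fun i => (mem_totalSub.1 hv i).trans (map_zero _).symm

theorem totalSub_top : totalSub (fun i => (⊤ : Submodule k (Fin (d i) → k))) = ⊤ :=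
  eq_top_iff.2 fun _ _ => mem_totalSub.2 fun _ => trivial

theorem finrank_family_eq_zero_iff {W : ∀ i, Submodule k (Fin (d i) → k)} :
    (fun i => Module.finrank k (W i)) = 0 ↔ W = fun _ => ⊥ := by
  rw [funext_iff, funext_iff]
  exact forall_congr' fun i => Submodule.finrank_eq_zero

theorem shift_bot_invLat {m : A → Matrix (Σ i, Fin (d i)) (Σ i, Fin (d i)) k}
    (θ : Module.Dual ℤ (I → ℤ)) (μ : ℚ) :
    shift (latDeg θ) latRk μ (⊥ : invLat (stdColor d) m) = 0 := by
  have h : (⊥ : invLat (stdColor d) m)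
      = ⟨totalSub (k := k) fun _ => ⊥, by
        rw [totalSub_eq_bot_iff.2 rfl]; exact (⊥ : invLat (stdColor d) m).2⟩ :=
    Subtype.ext (totalSub_eq_bot_iff.2 rfl).symm
  rw [h, shift_totalSub, finrank_family_eq_zero_iff.2 rfl]
  have : toLat (0 : I → ℕ) = 0 := rfl
  simp [this]

theorem shift_top_invLat {m : A → Matrix (Σ i, Fin (d i)) (Σ i, Fin (d i)) k}
    (θ : Module.Dual ℤ (I → ℤ)) (μ : ℚ) :
    shift (latDeg θ) latRk μ (⊤ : invLat (stdColor d) m)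
      = (θ (toLat d) : ℚ) - μ * ((∑ i, toLat d i : ℤ) : ℚ) := by
  have h : (⊤ : invLat (stdColor d) m)
      = ⟨totalSub (k := k) fun _ => ⊤, by
        rw [totalSub_top]; exact (⊤ : invLat (stdColor d) m).2⟩ :=
    Subtype.ext totalSub_top.symm
  rw [h, shift_totalSub]
  simp only [finrank_top, Module.finrank_fin_fun]

/-- The zero and the full subrepresentation are excluded in `Rep.Semistable` but not in
`SemistableInterval`; for them the inequality holds with equality, once the slope is `μ` or the
space is zero. -/
theorem semistable_repOf_iff {m : A → Matrix (Σ i, Fin (d i)) (Σ i, Fin (d i)) k}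
    (hm : m ∈ repMat Q k (stdColor d)) (θ : Module.Dual ℤ (I → ℤ)) (μ : ℚ) :
    ((d = 0 ∨ slope θ d = μ) ∧ (repOf Q d m).Semistable θ)
      ↔ SemistableInterval (latDeg (c := stdColor d) (m := m) θ) latRk μ ⊥ ⊤ := by
  rw [SemistableInterval, shift_bot_invLat, shift_top_invLat]
  have htop : (θ (toLat d) : ℚ) - μ * ((∑ i, toLat d i : ℤ) : ℚ) = 0 ↔ (d = 0 ∨ slope θ d = μ) := by
    by_cases hd : d = 0
    · have : toLat (0 : I → ℕ) = 0 := rfl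
      simp [hd, this]
    · rw [slope_eq_iff θ hd]
      simp [hd]
  constructor
  · rintro ⟨hs, h⟩
    refine ⟨bot_le, htop.2 hs, ?_⟩
    rintro ⟨Z, hZ⟩ - -
    obtain ⟨W, rfl⟩ := exists_totalSub_eq hZ.1
    by_cases h₁ : W = fun _ => ⊥
    · subst h₁
      refine le_of_eq (Eq.trans (congrArg _ (Subtype.ext (totalSub_eq_bot_iff.2 rfl)))
        (shift_bot_invLat (m := m) θ μ))
    by_cases h₂ : W = fun _ => ⊤
    · subst h₂
      refine le_of_eq (Eq.trans (congrArg _ (Subtype.ext totalSub_top))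
        ((shift_top_invLat (m := m) θ μ).trans (htop.2 hs)))
    rw [shift_totalSub, ← slope_le_iff θ fun e => h₁ (finrank_family_eq_zero_iff.1 e)]
    have h₃ := h W ((isSubrep_repOf_iff hm W).2 hZ) h₁ h₂
    rw [repOf_dim] at h₃
    have hd : d ≠ 0 := by
      rintro rfl
      exact h₁ (funext fun i => (Subsingleton.elim (α := Submodule k (Fin 0 → k)) _ _))
    rcases hs with hs | hs
    · exact absurd hs hd
    · exact hs ▸ h₃
  · rintro ⟨-, hs, h⟩
    refine ⟨htop.1 hs, fun (W : ∀ i, Submodule k (Fin (d i) → k)) hW h₁ _ => ?_⟩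
    have hW' := (isSubrep_repOf_iff hm W).1 hW
    have h₃ := h ⟨totalSub W, hW'⟩ bot_le le_top
    rw [shift_totalSub, ← slope_le_iff θ fun e => h₁ (finrank_family_eq_zero_iff.1 e)] at h₃
    change slope θ (fun i => Module.finrank k (W i)) ≤ _
    rw [repOf_dim]
    have hd : d ≠ 0 := by
      rintro rfl
      exact h₁ (funext fun i => (Subsingleton.elim (α := Submodule k (Fin 0 → k)) _ _))
    rcases htop.1 hs with hs | hs
    · exact absurd hs hd
    · exact hs ▸ h₃

/-- If `d ≠ 0` has a slope other than `μ`, both sides vanish, since slope `μ` is part of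
`SemistableInterval`. -/
theorem dtSeries_eq [Fintype A] [Finite k] (θ : Module.Dual ℤ (I → ℤ)) (μ : ℚ) (d : I → ℕ) :
    dtSeries Q k θ μ d = sqrtq k ^ Q.euler (toLat d) (toLat d)
      * repMass Q k θ (IntervalPredicate.semistable μ) d := by
  have : Finite (A → Matrix (Σ i, Fin (d i)) (Σ i, Fin (d i)) k) := Pi.finite
  rw [dtSeries, repMass]
  split_ifs with hs
  · rw [finsum_quotient_eq (fun m : repMat Q k (stdColor d) => repOf Q d m.1)
      (fun U => Nat.card (U.Iso U)) (P := fun U => U.dim = d ∧ U.Semistable θ)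
      (st := Rep.isoSetoid Q k) (fun U V ⟨f⟩ h =>
        ⟨f.dim_eq.symm.trans h.1, f.symm.semistable h.2⟩)
      (G := Nat.card (gradedGL k (stdColor d))) Nat.card_pos.ne'
      (fun U hU => ncard_repOf_mul_card hU.1)]
    congr 3
    refine Set.ncard_congr (fun m _ => m.1) ?_ (fun _ _ _ _ => Subtype.ext) ?_
    · rintro ⟨m, hm⟩ ⟨-, h⟩
      exact ⟨hm, (semistable_repOf_iff hm θ μ).1 ⟨hs, h⟩⟩
    · rintro m ⟨hm, h⟩
      exact ⟨⟨m, hm⟩, ⟨repOf_dim m, ((semistable_repOf_iff hm θ μ).2 h).2⟩, rfl⟩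
  · have : repSet Q (IntervalPredicate.semistable μ) θ k (stdColor d) = ∅ := by
      rw [Set.eq_empty_iff_forall_notMem]
      rintro m ⟨hm, h⟩
      exact hs ((semistable_repOf_iff hm θ μ).2 h).1
    rw [this, Set.ncard_empty, Nat.cast_zero, zero_div, mul_zero]

end

/-! ### Forms on coordinate spaces -/

section

variable {I : Type u₂} [DecidableEq I] [Fintype I] {A : Type*} [Fintype A] {Q : FQuiver I A}
  {σ : Q.Involution} {D : DualityStructure σ} {k : Type u₁} [Field k] [Finite k] {d : I → ℕ}

/-- Families of homogeneous vectors as vectors of the whole coordinate space. -/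
def flatEquiv (k : Type u₁) [Field k] (d : I → ℕ) :
    (∀ i, Fin (d i) → k) ≃ₗ[k] ((Σ i, Fin (d i)) → k) :=
  (LinearEquiv.piCurry k fun i (_ : Fin (d i)) => k).symm

theorem colorRes_flatEquiv (i : I) (x : ∀ i, Fin (d i) → k) :
    colorRes k d i (flatEquiv k d x) = x i := rfl

theorem flatEquiv_single (i : I) (x : Fin (d i) → k) :
    flatEquiv k d (Pi.single i x) = colorIncl k d i x := by
  refine ext_colorRes fun j => ?_
  rw [colorRes_flatEquiv]
  by_cases h : i = j
  · subst h
    rw [Pi.single_eq_same, colorRes_colorIncl]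
  · rw [Pi.single_eq_of_ne (fun e => h e.symm), colorRes_colorIncl_ne h]

theorem single_eq_colorIncl (p : Σ i, Fin (d i)) :
    (Pi.single p 1 : (Σ i, Fin (d i)) → k) = colorIncl k d p.1 (Pi.single p.2 1) := by
  refine ext_colorRes fun j => ?_
  by_cases h : p.1 = j
  · subst h
    rw [colorRes_colorIncl]
    ext x
    rw [colorRes_apply, Pi.single_apply, Pi.single_apply]
    exact if_congr ⟨fun e => eq_of_heq (Sigma.ext_iff.1 e).2, fun e => by rw [e]⟩ rfl rfl
  · rw [colorRes_colorIncl_ne h, colorRes_single h]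

/-- The bilinear form given by a matrix. -/
def stdForm (b : Matrix (Σ i, Fin (d i)) (Σ i, Fin (d i)) k) :
    LinearMap.BilinForm k (∀ i, Fin (d i) → k) :=
  LinearMap.BilinForm.congr (flatEquiv k d).symm (Matrix.toBilin' b)

theorem stdForm_apply (b : Matrix (Σ i, Fin (d i)) (Σ i, Fin (d i)) k)
    (x y : ∀ i, Fin (d i) → k) :
    stdForm b x y = flatEquiv k d x ⬝ᵥ b.mulVec (flatEquiv k d y) :=
  Matrix.toBilin'_apply' b _ _

theorem eq_of_form_eq {X : Type*} [Fintype X] [DecidableEq X] {b b' : Matrix X X k}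
    (h : ∀ v w, v ⬝ᵥ b.mulVec w = v ⬝ᵥ b'.mulVec w) : b = b' := by
  refine Matrix.toBilin'.injective (LinearMap.ext₂ fun v w => ?_)
  rw [Matrix.toBilin'_apply', Matrix.toBilin'_apply', h]

theorem stdForm_injective : Function.Injective (stdForm (k := k) (d := d)) :=
  (LinearMap.BilinForm.congr (flatEquiv k d).symm).injective.comp Matrix.toBilin'.injective

theorem stdForm_nondegenerate {b : Matrix (Σ i, Fin (d i)) (Σ i, Fin (d i)) k} (hb : IsUnit b) :
    (stdForm b).Nondegenerate := by
  rw [stdForm, LinearMap.BilinForm.nondegenerate_congr_iff, Matrix.nondegenerate_toBilin'_iff,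
    Matrix.nondegenerate_iff_det_ne_zero]
  exact ((Matrix.isUnit_iff_isUnit_det b).1 hb).ne_zero

/-- The self-dual representation given by matrices. -/
def sdRepOf {z : (A → Matrix (Σ i, Fin (d i)) (Σ i, Fin (d i)) k) ×
    Matrix (Σ i, Fin (d i)) (Σ i, Fin (d i)) k} (hz : z ∈ sdMat D k (stdColor d)) :
    SDRep D k where
  toRep := repOf Q d z.1
  form := stdForm z.2
  nondegenerate := stdForm_nondegenerate hz.2.1.unit
  orthogonal i j h (x : Fin (d i) → k) (y : Fin (d j) → k) := by
    change stdForm z.2 (Pi.single i x) (Pi.single j y) = 0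
    rw [stdForm_apply, flatEquiv_single, flatEquiv_single, ← colorProj_colorIncl j y,
      hz.2.1.form_colorProj, ← colorProj_colorIncl i x, colorProj_ne _ h.symm, zero_dotProduct]
  symmetric i (x : ∀ j, Fin (d j) → k) (y : ∀ j, Fin (d j) → k) h := by
    change stdForm z.2 x y = signCast k (D.s i) * stdForm z.2 y x
    rw [stdForm_apply, stdForm_apply]
    conv_lhs => rw [← sum_colorProj (stdColor d) (flatEquiv k d y)]
    conv_rhs => rw [← sum_colorProj (stdColor d) (flatEquiv k d y)]
    rw [Matrix.mulVec_sum, dotProduct_sum, sum_dotProduct, Finset.mul_sum]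
    refine Finset.sum_congr rfl fun j _ => ?_
    -- Only the components of colours `i` and `σ(i)` are nonzero, and these two nodes have the same
    -- sign.
    rw [hz.2.1.form_symm_of_colorProj]
    by_cases hj : j = i
    · rw [hj]
    by_cases hj' : j = σ.node i
    · rw [hj', D.s_node]
    · have : y j = 0 := (h j hj hj').2
      rw [← colorIncl_colorRes, colorRes_flatEquiv, this, map_zero, zero_dotProduct, mul_zero,
        mul_zero]
  compatible a (x : Fin (d (Q.src a)) → k) (y : Fin (d (Q.src (σ.arrow a))) → k) := by
    change stdForm z.2 (Pi.single (Q.tgt a) (arrowMap Q d z.1 a x))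
        (Pi.single (Q.src (σ.arrow a)) y) - signCast k (D.τ a) *
      stdForm z.2 (Pi.single (Q.src a) x)
        (Pi.single (Q.tgt (σ.arrow a)) (arrowMap Q d z.1 (σ.arrow a) y)) = 0
    simp only [stdForm_apply, flatEquiv_single, colorIncl_arrowMap hz.1]
    rw [form_mulVec hz, sub_self]

/-- Transport of structure along an arbitrary frame: the matrices are those of the arrows and of the
form in the coordinates given by `φ`. -/
theorem exists_sdRepOf (M : SDRep D k) (φ : ∀ i, M.V i ≃ₗ[k] (Fin (d i) → k)) :
    ∃ z, ∃ hz : z ∈ sdMat D k (stdColor d), ∃ f : M.Isometry (sdRepOf hz), f.1.1 = φ := by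
  obtain ⟨m, hm, hmf⟩ := exists_arrowMap (Q := Q) fun a =>
      (φ (Q.tgt a)).toLinearMap ∘ₗ M.map a ∘ₗ (φ (Q.src a)).symm.toLinearMap
  let ψ : (∀ i, M.V i) ≃ₗ[k] ((Σ i, Fin (d i)) → k) :=
    (LinearEquiv.piCongrRight φ).trans (flatEquiv k d)
  have hψ : ∀ i v, ψ.symm (colorIncl k d i v) = Pi.single i ((φ i).symm v) := by
    intro i v
    rw [LinearEquiv.symm_apply_eq]
    change _ = flatEquiv k d fun j => φ j _
    rw [← flatEquiv_single]
    congr 1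
    funext j
    by_cases h : j = i
    · subst h
      rw [Pi.single_eq_same, Pi.single_eq_same, LinearEquiv.apply_symm_apply]
    · rw [Pi.single_eq_of_ne h, Pi.single_eq_of_ne h, map_zero]
  obtain ⟨b, hb'⟩ : ∃ b, b = LinearMap.BilinForm.toMatrix' (LinearMap.BilinForm.congr ψ M.form) :=
    ⟨_, rfl⟩
  have hb : ∀ v w, v ⬝ᵥ b.mulVec w = M.form (ψ.symm v) (ψ.symm w) := by
    intro v w
    rw [← Matrix.toBilin'_apply', hb', Matrix.toBilin'_toMatrix']
    rfl
  have hbe : ∀ p q, b p q = M.form (Pi.single p.1 ((φ p.1).symm (Pi.single p.2 1)))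
      (Pi.single q.1 ((φ q.1).symm (Pi.single q.2 1))) := by
    intro p q
    rw [hb', LinearMap.BilinForm.toMatrix'_apply, single_eq_colorIncl, single_eq_colorIncl,
      ← hψ, ← hψ]
    rfl
  have hF : IsSDForm D (stdColor d) b := by
    refine ⟨fun p q h => ?_, fun p q => ?_, ?_⟩
    · rw [hbe]
      exact M.orthogonal _ _ h _ _
    · by_cases h : p.1 = σ.node q.1
      · rw [hbe, hbe q p]
        refine M.symmetric p.1 _ _ fun j h₁ h₂ => ⟨Pi.single_eq_of_ne h₁ _, ?_⟩
        rw [h, σ.node_involutive q.1] at h₂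
        exact Pi.single_eq_of_ne h₂ _
      · rw [hbe, hbe q p, M.orthogonal _ _ h, M.orthogonal, mul_zero]
        intro h'
        exact h (by rw [h', σ.node_involutive])
    · rw [Matrix.isUnit_iff_isUnit_det, isUnit_iff_ne_zero,
        ← Matrix.nondegenerate_iff_det_ne_zero, hb',
        LinearMap.BilinForm.nondegenerate_toMatrix'_iff,
        LinearMap.BilinForm.nondegenerate_congr_iff]
      exact M.nondegenerate
  have hz : (m, b) ∈ sdMat D k (stdColor d) := by
    refine ⟨hm, hF, fun a => eq_of_form_eq fun v w => ?_⟩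
    -- The compatibility of `M` concerns homogeneous vectors only, so both sides are first reduced
    -- to the relevant homogeneous parts of `v` and `w`.
    have h₁ : (m a).mulVec v ⬝ᵥ b.mulVec w = (m a).mulVec v ⬝ᵥ
        b.mulVec (colorIncl k d (Q.src (σ.arrow a)) (colorRes k d (Q.src (σ.arrow a)) w)) := by
      rw [colorIncl_colorRes, hF.form_colorProj, σ.src_arrow, σ.node_involutive,
        ← mulVec_colorProj_of_mem hm, colorProj_self]
    have h₂ : v ⬝ᵥ b.mulVec ((m (σ.arrow a)).mulVec w)
        = colorIncl k d (Q.src a) (colorRes k d (Q.src a) v) ⬝ᵥ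
          b.mulVec ((m (σ.arrow a)).mulVec w) := by
      have h₃ : colorProj k (stdColor d) (Q.tgt (σ.arrow a)) ((m (σ.arrow a)).mulVec w)
          = (m (σ.arrow a)).mulVec w := by
        rw [← mulVec_colorProj_of_mem hm, colorProj_self]
      rw [← h₃, hF.form_colorProj, h₃, σ.tgt_arrow, σ.node_involutive, colorIncl_colorRes]
    rw [Matrix.smul_mulVec, dotProduct_smul, ← Matrix.mulVec_mulVec, ← Matrix.mulVec_mulVec,
      Matrix.dotProduct_mulVec v, Matrix.vecMul_transpose, h₁, h₂, mulVec_eq_arrowMap hm,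
      mulVec_eq_arrowMap hm, hb, hb, hψ, hψ, hψ, hψ, hmf, hmf]
    simp only [LinearMap.comp_apply, LinearEquiv.coe_coe, LinearEquiv.symm_apply_apply]
    exact sub_eq_zero.1 (M.compatible a _ _)
  refine ⟨(m, b), hz, ⟨⟨φ, fun a x => ?_⟩, fun x y => ?_⟩, rfl⟩
  · refine Eq.trans ?_ (hmf a (φ (Q.src a) x)).symm
    simp only [LinearMap.comp_apply, LinearEquiv.coe_coe, LinearEquiv.symm_apply_apply]
    rfl
  · change stdForm b (fun i => φ i (x i)) (fun i => φ i (y i)) = _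
    rw [stdForm_apply, hb]
    exact congrArg₂ (fun x y => M.form x y) (ψ.symm_apply_apply x) (ψ.symm_apply_apply y)

/-! ### Isometry classes -/

namespace SDRep

variable {L M N : SDRep D k}

/-- Composition of isometries. -/
def Isometry.trans (f : L.Isometry M) (g : M.Isometry N) : L.Isometry N :=
  ⟨f.1.trans g.1, fun x y => (g.2 (fun i => f.1.1 i (x i)) (fun i => f.1.1 i (y i))).trans (f.2 x y)⟩

/-- The inverse isometry. -/
def Isometry.symm (f : M.Isometry N) : N.Isometry M :=
  ⟨f.1.symm, fun x y => by
    rw [← f.2]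
    simp only [Rep.Iso.symm, LinearEquiv.apply_symm_apply]⟩

instance : Finite (M.Isometry N) := Subtype.finite

theorem Isometry.card_eq (f : M.Isometry N) :
    Nat.card (M.Isometry N) = Nat.card (M.Isometry M) :=
  Nat.card_congr
    { toFun := fun g => g.trans f.symm
      invFun := fun g => g.trans f
      left_inv := fun _ => Subtype.ext (Subtype.ext (funext fun i => LinearEquiv.ext fun _ =>
        (f.1.1 i).apply_symm_apply _))
      right_inv := fun _ => Subtype.ext (Subtype.ext (funext fun i => LinearEquiv.ext fun _ =>
        (f.1.1 i).symm_apply_apply _)) }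

theorem Isometry.semistable (f : M.Isometry N) {θ : Module.Dual ℤ (I → ℤ)} (h : N.Semistable θ) :
    M.Semistable θ := by
  intro W hW hi hbot
  have := h _ (f.1.isSubrep_map hW) ?_ (fun e => hbot (funext fun i => ?_))
  · rwa [f.1.subDim_map, ← f.1.dim_eq] at this
  · intro x y hx hy
    choose x' hx' ex using hx
    choose y' hy' ey using hy
    rw [← hi x' y' hx' hy', ← f.2]
    exact congrArg₂ (fun x y => N.form x y) (funext fun i => (ex i).symm)
      (funext fun i => (ey i).symm)
  · have e' := congrFun e i
    rw [eq_bot_iff]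
    intro x hx
    have : f.1.1 i x ∈ (W i).map (f.1.1 i).toLinearMap := ⟨x, hx, rfl⟩
    rw [e', Submodule.mem_bot, LinearEquiv.map_eq_zero_iff] at this
    exact this

end SDRep

theorem ncard_sdRepOf_mul_card {M : SDRep D k} (hM : M.dim = d) :
    {z : sdMat D k (stdColor d) | (SDRep.isometrySetoid D k).r (sdRepOf z.2) M}.ncard
      * Nat.card (M.Isometry M) = Nat.card (gradedGL k (stdColor d)) := by
  rw [ncard_mul_card (F := fun z : sdMat D k (stdColor d) => M.Isometry (sdRepOf z.2))
    (fun m => ⟨fun ⟨f⟩ => ⟨f.symm⟩, fun ⟨f⟩ => ⟨f.symm⟩⟩) (fun m ⟨f⟩ => f.card_eq),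
    ← card_frames fun i => congrFun hM i]
  refine Nat.card_congr (Equiv.ofBijective (fun x => x.2.1.1) ⟨?_, fun φ => ?_⟩)
  · rintro ⟨⟨⟨m, b⟩, hz⟩, ⟨φ, hφ⟩, hf⟩ ⟨⟨⟨m', b'⟩, hz'⟩, ⟨φ', hφ'⟩, hf'⟩ (h : φ = φ')
    subst h
    obtain rfl : m = m' := arrowMap_injective hz.1 hz'.1 fun a v => by
      obtain ⟨x, rfl⟩ := (φ (Q.src a)).surjective v
      exact (hφ a x).symm.trans (hφ' a x)
    obtain rfl : b = b' := stdForm_injective (LinearMap.ext₂ fun x y => by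
      obtain ⟨x, rfl⟩ : ∃ x', (fun i => φ i (x' i)) = x :=
        ⟨fun i => (φ i).symm (x i), funext fun i => (φ i).apply_symm_apply _⟩
      obtain ⟨y, rfl⟩ : ∃ x', (fun i => φ i (x' i)) = y :=
        ⟨fun i => (φ i).symm (y i), funext fun i => (φ i).apply_symm_apply _⟩
      exact (hf x y).trans (hf' x y).symm)
    rfl
  · obtain ⟨z, hz, f, hf⟩ := exists_sdRepOf M φ
    exact ⟨⟨⟨z, hz⟩, f⟩, hf⟩

/-- Compatibility makes the slope of a self-dual representation zero, so semistability bounds the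
degrees of isotropic subrepresentations by zero, the degree of `⊥`. -/
theorem semistable_sdRepOf_iff {m : A → Matrix (Σ i, Fin (d i)) (Σ i, Fin (d i)) k}
    {b : Matrix (Σ i, Fin (d i)) (Σ i, Fin (d i)) k} (hz : (m, b) ∈ sdMat D k (stdColor d))
    {θ : Module.Dual ℤ (I → ℤ)} (hθ : σ.Compatible θ) (hd : σ.act d = d) :
    (sdRepOf hz).Semistable θ ↔ SDSemistableAt θ b (⊥ : invLat (stdColor d) m) := by
  have hs : slope θ (repOf Q d m).dim = 0 := by
    rw [repOf_dim, slope, stability_invariant hθ (d := toLat d) (funext fun i =>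
      congrArg Nat.cast (congrFun hd i)), Int.cast_zero, zero_div]
  have hiso : ∀ W : ∀ i, Submodule k (Fin (d i) → k),
      (sdRepOf hz).IsIsotropic W ↔ IsIsotropicSubspace b (totalSub W) := by
    intro W
    constructor
    · intro h v hv w hw
      have := h ((flatEquiv k d).symm v) ((flatEquiv k d).symm w) (mem_totalSub.1 hv)
        (mem_totalSub.1 hw)
      rw [← LinearEquiv.apply_symm_apply (flatEquiv k d) v,
        ← LinearEquiv.apply_symm_apply (flatEquiv k d) w, ← stdForm_apply]
      exact this
    · intro h x y hx hy
      exact (stdForm_apply b x y).trans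
        (h _ (mem_totalSub.2 fun i => hx i) _ (mem_totalSub.2 fun i => hy i))
  have hdeg : ∀ (W : ∀ i, Submodule k (Fin (d i) → k)), W ≠ (fun _ => ⊥) →
      (slope θ (fun i => Module.finrank k (W i)) ≤ 0 ↔
        θ (gdim (stdColor d) (totalSub W)) ≤ 0) := by
    intro W hW
    rw [slope_le_iff θ fun e => hW (finrank_family_eq_zero_iff.1 e), zero_mul, sub_zero,
      gdim_totalSub]
    exact Int.cast_nonpos
  have hbot : latDeg θ (⊥ : invLat (stdColor d) m) = 0 := by
    change θ (gdim _ ⊥) = 0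
    rw [gdim_bot, map_zero]
  unfold SDSemistableAt
  rw [hbot]
  constructor
  · rintro h ⟨Z, hZ⟩ hi -
    obtain ⟨W, rfl⟩ := exists_totalSub_eq hZ.1
    by_cases h₁ : W = fun _ => ⊥
    · change θ (gdim _ (totalSub W)) ≤ 0
      rw [totalSub_eq_bot_iff.2 h₁, gdim_bot, map_zero]
    · have := h W ((isSubrep_repOf_iff hz.1 W).2 hZ) ((hiso W).2 hi) h₁
      rw [show (sdRepOf hz).dim = (repOf Q d m).dim from rfl, hs] at this
      exact (hdeg W h₁).1 this
  · intro h (W : ∀ i, Submodule k (Fin (d i) → k)) hW hi h₁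
    change slope θ (fun i => Module.finrank k (W i)) ≤ slope θ (repOf Q d m).dim
    rw [hs, hdeg W h₁]
    exact h ⟨totalSub W, (isSubrep_repOf_iff hz.1 W).1 hW⟩ ((hiso W).1 hi) bot_le

theorem oriDTSeries_eq [DecidableEq A] {θ : Module.Dual ℤ (I → ℤ)} (hθ : σ.Compatible θ)
    (e : σ.InvDim) :
    oriDTSeries D k θ e = sqrtq k ^ D.sdEuler (toLat e.1) * sdMass k θ D e.1 := by
  have : Finite (A → Matrix (Σ i, Fin (e.1 i)) (Σ i, Fin (e.1 i)) k) := Pi.finite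
  rw [oriDTSeries, sdMass, finsum_quotient_eq (st := SDRep.isometrySetoid D k)
    (fun z : sdMat D k (stdColor e.1) => sdRepOf z.2)
    (fun M => Nat.card (M.Isometry M)) (P := fun M => M.toRep.dim = e.1 ∧ M.Semistable θ)
    (fun U V ⟨f⟩ h => ⟨f.1.dim_eq.symm.trans h.1, f.symm.semistable h.2⟩)
    (G := Nat.card (gradedGL k (stdColor e.1))) Nat.card_pos.ne'
    (fun M hM => ncard_sdRepOf_mul_card hM.1)]
  congr 3
  refine Set.ncard_congr (fun z _ => z.1) ?_ (fun _ _ _ _ => Subtype.ext) ?_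
  · rintro ⟨⟨m, b⟩, hz⟩ ⟨-, h⟩
    exact ⟨hz, (semistable_sdRepOf_iff hz hθ e.2).1 h⟩
  · rintro ⟨m, b⟩ ⟨hz, h⟩
    exact ⟨⟨(m, b), hz⟩, ⟨repOf_dim m, (semistable_sdRepOf_iff hz hθ e.2).2 h⟩, rfl⟩

end

end OrientifoldDT

/-! ### The wall-crossing formula. -/

theorem mainTheorem1 {I : Type*} {A : Type*} [Fintype I] [DecidableEq I] [Fintype A] [DecidableEq A]
    (Q : OrientifoldDT.FQuiver I A) (σ : Q.Involution) (D : OrientifoldDT.DualityStructure σ)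
    (k : Type*) [Field k] [Finite k] (hk : ringChar k ≠ 2)
    (θ θ' : Module.Dual ℤ (I → ℤ)) (hθ : σ.Compatible θ) (hθ' : σ.Compatible θ') :
    ∃ P P' : OrientifoldDT.QTorus Q k,
      OrientifoldDT.IsSlopeProduct
        (fun μ : {μ : ℚ // 0 < μ} => OrientifoldDT.dtSeries Q k θ μ.1) P ∧
      OrientifoldDT.IsSlopeProduct
        (fun μ : {μ : ℚ // 0 < μ} => OrientifoldDT.dtSeries Q k θ' μ.1) P' ∧
      P • OrientifoldDT.oriDTSeries D k θ = P' • OrientifoldDT.oriDTSeries D k θ' := by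
  have h2 : (2 : k) ≠ 0 := Ring.two_ne_zero hk
  refine ⟨_, _, OrientifoldDT.isSlopeProduct_positive θ (OrientifoldDT.dtSeries_eq θ),
    OrientifoldDT.isSlopeProduct_positive θ' (OrientifoldDT.dtSeries_eq θ'), ?_⟩
  funext e
  rw [OrientifoldDT.smul_eq_total θ D h2 hθ (fun _ => rfl) (OrientifoldDT.oriDTSeries_eq hθ),
    OrientifoldDT.smul_eq_total θ' D h2 hθ' (fun _ => rfl) (OrientifoldDT.oriDTSeries_eq hθ')]

end
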